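/- Let $\lambda$ be a $\sigma$-finite measure on a measurable space $\mathbb X$, and let $\eta$ be a Poisson process on $\mathbb X$ with intensity measure $\lambda$, i.e. a random integer-valued (values in $\{0,1,\dots\}\cup\{\infty\}$) $\sigma$-finite measure, defined on a probability space, whose values on disjoint measurable sets are independent and such that $\eta(B)$ is Poisson distributed with mean $\lambda(B)$ whenever $\lambda(B)<\infty$. For $n\in\mathbb N=\{1,2,\dots\}$ let $L^1_s(\lambda^n)$ be the set of measurable, symmetric, $\lambda^n$-integrable functions $f:\mathbb X^n\to\mathbb R$, and for such $f$ let $$I_n(f)=\sum_{J\subset[n]}(-1)^{n-|J|}\iint f(x_1,\dots,x_n)\,\eta^{(|J|)}(dx_J)\,\lambda^{n-|J|}(dx_{J^c})$$ be the pathwise multiple Wiener–Itô integral, where $[n]=\{1,\dots,n\}$, $J^c=[n]\setminus J$, and $\eta^{(m)}$ is the $m$-th factorial measure of $\eta$, $$\int g\,d\eta^{(m)}=\int\!\cdots\!\int g(x_1,\dots,x_m)\Big(\eta-\sum_{j<m}\delta_{x_j}\Big)(dx_m)\cdots(\eta-\delta_{x_1})(dx_2)\,\eta(dx_1).$$ For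 $n_1,\dots,n_\ell\in\mathbb N$ divide $[n_1+\dots+n_\ell]$ into consecutive rows $J_1,\dots,J_\ell$ with $|J_i|=n_i$. Let $\Pi(n_1,\dots,n_\ell)$ be the set of all (non-flat) partitions $\sigma$ of $[n_1+\dots+n_\ell]$ every block of which contains at most one element of each row; let $\Pi_{\ge2}(n_1,\dots,n_\ell)$ be the set of those $\sigma\in\Pi(n_1,\dots,n_\ell)$ all of whose blocks have at least two elements; and let $\tilde\Pi_{\ge2}(n_1,\dots,n_\ell)$ be the set of those $\sigma\in\Pi_{\ge2}(n_1,\dots,n_\ell)$ that are connected, i.e. for which the finest partition of $[\ell]$ that puts $i$ and $j$ into the same block whenever some block of $\sigma$ meets both $J_i$ and $J_j$ is $\{[\ell]\}$. Write $(\otimes_{i=1}^\ell f_{n_i})(x)=\prod_{i=1}^\ell f_{n_i}(x_{J_i})$, where $x_{J_i}=(x_j)_{j\in J_i}$; let $|\sigma|$ be the number of blocks of $\sigma$, and for a function $h$ on $\mathbb X^{n_1+\dots+n_\ell}$ let $h_\sigma$ be the function on $\mathbb X^{|\sigma|}$ obtained from $h$ by identifying the arguments that belong to the same block of $\sigma$.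 Let $\ell\in\mathbb N$ and $f_n\in L^1_s(\lambda^n)$, $n\in\mathbb N$, and assume that $$\int(\otimes_{i=1}^\ell|f_{n_i}|)_\sigma\,d\lambda^{|\sigma|}<\infty\qquad\text{for all }n_1,\dots,n_\ell\in\mathbb N\text{ and }\sigma\in\Pi(n_1,\dots,n_\ell),$$ and that $\mathbb E\big(\sum_{n=1}^\infty|I_n(f_n)|\big)^\ell<\infty$. Then $F:=\sum_{n=1}^\infty I_n(f_n)$ satisfies $\mathbb E|F|^\ell<\infty$, and its $\ell$-th moment and its $\ell$-th cumulant $\gamma_\ell(F)=\gamma(F,\dots,F)$, where $$\gamma(X_1,\dots,X_\ell)=(-\mathbf i)^\ell\frac{\partial^\ell}{\partial z_1\cdots\partial z_\ell}\log\mathbb E\,e^{\mathbf i(z_1X_1+\dots+z_\ell X_\ell)}\Big|_{z_1=\dots=z_\ell=0},$$ are given by $$\mathbb E F^\ell=\sum_{n_1,\dots,n_\ell\in\mathbb N}\ \sum_{\sigma\in\Pi_{\ge2}(n_1,\dots,n_\ell)}\int(\otimes_{i=1}^\ell f_{n_i})_\sigma\,d\lambda^{|\sigma|},$$ $$\gamma_\ell(F)=\sum_{n_1,\dots,n_\ell\in\mathbb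 N}\ \sum_{\sigma\in\tilde\Pi_{\ge2}(n_1,\dots,n_\ell)}\int(\otimes_{i=1}^\ell f_{n_i})_\sigma\,d\lambda^{|\sigma|},$$ where the outer series, with the finite inner sums as their terms, converge unconditionally. -/

import Mathlib

open MeasureTheory ProbabilityTheory

noncomputable section

namespace PoissonChaos

/-! ### Poisson processes -/

/-- `η` is a Poisson process with intensity measure `lam`, defined on the probability space
`(Ω, P)`: a random element of the space of integer-valued (including `∞`) `σ`-finite measures,
with independent values on disjoint sets, and with `η(B)` Poisson distributed with mean `lam B`
for all measurable `B` of finite intensity. (`Measure X` carries the `σ`-field generated by the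
evaluations `μ ↦ μ B` at measurable sets.) -/
structure IsPoissonProcess {Ω X : Type*} [MeasurableSpace Ω] [MeasurableSpace X]
    (η : Ω → Measure X) (lam : Measure X) (P : Measure Ω) : Prop where
  measurable : Measurable η
  integerValued : ∀ ω, ∀ B : Set X, MeasurableSet B → ∃ k : ℕ∞, η ω B = (k : ENNReal)
  sigmaFinite : ∀ ω, SigmaFinite (η ω)
  law : ∀ B : Set X, MeasurableSet B → lam B < ⊤ → ∀ k : ℕ,
    P {ω | η ω B = (k : ENNReal)} = poissonMeasure (lam B).toNNReal {k}
  indep : ∀ (k : ℕ) (B : Fin k → Set X), (∀ i, MeasurableSet (B i)) →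
    Pairwise (fun i j => Disjoint (B i) (B j)) → iIndepFun (fun i ω => η ω (B i)) P

/-! ### Factorial measures and multiple Wiener-Itô integrals -/

/-- The iterated integral
`∫ ⋯ ∫ f(x₁,…,x_m) (μ - ∑_{p ∈ ps} δ_p - ∑_{j < m} δ_{x_j})(dx_m) ⋯ (μ - ∑_{p ∈ ps} δ_p)(dx₁)`,
where the integral of `g` against a difference `μ - ∑ δ_p` is `∫ g dμ - ∑ g(p)`. -/
def facIntegralAux {X : Type*} [MeasurableSpace X] (μ : Measure X) :
    (m : ℕ) → List X → ((Fin m → X) → ℝ) → ℝ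
  | 0, _, f => f Fin.elim0
  | m + 1, ps, f =>
    (∫ x, facIntegralAux μ m (x :: ps) (fun y => f (Fin.cons x y)) ∂μ)
      - (ps.map fun p => facIntegralAux μ m (p :: ps) (fun y => f (Fin.cons p y))).sum

/-- The integral `∫ f dμ^{(m)}` of `f` against the `m`-th factorial measure of `μ`. -/
def facIntegral {X : Type*} [MeasurableSpace X] (μ : Measure X) {m : ℕ}
    (f : (Fin m → X) → ℝ) : ℝ :=
  facIntegralAux μ m [] f

/-- The point of `X^n` whose coordinates in `J` are, in increasing order of the indices, those
of `x`, and whose coordinates outside `J` are those of `y`. -/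
def glue {X : Type*} {n : ℕ} (J : Finset (Fin n)) (x : Fin J.card → X)
    (y : {i : Fin n // i ∉ J} → X) : Fin n → X :=
  fun i => if h : i ∈ J then x ((J.orderIsoOfFin rfl).symm ⟨i, h⟩) else y ⟨i, h⟩

/-- The pathwise multiple Wiener-Itô integral
`I_n(f) = ∑_{J ⊆ [n]} (-1)^{n-|J|} ∬ f(x₁,…,x_n) μ^{(|J|)}(dx_J) lam^{n-|J|}(dx_{J^c})`,
evaluated at the realization `μ` of the Poisson process (the `μ^{(|J|)}`-integral is the
inner one). -/
def wienerIto {X : Type*} [MeasurableSpace X] (lam : Measure X) {n : ℕ}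
    (f : (Fin n → X) → ℝ) (μ : Measure X) : ℝ :=
  ∑ J : Finset (Fin n), (-1 : ℝ) ^ (n - J.card) *
    ∫ y : {i : Fin n // i ∉ J} → X, facIntegral μ (fun x => f (glue J x y))
      ∂(Measure.pi fun _ => lam)

/-- The space of measurable, symmetric and `lam^n`-integrable functions on `X^n`. -/
structure IsL1Symm {X : Type*} [MeasurableSpace X] (lam : Measure X) {n : ℕ}
    (f : (Fin n → X) → ℝ) : Prop where
  measurable : Measurable f
  symm : ∀ (π : Equiv.Perm (Fin n)) (x : Fin n → X), f (x ∘ π) = f x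
  integrable : Integrable f (Measure.pi fun _ => lam)

/-! ### Diagrams

The set `[n₁ + ⋯ + n_ℓ]` is realized as the set of pairs `⟨i, j⟩` with `i ∈ [ℓ]`, `j ∈ [n_i]`;
its `i`-th row `J_i` consists of the pairs with first entry `i`. -/

/-- The entries of a diagram with rows of lengths `n₁, …, n_ℓ`. -/
abbrev Cell {ℓ : ℕ} (n : Fin ℓ → ℕ+) : Type := Σ i : Fin ℓ, Fin (n i : ℕ)

/-- Partitions of the set of entries into non-empty blocks. -/
abbrev Partn {ℓ : ℕ} (n : Fin ℓ → ℕ+) : Type :=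
  Finpartition (Finset.univ : Finset (Cell n))

/-- The non-flat partitions `Π(n₁, …, n_ℓ)`: every block has at most one element in each row. -/
def nonFlat {ℓ : ℕ} (n : Fin ℓ → ℕ+) : Set (Partn n) :=
  {σ | ∀ B ∈ σ.parts, ∀ i : Fin ℓ, (B.filter fun a => a.1 = i).card ≤ 1}

/-- `Π_{≥2}(n₁, …, n_ℓ)`: non-flat partitions all of whose blocks have at least two elements. -/
def nonFlatGeTwo {ℓ : ℕ} (n : Fin ℓ → ℕ+) : Set (Partn n) :=
  {σ | σ ∈ nonFlat n ∧ ∀ B ∈ σ.parts, 2 ≤ B.card}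

/-- The rows `i` and `j` are both intersected by a common block of `σ`. -/
def RowsMeet {ℓ : ℕ} {n : Fin ℓ → ℕ+} (σ : Partn n) (i j : Fin ℓ) : Prop :=
  ∃ B ∈ σ.parts, (∃ a ∈ B, a.1 = i) ∧ (∃ b ∈ B, b.1 = j)

/-- The induced partition `σ*` of `[ℓ]`, as an equivalence relation: the finest one for which any
two rows intersected by a common block of `σ` are equivalent. -/
def rowPartition {ℓ : ℕ} {n : Fin ℓ → ℕ+} (σ : Partn n) : Setoid (Fin ℓ) :=
  Relation.EqvGen.setoid (RowsMeet σ)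

/-- The connected partitions `Π̃_{≥2}(n₁, …, n_ℓ)`: those `σ ∈ Π_{≥2}(n₁, …, n_ℓ)` for which
`σ*` has exactly one block. -/
def connectedGeTwo {ℓ : ℕ} (n : Fin ℓ → ℕ+) : Set (Partn n) :=
  {σ | σ ∈ nonFlatGeTwo n ∧ Nat.card (Quotient (rowPartition σ)) = 1}

/-- The block of `σ` that contains the entry `a`. -/
def blockOf {ℓ : ℕ} {n : Fin ℓ → ℕ+} (σ : Partn n) (a : Cell n) : {B // B ∈ σ.parts} :=
  ⟨σ.part a, σ.part_mem.2 (Finset.mem_univ a)⟩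

/-- The tensor product of `f₁, …, f_ℓ`. -/
def tensor {X : Type*} {ℓ : ℕ} {n : Fin ℓ → ℕ+} (f : (i : Fin ℓ) → (Fin (n i : ℕ) → X) → ℝ) :
    (Cell n → X) → ℝ :=
  fun x => ∏ i, f i (fun j => x ⟨i, j⟩)

/-- The function `h_σ` obtained from `h` by identifying the arguments that belong to the same
block of `σ`; its arguments are indexed by the blocks of `σ`. -/
def identify {X : Type*} {ℓ : ℕ} {n : Fin ℓ → ℕ+} (σ : Partn n) (h : (Cell n → X) → ℝ) :
    ({B // B ∈ σ.parts} → X) → ℝ :=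
  fun y => h (fun a => y (blockOf σ a))

/-- `∫ (⊗_i f_i)_σ d lam^{|σ|}`. -/
def partitionIntegral {X : Type*} [MeasurableSpace X] (lam : Measure X) {ℓ : ℕ}
    {n : Fin ℓ → ℕ+} (f : (i : Fin ℓ) → (Fin (n i : ℕ) → X) → ℝ) (σ : Partn n) : ℝ :=
  ∫ y, identify σ (tensor f) y ∂(Measure.pi fun _ => lam)

/-! ### Cumulants -/

/-- The partial derivative `∂G/∂z_i`. -/
def partialDeriv {ℓ : ℕ} (i : Fin ℓ) (G : (Fin ℓ → ℝ) → ℂ) : (Fin ℓ → ℝ) → ℂ :=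
  fun z => deriv (fun t : ℝ => G (Function.update z i t)) (z i)

/-- The mixed partial derivative `∂^ℓ G / ∂z₁ ⋯ ∂z_ℓ`. -/
def mixedPartialDeriv {ℓ : ℕ} (G : (Fin ℓ → ℝ) → ℂ) : (Fin ℓ → ℝ) → ℂ :=
  (List.finRange ℓ).foldr partialDeriv G

/-- The joint cumulant
`γ(X₁,…,X_ℓ) = (-𝐢)^ℓ ∂^ℓ/∂z₁⋯∂z_ℓ log E exp(𝐢(z₁X₁+⋯+z_ℓX_ℓ))` at `z = 0`.
The characteristic function is close to `1` for `z` close to `0`, so the principal branch of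
the logarithm is the right one there. -/
def jointCumulant {Ω : Type*} [MeasurableSpace Ω] (P : Measure Ω) {ℓ : ℕ}
    (Y : Fin ℓ → Ω → ℝ) : ℂ :=
  (-Complex.I) ^ ℓ * mixedPartialDeriv
    (fun z => Complex.log (∫ ω, Complex.exp (Complex.I * ((∑ i, z i * Y i ω : ℝ) : ℂ)) ∂P)) 0

/-- The `ℓ`-th cumulant `γ_ℓ(Y) = γ(Y, …, Y)` of a random variable `Y`. -/
def cumulant {Ω : Type*} [MeasurableSpace Ω] (P : Measure Ω) (ℓ : ℕ) (Y : Ω → ℝ) : ℂ :=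
  jointCumulant P (fun _ : Fin ℓ => Y)

/-- The random variable `F = ∑_{n ≥ 1} I_n(f_n)`. -/
def chaosSum {Ω X : Type*} [MeasurableSpace X] (η : Ω → Measure X) (lam : Measure X)
    (f : (n : ℕ+) → (Fin (n : ℕ) → X) → ℝ) : Ω → ℝ :=
  fun ω => ∑' n : ℕ+, wienerIto lam (f n) (η ω)

end PoissonChaos

end

/-!
# Moments and cumulants of Poisson chaos series

*Product formula.* Almost surely, `I_n(f)` is the alternating sum over `J ⊆ [n]` of the integrals
of `f` against `η^{(|J|)} ⊗ lam^{n-|J|}`. An integer-valued `σ`-finite measure on a space with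
countably many separating sets is a sum of Dirac measures (`IntegerValued.eq_sum_dirac`), so that
`η^{(m)}` is the sum of the Dirac measures at all `m`-tuples of distinct points (`facMeasure`), with
intensity measure `lam^m` (`IsPoissonProcess.bind_facMeasure`). A product of factorial measures
is the sum over all non-flat partitions `σ` of one factorial measure whose arguments are identified
along `σ` (`lintegral_pi_facMeasure`). When the expectation of `∏ I_{n_i}(f_{n_i})` is
expanded, a partition occurs once for each set of its singletons that is integrated against `lam`;
because of the signs only the partitions without singletons survive
(`IsPoissonProcess.integral_prod_wienerIto`). A general space `X` is mapped to a standard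
Borel space through which the finitely many kernels factor (`exists_code`,
`integral_prod_wienerIto`).

*Moments.* As `E (∑ |I_n(f_n)|)^ℓ < ∞`, the power `F^ℓ` may be expanded and integrated term by
term (`hasSum_integral_prod`).

*Cumulants.* The `ℓ`-th cumulant is `(-i)^ℓ` times the `ℓ`-th derivative at `0` of the logarithm of
the characteristic function `φ`, and differentiating `φ' = φ (log φ)'` expresses the moments through
the cumulants and moments of lower order (`moment_succ_eq_sum`). Diagram sums satisfy the same
recursion: a partition splits into the connected component of a fixed row and a partition of the
remaining rows, and its integral is the product of the integrals of the two parts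
(`diagramSum_eq_sum_component`). By induction on the number of rows, the connected diagrams yield
the cumulants (`hasSum_connectedSum`). The induction needs the integrability hypothesis for subsets
of the rows, which follows by filling the other rows with a function that does not vanish
(`DiagramIntegrable.subtype`).

Partitions of diagrams are handled as equivalence relations (`diagMeasure`, `NonFlat`, `GeTwo`,
`Connected`), with rows indexed by an arbitrary finite type; `blockSetoid` translates from
partitions into blocks.
-/

noncomputable section

namespace PoissonChaos

/-! ### Atoms of integer-valued measures -/

/-- The measure `μ` takes values in `{0, 1, …} ∪ {∞}` on measurable sets. -/
def IntegerValued {Y : Type*} [MeasurableSpace Y] (μ : Measure Y) : Prop :=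
  ∀ B : Set Y, MeasurableSet B → ∃ k : ℕ∞, μ B = (k : ENNReal)

/-- The points of a measure `μ`, counted with multiplicity: an atom `y` contributes `μ {y}`
indices. -/
abbrev Points {Y : Type*} [MeasurableSpace Y] (μ : Measure Y) : Type _ :=
  Σ y : Y, Fin ⌊(μ {y}).toReal⌋₊

section Atoms

variable {Y : Type*} [MeasurableSpace Y] {μ : Measure Y}

lemma IntegerValued.exists_nat (h : IntegerValued μ) {B : Set Y} (hB : MeasurableSet B)
    (hfin : μ B ≠ ⊤) : ∃ k : ℕ, μ B = k := by
  obtain ⟨k, hk⟩ := h B hB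
  induction k using ENat.recTopCoe with
  | top => simp [hk] at hfin
  | coe k => exact ⟨k, by simpa using hk⟩

/-- A set of finite positive mass contains an atom: on a subset of minimal positive mass, the
measure only takes two values, so that it is concentrated in a point. -/
lemma IntegerValued.exists_atom [MeasurableSpace.CountablySeparated Y]
    [MeasurableSingletonClass Y] (h : IntegerValued μ) {B : Set Y} (hB : MeasurableSet B)
    (hpos : μ B ≠ 0) (hfin : μ B ≠ ⊤) : ∃ y ∈ B, μ {y} ≠ 0 := by
  classical
  have hex : ∃ n : ℕ, n ≠ 0 ∧ ∃ A ⊆ B, MeasurableSet A ∧ μ A = n := by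
    obtain ⟨k, hk⟩ := h.exists_nat hB hfin
    exact ⟨k, by rintro rfl; simp [hk] at hpos, B, subset_rfl, hB, hk⟩
  obtain ⟨hn, A, hAB, hA, hAn⟩ := Nat.find_spec hex
  have hmin := fun m => @Nat.find_min' _ _ hex m
  set n := Nat.find hex
  have key : ∀ U : Set Y, MeasurableSet U → μ (A ∩ U) = 0 ∨ μ (A \ U) = 0 := by
    intro U hU
    by_contra! hcon
    have hle : μ (A ∩ U) + μ (A \ U) = n := by rw [measure_inter_add_sdiff A hU, hAn]
    have h1 : μ (A ∩ U) ≠ ⊤ := by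
      intro h'; rw [h', top_add] at hle; simp at hle
    obtain ⟨k, hk⟩ := h.exists_nat (hA.inter hU) h1
    have hk0 : k ≠ 0 := by rintro rfl; exact hcon.1 (by simpa using hk)
    have h3 : n ≤ k := hmin k ⟨hk0, A ∩ U, Set.inter_subset_left.trans hAB, hA.inter hU, hk⟩
    have h4 : (n : ENNReal) + μ (A \ U) ≤ n + 0 := by
      rw [hk] at hle
      calc (n : ENNReal) + μ (A \ U) ≤ k + μ (A \ U) := by gcongr
        _ = n + 0 := by rw [hle, add_zero]
    exact hcon.2 (le_antisymm ((ENNReal.add_le_add_iff_left (by simp)).1 h4) bot_le)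
  have hne : Nonempty Y := by
    by_contra hY
    rw [not_nonempty_iff] at hY
    exact hpos (by rw [Set.eq_empty_of_isEmpty B, measure_empty])
  obtain ⟨y, hy⟩ := Filter.exists_eventuallyEq_const_of_forall_separating
    (l := ae (μ.restrict A)) (f := (id : Y → Y)) MeasurableSet (fun U hU => by
      rcases key U hU with h0 | h0
      · right
        change ∀ᵐ x ∂(μ.restrict A), x ∉ U
        rw [ae_iff, Measure.restrict_apply (by simpa using hU)]
        simpa [Set.inter_comm] using h0
      · left
        change ∀ᵐ x ∂(μ.restrict A), x ∈ U
        rw [ae_iff, Measure.restrict_apply (by exact hU.compl)]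
        rw [← h0]
        congr 1
        ext; simp [and_comm])
  have hy' : μ (A \ {y}) = 0 := by
    have : ∀ᵐ x ∂(μ.restrict A), x ∈ ({y} : Set Y) := hy
    rw [ae_iff, Measure.restrict_apply (by exact (MeasurableSet.singleton y).compl)] at this
    rw [← this]
    congr 1
    ext; simp [and_comm]
  have hyA : μ (A ∩ {y}) ≠ 0 := by
    have := measure_inter_add_sdiff (μ := μ) A (MeasurableSet.singleton y)
    rw [hy', add_zero, hAn] at this
    rw [this]
    exact_mod_cast hn
  by_cases hyB : y ∈ A
  · refine ⟨y, hAB hyB, fun h0 => hyA (measure_mono_null Set.inter_subset_right h0)⟩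
  · exact absurd (by rw [Set.inter_singleton_eq_empty.2 hyB, measure_empty]) hyA

lemma measure_singleton_ne_top [SigmaFinite μ] (y : Y) : μ {y} ≠ ⊤ := by
  have hy : y ∈ ⋃ N, spanningSets μ N := by rw [iUnion_spanningSets]; trivial
  obtain ⟨N, hN⟩ := Set.mem_iUnion.1 hy
  exact ((measure_mono (Set.singleton_subset_iff.2 hN)).trans_lt
    (measure_spanningSets_lt_top μ N)).ne

lemma countable_atoms [SigmaFinite μ] [MeasurableSingletonClass Y] :
    {y | μ {y} ≠ 0}.Countable := by
  have := Measure.countable_meas_pos_of_disjoint_iUnion (μ := μ) (As := fun y : Y => {y})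
    (fun y => MeasurableSet.singleton y)
    (fun i j hij => by simpa [Function.onFun] using hij)
  simpa [pos_iff_ne_zero] using this

lemma countable_points [SigmaFinite μ] [MeasurableSingletonClass Y] : Countable (Points μ) := by
  have : Countable {y | μ {y} ≠ 0} := countable_atoms.to_subtype
  let g : Points μ → Σ y : {y | μ {y} ≠ 0}, Fin ⌊(μ {y.1}).toReal⌋₊ := fun p =>
    ⟨⟨p.1, fun h0 => by
      have h1 : p.2.1 < ⌊(μ {p.1}).toReal⌋₊ := p.2.2
      simp [h0] at h1⟩, p.2⟩
  have hg : Function.Injective g := by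
    rintro ⟨y, k⟩ ⟨y', k'⟩ h
    simp only [g, Sigma.mk.injEq, Subtype.mk.injEq] at h
    obtain ⟨rfl, h2⟩ := h
    simpa using h2
  exact hg.countable

lemma IntegerValued.floor_eq [SigmaFinite μ] [MeasurableSingletonClass Y]
    (h : IntegerValued μ) (y : Y) : ((⌊(μ {y}).toReal⌋₊ : ℕ) : ENNReal) = μ {y} := by
  obtain ⟨k, hk⟩ := h.exists_nat (MeasurableSet.singleton y) (measure_singleton_ne_top y)
  rw [hk]; simp

/-- An integer-valued `σ`-finite measure is the sum of the Dirac measures at its points. -/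
lemma IntegerValued.eq_sum_dirac [MeasurableSpace.CountablySeparated Y]
    [MeasurableSingletonClass Y] [SigmaFinite μ] (h : IntegerValued μ) :
    μ = Measure.sum fun i : Points μ => Measure.dirac i.1 := by
  have hS := countable_atoms (μ := μ)
  have hSc : μ {y | μ {y} ≠ 0}ᶜ = 0 := by
    by_contra hne
    obtain ⟨N, hN⟩ : ∃ N, μ ({y | μ {y} ≠ 0}ᶜ ∩ spanningSets μ N) ≠ 0 := by
      by_contra! hall
      apply hne
      have : {y | μ {y} ≠ 0}ᶜ = ⋃ N, ({y | μ {y} ≠ 0}ᶜ ∩ spanningSets μ N) := by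
        rw [← Set.inter_iUnion, iUnion_spanningSets, Set.inter_univ]
      rw [this]
      exact measure_iUnion_null hall
    obtain ⟨y, hy, hy'⟩ := h.exists_atom
      (hS.measurableSet.compl.inter (measurableSet_spanningSets μ N)) hN
      ((measure_mono Set.inter_subset_right).trans_lt (measure_spanningSets_lt_top μ N)).ne
    exact hy.1 hy'
  ext s hs
  rw [Measure.sum_apply _ hs, ENNReal.tsum_sigma']
  have h1 : ∀ y, ∑' b : Fin ⌊(μ {y}).toReal⌋₊, Measure.dirac y s =
      s.indicator (fun y => μ {y}) y := by
    intro y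
    rw [Measure.dirac_apply' _ hs, tsum_fintype, Finset.sum_const, Finset.card_univ,
      Fintype.card_fin, nsmul_eq_mul, h.floor_eq]
    by_cases hy : y ∈ s <;> simp [hy]
  simp only [h1]
  have h2 : μ s = μ (s ∩ {y | μ {y} ≠ 0}) := by
    rw [← measure_inter_add_sdiff (μ := μ) s hS.measurableSet]
    rw [measure_mono_null (s := s \ {y | μ {y} ≠ 0}) (t := {y | μ {y} ≠ 0}ᶜ)
      (fun x hx => hx.2) hSc, add_zero]
  have h3 : s ∩ {y | μ {y} ≠ 0} = ⋃ y ∈ s ∩ {y | μ {y} ≠ 0}, {y} :=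
    (Set.biUnion_of_singleton _).symm
  rw [h2, h3, measure_biUnion (hS.mono Set.inter_subset_right)
    (fun i _ j _ hij => by simpa [Function.onFun] using hij)
    (fun y _ => MeasurableSet.singleton y), tsum_subtype (s ∩ {y | μ {y} ≠ 0}) fun y => μ {y}]
  congr 1
  ext y
  by_cases hy : y ∈ s <;> by_cases hy' : μ {y} = 0 <;> simp [hy, hy', Set.indicator]

end Atoms

/-! ### Factorial measures as sums over distinct points -/

/-- The factorial measure of `μ` on `Y^κ`, for an integer-valued measure `μ`: the sum of the
Dirac measures at all `κ`-tuples of distinct points of `μ`. The coordinates are indexed by an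
arbitrary type `κ`. -/
def facMeasure {Y : Type*} [MeasurableSpace Y] (κ : Type*) (μ : Measure Y) : Measure (κ → Y) :=
  Measure.sum fun i : κ ↪ Points μ => Measure.dirac fun a => (i a).1

/-- A `Fin (m + 1)`-tuple of distinct elements avoiding a list consists of its first entry and of
a tuple avoiding the enlarged list. -/
def embeddingAvoidSucc {P : Type*} (m : ℕ) (us : List P) :
    (Σ p : {p : P // p ∉ us}, {i : Fin m ↪ P // ∀ a, i a ∉ (p.1 :: us)}) ≃
      {i : Fin (m + 1) ↪ P // ∀ a, i a ∉ us} where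
  toFun q := ⟨⟨Fin.cons q.1.1 q.2.1, by
      rw [Fin.cons_injective_iff]
      refine ⟨?_, q.2.1.injective⟩
      rintro ⟨a, ha⟩
      exact q.2.2 a (by rw [ha]; exact List.mem_cons_self)⟩, fun a => by
      refine Fin.cases ?_ (fun a => ?_) a
      · exact q.1.2
      · exact fun h => q.2.2 a (List.mem_cons_of_mem _ h)⟩
  invFun i := ⟨⟨i.1 0, i.2 0⟩, ⟨⟨fun a => i.1 a.succ, fun a b h => by simpa using h⟩, fun a h => by
    rcases List.mem_cons.1 h with h | h
    · simpa using i.1.injective h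
    · exact i.2 _ h⟩⟩
  left_inv q := by
    obtain ⟨⟨p, hp⟩, ⟨i, hi⟩⟩ := q
    rfl
  right_inv i := by
    ext a
    refine Fin.cases ?_ (fun a => ?_) a <;> rfl

section

variable {Y : Type*} [MeasurableSpace Y] {μ : Measure Y}

lemma countable_embedding {κ P : Type*} [Finite κ] [Countable P] : Countable (κ ↪ P) :=
  (DFunLike.coe_injective (F := κ ↪ P)).countable

lemma lintegral_facMeasure {κ : Type*} {h : (κ → Y) → ENNReal} (hh : Measurable h) :
    ∫⁻ x, h x ∂(facMeasure κ μ) = ∑' i : κ ↪ Points μ, h fun a => (i a).1 := by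
  simp_rw [facMeasure, lintegral_sum_measure, lintegral_dirac' _ hh]

lemma facMeasure_apply {κ : Type*} {s : Set (κ → Y)} (hs : MeasurableSet s) :
    facMeasure κ μ s = ∑' i : κ ↪ Points μ, s.indicator 1 fun a => (i a).1 := by
  simp_rw [facMeasure, Measure.sum_apply _ hs, Measure.dirac_apply' _ hs]

/-- The iterated integral defining the factorial measure, with the points listed in `us` already
removed, is the sum over the tuples of distinct points outside `us`. The terms belonging to the
removed points cancel exactly, also when they are not integrable. -/
lemma facIntegralAux_eq_tsum [MeasurableSpace.CountablySeparated Y] [MeasurableSingletonClass Y]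
    [SigmaFinite μ] (hμ : IntegerValued μ) (m : ℕ) :
    ∀ (us : List (Points μ)), us.Nodup → ∀ g : (Fin m → Y) → ℝ,
    Summable (fun i : {i : Fin m ↪ Points μ // ∀ a, i a ∉ us} => g fun a => (i.1 a).1) →
    facIntegralAux μ m (us.map Sigma.fst) g =
      ∑' i : {i : Fin m ↪ Points μ // ∀ a, i a ∉ us}, g fun a => (i.1 a).1 := by
  classical
  induction m with
  | zero =>
    intro us _ g _
    rw [facIntegralAux, tsum_eq_single ⟨Function.Embedding.ofIsEmpty, fun a => a.elim0⟩]
    · congr 1; ext a; exact a.elim0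
    · intro b hb
      exact absurd (Subtype.ext (Subsingleton.elim _ _)) hb
  | succ m ih =>
    intro us hus g hg
    have hcount : Countable (Points μ) := countable_points
    rw [← (embeddingAvoidSucc m us).summable_iff] at hg
    refine Eq.trans ?_ (hg.tsum_sigma.symm.trans ((embeddingAvoidSucc m us).tsum_eq
      fun i : {i : Fin (m + 1) ↪ Points μ // ∀ a, i a ∉ us} => g fun a => (i.1 a).1))
    rw [facIntegralAux]
    set G : Y → ℝ := fun y => facIntegralAux μ m (y :: us.map Sigma.fst)
      fun z => g (Fin.cons y z) with hG
    have hval : ∀ p : {p : Points μ // p ∉ us}, G p.1.1 =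
        ∑' c : {i : Fin m ↪ Points μ // ∀ a, i a ∉ (p.1 :: us)},
          ((fun i : {i : Fin (m + 1) ↪ Points μ // ∀ a, i a ∉ us} => g fun a => (i.1 a).1)
            ∘ embeddingAvoidSucc m us) ⟨p, c⟩ := by
      intro p
      have hrw : ∀ c : {i : Fin m ↪ Points μ // ∀ a, i a ∉ (p.1 :: us)},
          (fun a => (((embeddingAvoidSucc m us) ⟨p, c⟩).1 a).1) =
            Fin.cons (α := fun _ => Y) p.1.1 (fun a => (c.1 a).1) := by
        intro c
        ext a
        refine Fin.cases ?_ (fun a => ?_) a <;> rfl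
      have hs := hg.sigma_factor p
      simp only [Function.comp_def, hrw] at hs ⊢
      exact ih (p.1 :: us) (List.nodup_cons.2 ⟨p.2, hus⟩)
        (fun z => g (Fin.cons p.1.1 z)) hs
    rw [← tsum_congr hval]
    have hsum : Summable fun p : {p : Points μ // p ∉ us} => G p.1.1 := by
      simp_rw [hval]
      exact hg.sigma
    have hsum' : Summable fun p : Points μ => G p.1 := by
      rw [← us.toFinset.summable_compl_iff]
      have : ∀ p, p ∉ us.toFinset ↔ p ∉ us := by simp
      exact (Equiv.summable_iff (Equiv.subtypeEquivRight this)
        (f := fun p : {p : Points μ // p ∉ us} => G p.1.1)).2 hsum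
    have hint : ∫ y, G y ∂μ = ∑' p : Points μ, G p.1 := by
      conv_lhs => rw [hμ.eq_sum_dirac]
      have := integral_sum_dirac (x := fun p : Points μ => p.1) (f := G)
        (c := fun _ => 1) (by simp)
      simpa using this
    have hlist : ((us.map Sigma.fst).map G).sum = ∑ p ∈ us.toFinset, G p.1 := by
      rw [List.map_map, List.sum_toFinset _ hus]
      rfl
    change (∫ y, G y ∂μ) - ((us.map Sigma.fst).map G).sum = _
    rw [hint, hlist, ← hsum'.sum_add_tsum_compl (s := us.toFinset), add_sub_cancel_left]
    have : ∀ p, p ∈ ((us.toFinset : Set (Points μ))ᶜ : Set _) ↔ p ∉ us := by simp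
    exact Equiv.tsum_eq (Equiv.subtypeEquivRight this)
      (f := fun p : {p : Points μ // p ∉ us} => G p.1.1)

lemma facIntegral_eq_integral [MeasurableSpace.CountablySeparated Y] [MeasurableSingletonClass Y]
    [SigmaFinite μ] (hμ : IntegerValued μ) {m : ℕ} {g : (Fin m → Y) → ℝ}
    (hg : Integrable g (facMeasure (Fin m) μ)) :
    facIntegral μ g = ∫ x, g x ∂(facMeasure (Fin m) μ) := by
  have hcount : Countable (Points μ) := countable_points
  have hcount' : Countable (Fin m ↪ Points μ) := countable_embedding
  have hs : Summable fun i : Fin m ↪ Points μ => g fun a => (i a).1 := by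
    have := hasSum_integral_measure hg
    simpa using this.summable
  let e := Equiv.subtypeUnivEquiv (p := fun i : Fin m ↪ Points μ => ∀ a, i a ∉ ([] : List _))
    (by simp)
  have h1 := facIntegralAux_eq_tsum hμ m [] List.nodup_nil g (e.summable_iff.2 hs)
  rw [facIntegral, facMeasure, integral_sum_measure hg]
  simp only [integral_dirac]
  refine h1.trans ?_
  exact e.tsum_eq (f := fun i : Fin m ↪ Points μ => g fun a => (i a).1)

end

/-! ### The intensity measures of the factorial measures -/

/-- The falling factorial `t (t - 1) ⋯ (t - m + 1)` with truncated subtraction. -/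
def fallingFactorial (m : ℕ) (t : ENNReal) : ENNReal := ∏ i ∈ Finset.range m, (t - i)

lemma fallingFactorial_natCast (m k : ℕ) :
    fallingFactorial m (k : ENNReal) = (k.descFactorial m : ℕ) := by
  rw [Nat.descFactorial_eq_prod_range, fallingFactorial, Nat.cast_prod]
  exact Finset.prod_congr rfl fun i _ => by rw [ENNReal.natCast_sub]

lemma measurable_fallingFactorial (m : ℕ) : Measurable (fallingFactorial m) := by
  unfold fallingFactorial
  fun_prop

/-- Tuples of distinct points with prescribed sides, grouped by the distinct sides. -/
def embeddingRectangle {κ P L : Type*} (A : L → Set P)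
    (hA : Pairwise (fun l l' => Disjoint (A l) (A l')))
    (c : κ → L) :
    {i : κ ↪ P // ∀ a, i a ∈ A (c a)} ≃ (∀ l : L, {a // c a = l} ↪ A l) where
  toFun i l := ⟨fun a => ⟨i.1 a.1, by simpa only [a.2] using i.2 a.1⟩, fun a b h => by
    have : i.1 a.1 = i.1 b.1 := by simpa using h
    exact Subtype.ext (i.1.injective this)⟩
  invFun q := ⟨⟨fun a => (q (c a) ⟨a, rfl⟩).1, fun a b h => by
    have hc : c a = c b := by
      by_contra hne
      exact Set.disjoint_left.1 (hA hne) (q (c a) ⟨a, rfl⟩).2 (by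
        have := (q (c b) ⟨b, rfl⟩).2
        simp only at h
        rwa [← h] at this)
    have hb : (q (c b) ⟨b, rfl⟩).1 = (q (c a) ⟨b, hc.symm⟩).1 := by
      generalize_proofs h1 h2
      revert h1 h2
      rw [hc]
      intros; rfl
    simp only [hb] at h
    simpa using (q (c a)).injective (Subtype.ext h)⟩, fun a => (q (c a) ⟨a, rfl⟩).2⟩
  left_inv i := by ext a; rfl
  right_inv q := by
    ext l a
    obtain ⟨a, rfl⟩ := a
    rfl

section

variable {Y : Type*} [MeasurableSpace Y] {μ : Measure Y}

/-- The factorial measure of a rectangle whose sides `A (c a)` are equal or disjoint is a product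
of falling factorials. -/
lemma facMeasure_rectangle [MeasurableSpace.CountablySeparated Y] [MeasurableSingletonClass Y]
    [SigmaFinite μ] (hμ : IntegerValued μ) {κ L : Type*} [Fintype κ] [Fintype L]
    (A : L → Set Y) (hAm : ∀ l, MeasurableSet (A l))
    (hA : Pairwise (fun l l' => Disjoint (A l) (A l'))) (hfin : ∀ l, μ (A l) ≠ ⊤) (c : κ → L) :
    facMeasure κ μ (Set.pi Set.univ fun a => A (c a)) =
      ∏ l, fallingFactorial (Nat.card {a // c a = l}) (μ (A l)) := by
  classical
  let AP : L → Set (Points μ) := fun l => {p | p.1 ∈ A l}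
  have hmass : ∀ l, μ (A l) = ((AP l).encard : ENNReal) := by
    intro l
    conv_lhs => rw [hμ.eq_sum_dirac]
    rw [Measure.sum_apply _ (hAm l), ← ENNReal.tsum_set_one, tsum_subtype (AP l) fun _ => 1]
    refine tsum_congr fun p => ?_
    rw [Measure.dirac_apply' _ (hAm l)]
    by_cases hp : p.1 ∈ A l <;> simp [AP, hp, Set.indicator]
  have hAPfin : ∀ l, (AP l).Finite := by
    intro l
    by_contra h
    have h1 := hmass l
    rw [Set.encard_eq_top_iff.2 h] at h1
    exact hfin l (by simpa using h1)
  have : ∀ l, Fintype (AP l) := fun l => (hAPfin l).fintype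
  have hmass' : ∀ l, μ (A l) = (Fintype.card (AP l) : ℕ) := by
    intro l
    rw [hmass, Set.encard_eq_coe_toFinset_card, Set.toFinset_card, ENat.toENNReal_coe]
  have hAP : Pairwise (fun l l' => Disjoint (AP l) (AP l')) := by
    intro l l' hl
    refine Set.disjoint_left.2 fun p hp hp' => Set.disjoint_left.1 (hA hl) hp hp'
  rw [facMeasure_apply (MeasurableSet.univ_pi fun a => hAm _)]
  let S : Set (κ ↪ Points μ) := {i | ∀ a, i a ∈ AP (c a)}
  have h1 : ∀ i : κ ↪ Points μ,
      (Set.pi Set.univ fun a => A (c a)).indicator (1 : (κ → Y) → ENNReal) (fun a => (i a).1) =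
        S.indicator (fun _ => 1) i := by
    intro i
    by_cases hi : i ∈ S
    · have : (fun a => (i a).1) ∈ Set.pi Set.univ fun a => A (c a) := fun a _ => hi a
      simp [hi, this]
    · have : ¬ (fun a => (i a).1) ∈ Set.pi Set.univ fun a => A (c a) :=
        fun h => hi fun a => h a trivial
      rw [Set.indicator_of_notMem this, Set.indicator_of_notMem hi]
  simp_rw [h1]
  rw [← tsum_subtype S fun _ => (1 : ENNReal)]
  rw [← Equiv.tsum_eq (β := S) (embeddingRectangle AP hAP c).symm, tsum_fintype]
  simp only [Finset.sum_const, Finset.card_univ, nsmul_eq_mul, mul_one, Fintype.card_pi,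
    Nat.cast_prod]
  refine Finset.prod_congr rfl fun l _ => ?_
  rw [hmass', fallingFactorial_natCast, Fintype.card_embedding_eq, Nat.card_eq_fintype_card]

end

lemma lintegral_fallingFactorial_poissonMeasure (r : NNReal) (m : ℕ) :
    ∫⁻ k : ℕ, fallingFactorial m (k : ENNReal) ∂(poissonMeasure r) = (r : ENNReal) ^ m := by
  rw [lintegral_countable']
  simp_rw [poissonMeasure_singleton, fallingFactorial_natCast]
  rw [← ENNReal.summable.sum_add_tsum_nat_add' (k := m)]
  rw [Finset.sum_eq_zero, zero_add]
  · have h1 : ∀ j : ℕ, (((j + m).descFactorial m : ℕ) : ENNReal) *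
        ENNReal.ofReal (Real.exp (-r) * r ^ (j + m) / (j + m).factorial) =
        (r : ENNReal) ^ m * ENNReal.ofReal (Real.exp (-r) * r ^ j / j.factorial) := by
      intro j
      rw [← ENNReal.ofReal_natCast, ← ENNReal.ofReal_mul (by positivity),
        ← ENNReal.ofReal_coe_nnreal, ← ENNReal.ofReal_pow (by positivity),
        ← ENNReal.ofReal_mul (by positivity)]
      congr 1
      have h2 := Nat.factorial_mul_descFactorial (n := j + m) (k := m) (by omega)
      rw [Nat.add_sub_cancel] at h2
      rw [← h2]
      have : ((j + m).descFactorial m : ℝ) ≠ 0 := by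
        exact_mod_cast (Nat.pos_of_ne_zero (by
          rw [Ne, Nat.descFactorial_eq_zero_iff_lt]; omega)).ne'
      push_cast
      field_simp
      ring
    simp_rw [h1]
    rw [ENNReal.tsum_mul_left]
    have h3 := hasSum_one_poissonMeasure r
    rw [← ENNReal.ofReal_tsum_of_nonneg (fun _ => by positivity) h3.summable, h3.tsum_eq]
    simp
  · intro k hk
    rw [Nat.descFactorial_eq_zero_iff_lt.2 (Finset.mem_range.1 hk)]
    simp

section

variable {Ω Y : Type*} [MeasurableSpace Ω] [MeasurableSpace Y] {P : Measure Ω}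
  {lam : Measure Y} {η : Ω → Measure Y}

lemma IsPoissonProcess.measurable_apply (hη : IsPoissonProcess η lam P) {B : Set Y}
    (hB : MeasurableSet B) : Measurable fun ω => η ω B :=
  (Measure.measurable_coe hB).comp hη.measurable

lemma IsPoissonProcess.ae_lt_top [IsProbabilityMeasure P] (hη : IsPoissonProcess η lam P)
    {B : Set Y}
    (hB : MeasurableSet B) (hfin : lam B < ⊤) : ∀ᵐ ω ∂P, η ω B < ⊤ := by
  have hm := hη.measurable_apply hB
  have h1 : {ω | η ω B < ⊤} = ⋃ k : ℕ, {ω | η ω B = k} := by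
    ext ω
    simp only [Set.mem_ofPred_eq, Set.mem_iUnion]
    constructor
    · intro h
      exact IntegerValued.exists_nat (hη.integerValued ω) hB h.ne
    · rintro ⟨k, hk⟩
      simp [hk]
  have hms : MeasurableSet {ω | η ω B < ⊤} := hm measurableSet_Iio
  refine (mem_ae_iff_prob_eq_one hms).2 ?_
  rw [h1, measure_iUnion]
  · simp_rw [hη.law B hB hfin]
    have := lintegral_countable' (μ := poissonMeasure (lam B).toNNReal) (fun _ => 1)
    simpa using this.symm
  · intro i j hij
    refine Set.disjoint_left.2 fun ω h h' => hij ?_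
    have : (i : ENNReal) = j := h.symm.trans h'
    exact_mod_cast this
  · intro k
    exact hm (MeasurableSet.singleton _)

/-- The factorial moments of the Poisson distribution. -/
lemma IsPoissonProcess.lintegral_fallingFactorial [IsProbabilityMeasure P]
    (hη : IsPoissonProcess η lam P) {B : Set Y}
    (hB : MeasurableSet B) (hfin : lam B < ⊤) (m : ℕ) :
    ∫⁻ ω, fallingFactorial m (η ω B) ∂P = lam B ^ m := by
  have hm := hη.measurable_apply hB
  let N : Ω → ℕ := fun ω => ⌊(η ω B).toReal⌋₊
  have hN : Measurable N := Nat.measurable_floor.comp hm.ennreal_toReal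
  have hae : ∀ᵐ ω ∂P, η ω B = N ω := by
    filter_upwards [hη.ae_lt_top hB hfin] with ω hω
    obtain ⟨k, hk⟩ := IntegerValued.exists_nat (hη.integerValued ω) hB hω.ne
    simp [N, hk]
  have hmap : P.map N = poissonMeasure (lam B).toNNReal := by
    refine Measure.ext_of_singleton fun k => ?_
    rw [Measure.map_apply hN (MeasurableSet.singleton k), ← hη.law B hB hfin k]
    refine measure_congr ?_
    filter_upwards [hae] with ω hω
    apply propext
    change N ω = k ↔ η ω B = k
    rw [hω]
    norm_cast
  calc ∫⁻ ω, fallingFactorial m (η ω B) ∂P = ∫⁻ ω, fallingFactorial m (N ω : ENNReal) ∂P :=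
        lintegral_congr_ae (by filter_upwards [hae] with ω hω; rw [hω])
    _ = ∫⁻ k : ℕ, fallingFactorial m (k : ENNReal) ∂(P.map N) := by
        rw [lintegral_map (Measurable.of_discrete) hN]
    _ = lam B ^ m := by
        rw [hmap, lintegral_fallingFactorial_poissonMeasure, ENNReal.coe_toNNReal hfin.ne]

lemma IsPoissonProcess.indep_fintype (hη : IsPoissonProcess η lam P) {L : Type*} [Fintype L]
    (A : L → Set Y) (hAm : ∀ l, MeasurableSet (A l))
    (hA : Pairwise (fun l l' => Disjoint (A l) (A l'))) :
    iIndepFun (fun l ω => η ω (A l)) P := by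
  let e := Fintype.equivFin L
  have h := hη.indep (Fintype.card L) (fun i => A (e.symm i)) (fun i => hAm _)
    (fun i j hij => hA (e.symm.injective.ne hij))
  have := h.precomp e.injective
  simpa using this

end

/-- The rectangles in `Y^κ` with measurable sides that are pairwise equal or disjoint. -/
def cubeSystem (κ Y : Type*) [MeasurableSpace Y] : Set (Set (κ → Y)) :=
  {S | ∃ B : κ → Set Y, (∀ a, MeasurableSet (B a)) ∧ (∀ a b, B a = B b ∨ Disjoint (B a) (B b)) ∧
    S = Set.pi Set.univ B}

lemma equal_or_disjoint_inter {Y : Type*} {A B C D : Set Y} (h : A = B ∨ Disjoint A B)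
    (h' : C = D ∨ Disjoint C D) : A ∩ C = B ∩ D ∨ Disjoint (A ∩ C) (B ∩ D) := by
  rcases h with rfl | h
  · rcases h' with rfl | h'
    · exact Or.inl rfl
    · exact Or.inr (h'.mono Set.inter_subset_right Set.inter_subset_right)
  · exact Or.inr (h.mono Set.inter_subset_left Set.inter_subset_left)

lemma isPiSystem_cubeSystem (κ Y : Type*) [MeasurableSpace Y] : IsPiSystem (cubeSystem κ Y) := by
  rintro S ⟨B, hB, hB', rfl⟩ T ⟨C, hC, hC', rfl⟩ _
  refine ⟨fun a => B a ∩ C a, fun a => (hB a).inter (hC a), fun a b => ?_, ?_⟩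
  · exact equal_or_disjoint_inter (hB' a b) (hC' a b)
  · rw [Set.pi_inter_distrib]

/-- A rectangle is a finite union of rectangles whose sides are atoms of the algebra generated by
the original sides, and two such atoms are equal or disjoint. -/
lemma generateFrom_cubeSystem (κ Y : Type*) [Finite κ] [MeasurableSpace Y] :
    (MeasurableSpace.pi : MeasurableSpace (κ → Y)) =
      MeasurableSpace.generateFrom (cubeSystem κ Y) := by
  classical
  apply le_antisymm
  · rw [← generateFrom_pi]
    refine MeasurableSpace.generateFrom_le ?_
    rintro S ⟨B, hB, rfl⟩
    have hB : ∀ a, MeasurableSet (B a) := fun a => hB a trivial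
    let atom : (κ → Prop) → Set Y := fun v => {y | ∀ b, y ∈ B b ↔ v b}
    have hatom : ∀ v, MeasurableSet (atom v) := by
      intro v
      have : atom v = ⋂ b, {y | y ∈ B b ↔ v b} := by ext; simp [atom]
      rw [this]
      refine MeasurableSet.iInter fun b => ?_
      by_cases hv : v b
      · simpa [hv] using hB b
      · simp only [hv, iff_false]
        exact (hB b).compl
    have hu : Set.pi Set.univ B =
        ⋃ V : {V : κ → κ → Prop // ∀ a, V a a}, Set.pi Set.univ fun a => atom (V.1 a) := by
      ext x
      simp only [Set.mem_pi, Set.mem_univ, true_imp_iff, Set.mem_iUnion]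
      constructor
      · intro h
        exact ⟨⟨fun a b => x a ∈ B b, fun a => h a⟩, fun a b => Iff.rfl⟩
      · rintro ⟨V, hV⟩ a
        exact (hV a a).2 (V.2 a)
    rw [hu]
    have : Finite (κ → κ → Prop) := inferInstance
    refine MeasurableSet.iUnion fun V => MeasurableSpace.measurableSet_generateFrom
      ⟨_, fun a => hatom _, fun a b => ?_, rfl⟩
    by_cases h : V.1 a = V.1 b
    · left; rw [h]
    · right
      refine Set.disjoint_left.2 fun y hy hy' => h ?_
      ext c
      exact (hy c).symm.trans (hy' c)
  · refine MeasurableSpace.generateFrom_le ?_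
    rintro S ⟨B, hB, _, rfl⟩
    exact MeasurableSet.univ_pi hB

lemma iUnion_cube_spanningSets {Y : Type*} [MeasurableSpace Y] (lam : Measure Y)
    [SigmaFinite lam] (κ : Type*) [Finite κ] :
    ⋃ N, (Set.pi Set.univ fun _ : κ => spanningSets lam N) = Set.univ := by
  have := Fintype.ofFinite κ
  refine Set.eq_univ_of_forall fun x => Set.mem_iUnion.2 ?_
  refine ⟨Finset.univ.sup fun a => spanningSetsIndex lam (x a), fun a _ => ?_⟩
  exact monotone_spanningSets lam
    (Finset.le_sup (f := fun a => spanningSetsIndex lam (x a)) (Finset.mem_univ a))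
    (mem_spanningSetsIndex lam (x a))

lemma monotone_cube_spanningSets {Y : Type*} [MeasurableSpace Y] (lam : Measure Y)
    [SigmaFinite lam] (κ : Type*) :
    Monotone fun N => (Set.pi Set.univ fun _ : κ => spanningSets lam N) := fun _ _ h =>
  Set.pi_mono fun _ _ => monotone_spanningSets lam h

lemma measure_eq_iSup_cube {Y : Type*} [MeasurableSpace Y] (lam : Measure Y)
    [SigmaFinite lam] {κ : Type*} [Finite κ]
    (ν : Measure (κ → Y)) (S : Set (κ → Y)) :
    ν S = ⨆ N, ν (S ∩ Set.pi Set.univ fun _ => spanningSets lam N) := by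
  rw [← Monotone.measure_iUnion, ← Set.inter_iUnion, iUnion_cube_spanningSets, Set.inter_univ]
  exact fun _ _ h => Set.inter_subset_inter_right _ (monotone_cube_spanningSets lam κ h)

section

variable {Ω Y : Type*} [MeasurableSpace Ω] [MeasurableSpace Y] {P : Measure Ω}
  {lam : Measure Y} {η : Ω → Measure Y}
  [MeasurableSpace.CountablySeparated Y] [MeasurableSingletonClass Y] {κ : Type*} [Fintype κ]

/-- On a rectangle whose sides are pairwise equal or disjoint, the expectation of the factorial
measure follows from the independence of `η` on the distinct sides and from the factorial moments
of the Poisson distribution. -/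
lemma IsPoissonProcess.facMeasure_cube [IsProbabilityMeasure P] (hη : IsPoissonProcess η lam P)
    {B : κ → Set Y} (hB : ∀ a, MeasurableSet (B a)) (hB' : ∀ a b, B a = B b ∨ Disjoint (B a) (B b))
    (hlam : ∀ a, lam (B a) < ⊤) (hfin : ∀ ω a, η ω (B a) < ⊤) :
    Measurable (fun ω => facMeasure κ (η ω) (Set.pi Set.univ B)) ∧
      ∫⁻ ω, facMeasure κ (η ω) (Set.pi Set.univ B) ∂P = ∏ a, lam (B a) := by
  classical
  let A : Set.range B → Set Y := Subtype.val
  let c : κ → Set.range B := Set.rangeFactorization B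
  have : Fintype (Set.range B) := Fintype.ofFinite _
  have hA : ∀ l, MeasurableSet (A l) := by rintro ⟨_, a, rfl⟩; exact hB a
  have hAd : Pairwise fun l l' => Disjoint (A l) (A l') := by
    rintro ⟨_, a, rfl⟩ ⟨_, b, rfl⟩ hne
    exact (hB' a b).resolve_left fun h => hne (Subtype.ext h)
  have heq : ∀ ω, facMeasure κ (η ω) (Set.pi Set.univ B) =
      ∏ l, fallingFactorial (Nat.card {a // c a = l}) (η ω (A l)) := by
    intro ω
    have := hη.sigmaFinite ω
    exact facMeasure_rectangle (hη.integerValued ω) A hA hAd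
      (by rintro ⟨_, a, rfl⟩; exact (hfin ω a).ne) c
  have hmeas : ∀ l, Measurable fun ω =>
      fallingFactorial (Nat.card {a // c a = l}) (η ω (A l)) := fun l =>
    (measurable_fallingFactorial _).comp (hη.measurable_apply (hA l))
  simp_rw [heq]
  refine ⟨Finset.measurable_prod _ fun l _ => hmeas l, ?_⟩
  refine (lintegral_prod_eq_prod_lintegral_of_indepFun Finset.univ _
    ((hη.indep_fintype A hA hAd).comp
      (fun l => fallingFactorial (Nat.card {a // c a = l}))
      (fun l => measurable_fallingFactorial _)) hmeas).trans ?_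
  have h1 : ∀ l, ∫⁻ ω, fallingFactorial (Nat.card {a // c a = l}) (η ω (A l)) ∂P =
      ∏ a : {a // c a = l}, lam (B a) := by
    intro l
    rw [hη.lintegral_fallingFactorial (hA l) (by obtain ⟨_, a, rfl⟩ := l; exact hlam a)]
    have : ∀ a : {a // c a = l}, lam (B a) = lam (A l) := by
      rintro ⟨a, rfl⟩; rfl
    simp [this, Nat.card_eq_fintype_card]
  exact (Finset.prod_congr rfl fun l _ => h1 l).trans (Fintype.prod_fiberwise c fun a => lam (B a))

variable [SigmaFinite lam]

/-- On the cubes of a sequence exhausting the space, the factorial measure of any measurable set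
is a random variable whose expectation is its `lam^κ`-measure. -/
lemma IsPoissonProcess.facMeasure_inter [IsProbabilityMeasure P] (hη : IsPoissonProcess η lam P)
    (hfin : ∀ ω N, η ω (spanningSets lam N) < ⊤) (N : ℕ) {S : Set (κ → Y)}
    (hS : MeasurableSet S) :
    Measurable (fun ω => facMeasure κ (η ω)
      (S ∩ Set.pi Set.univ fun _ => spanningSets lam N)) ∧
      ∫⁻ ω, facMeasure κ (η ω) (S ∩ Set.pi Set.univ fun _ => spanningSets lam N) ∂P =
        Measure.pi (fun _ => lam) (S ∩ Set.pi Set.univ fun _ => spanningSets lam N) := by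
  classical
  set E : Set (κ → Y) := Set.pi Set.univ fun _ => spanningSets lam N with hE
  have hEm : MeasurableSet E := MeasurableSet.univ_pi fun _ => measurableSet_spanningSets lam N
  have hcube := hη.facMeasure_cube (κ := κ) (B := fun _ => spanningSets lam N)
    (fun _ => measurableSet_spanningSets lam N) (fun _ _ => Or.inl rfl)
    (fun _ => measure_spanningSets_lt_top lam N) (fun ω _ => hfin ω N)
  rw [← hE] at hcube
  have hEfin : ∀ ω, facMeasure κ (η ω) E ≠ ⊤ := by
    intro ω
    have := hη.sigmaFinite ω
    have h1 := facMeasure_rectangle (κ := κ) (hη.integerValued ω) (L := Unit)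
      (fun _ => spanningSets lam N)
      (fun _ => measurableSet_spanningSets lam N) (fun a b h => absurd rfl h)
      (fun _ => (hfin ω N).ne) (fun _ => ())
    rw [h1]
    obtain ⟨k, hk⟩ := IntegerValued.exists_nat (hη.integerValued ω)
      (measurableSet_spanningSets lam N) (hfin ω N).ne
    simp [hk, fallingFactorial_natCast]
  have hpiE : Measure.pi (fun _ : κ => lam) E = ∏ _a : κ, lam (spanningSets lam N) := by
    rw [hE, Measure.pi_pi]
  have hpifin : Measure.pi (fun _ : κ => lam) E ≠ ⊤ := by
    rw [hpiE]
    exact ENNReal.prod_ne_top fun _ _ => (measure_spanningSets_lt_top lam N).ne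
  induction S, hS using MeasurableSpace.induction_on_inter (generateFrom_cubeSystem κ Y)
    (isPiSystem_cubeSystem κ Y) with
  | empty => simp
  | basic T hT =>
    obtain ⟨B, hB, hB', rfl⟩ := hT
    rw [hE, ← Set.pi_inter_distrib]
    obtain ⟨h1, h2⟩ := hη.facMeasure_cube (B := fun a => B a ∩ spanningSets lam N)
      (fun a => (hB a).inter (measurableSet_spanningSets lam N))
      (fun a b => equal_or_disjoint_inter (hB' a b) (Or.inl rfl))
      (fun a => (measure_mono Set.inter_subset_right).trans_lt
        (measure_spanningSets_lt_top lam N))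
      (fun ω a => (measure_mono Set.inter_subset_right).trans_lt (hfin ω N))
    exact ⟨h1, by rw [h2, Measure.pi_pi]⟩
  | compl T hT ih =>
    have hset : Tᶜ ∩ E = E \ (T ∩ E) := by ext; simp [and_comm]
    have h1 : ∀ ω, facMeasure κ (η ω) (Tᶜ ∩ E) =
        facMeasure κ (η ω) E - facMeasure κ (η ω) (T ∩ E) := by
      intro ω
      rw [hset, measure_sdiff Set.inter_subset_right (hT.inter hEm).nullMeasurableSet]
      exact ne_top_of_le_ne_top (hEfin ω) (measure_mono Set.inter_subset_right)
    simp_rw [h1]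
    refine ⟨hcube.1.sub ih.1, ?_⟩
    rw [lintegral_sub ih.1 (by
      rw [ih.2]; exact ne_top_of_le_ne_top hpifin (measure_mono Set.inter_subset_right))
      (ae_of_all _ fun ω => measure_mono Set.inter_subset_right), ih.2, hcube.2, ← hpiE, hset,
      measure_sdiff Set.inter_subset_right (hT.inter hEm).nullMeasurableSet]
    exact ne_top_of_le_ne_top hpifin (measure_mono Set.inter_subset_right)
  | iUnion f hf hfm ih =>
    have hd : Pairwise (Function.onFun Disjoint fun i => f i ∩ E) := fun i j hij =>
      (hf hij).mono Set.inter_subset_left Set.inter_subset_left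
    simp_rw [Set.iUnion_inter]
    have h1 : ∀ ω, facMeasure κ (η ω) (⋃ i, f i ∩ E) = ∑' i, facMeasure κ (η ω) (f i ∩ E) :=
      fun ω => measure_iUnion hd fun i => (hfm i).inter hEm
    simp_rw [h1]
    refine ⟨Measurable.tsum fun i => (ih i).1, ?_⟩
    rw [lintegral_tsum fun i => (ih i).1.aemeasurable,
      measure_iUnion hd fun i => (hfm i).inter hEm]
    exact tsum_congr fun i => (ih i).2

lemma IsPoissonProcess.measurable_facMeasure [IsProbabilityMeasure P]
    (hη : IsPoissonProcess η lam P)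
    (hfin : ∀ ω N, η ω (spanningSets lam N) < ⊤) :
    Measurable fun ω => facMeasure κ (η ω) := by
  refine Measure.measurable_of_measurable_coe _ fun S hS => ?_
  simp_rw [measure_eq_iSup_cube lam _ S]
  exact Measurable.iSup fun N => (hη.facMeasure_inter hfin N hS).1

/-- The intensity measure of the factorial measure of a Poisson process is the product measure of
the intensity measure of the process. -/
lemma IsPoissonProcess.bind_facMeasure [IsProbabilityMeasure P] (hη : IsPoissonProcess η lam P)
    (hfin : ∀ ω N, η ω (spanningSets lam N) < ⊤) :
    P.bind (fun ω => facMeasure κ (η ω)) = Measure.pi fun _ => lam := by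
  ext S hS
  rw [measure_eq_iSup_cube lam _ S, measure_eq_iSup_cube lam (Measure.pi fun _ => lam) S]
  congr 1
  ext N
  rw [Measure.bind_apply (hS.inter (MeasurableSet.univ_pi fun _ =>
    measurableSet_spanningSets lam N)) (hη.measurable_facMeasure hfin).aemeasurable]
  exact (hη.facMeasure_inter hfin N hS).2

lemma IsPoissonProcess.sigmaFinite_facMeasure (hη : IsPoissonProcess η lam P)
    (hfin : ∀ ω N, η ω (spanningSets lam N) < ⊤) (ω : Ω) :
    SigmaFinite (facMeasure κ (η ω)) := by
  refine ⟨⟨⟨fun N => Set.pi Set.univ fun _ => spanningSets lam N, fun _ => trivial, fun N => ?_,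
    iUnion_cube_spanningSets lam κ⟩⟩⟩
  have := hη.sigmaFinite ω
  have h1 := facMeasure_rectangle (κ := κ) (hη.integerValued ω) (L := Unit)
    (fun _ => spanningSets lam N)
    (fun _ => measurableSet_spanningSets lam N) (fun a b h => absurd rfl h)
    (fun _ => (hfin ω N).ne) (fun _ => ())
  rw [h1]
  obtain ⟨k, hk⟩ := IntegerValued.exists_nat (hη.integerValued ω)
    (measurableSet_spanningSets lam N) (hfin ω N).ne
  simp only [hk, fallingFactorial_natCast, Finset.univ_unique, Finset.prod_singleton]
  exact ENNReal.natCast_lt_top _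

end

/-! ### Products identified along partitions -/

/-- The image of the product of copies of `lam`, one for each class of `s`, under the embedding of
`X^{C/s}` into `X^C`: the integral of `h` against it is `∫ h_s d lam^{|s|}`. Partitions of the
index set `C` are encoded as equivalence relations. -/
def diagMeasure {X C : Type*} [MeasurableSpace X] [Finite C] (lam : Measure X) (s : Setoid C) :
    Measure (C → X) :=
  letI := Fintype.ofFinite (Quotient s)
  (Measure.pi fun _ : Quotient s => lam).map fun z c => z (Quotient.mk s c)

lemma map_pi_equiv {X Q Q' : Type*} [MeasurableSpace X] [Fintype Q] [Fintype Q']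
    (lam : Measure X) [SigmaFinite lam] (e : Q' ≃ Q) :
    (Measure.pi fun _ : Q => lam).map (fun z q => z (e q)) = Measure.pi fun _ : Q' => lam := by
  refine (Measure.pi_eq fun S hS => ?_).symm
  rw [Measure.map_apply (by fun_prop) (MeasurableSet.univ_pi hS)]
  have : (fun (z : Q → X) q => z (e q)) ⁻¹' Set.pi Set.univ S =
      Set.pi Set.univ fun q => S (e.symm q) := by
    ext z
    simp only [Set.mem_preimage, Set.mem_pi, Set.mem_univ, true_imp_iff]
    exact ⟨fun h q => by simpa using h (e.symm q), fun h q => by simpa using h (e q)⟩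
  rw [this, Measure.pi_pi]
  exact e.symm.prod_comp fun q => lam (S q)

/-- The classes of `s` may be replaced by any type parametrizing them. -/
lemma diagMeasure_eq_map {X C Q : Type*} [MeasurableSpace X] [Finite C] [Fintype Q]
    (lam : Measure X) [SigmaFinite lam] (s : Setoid C) (p : C → Q) (hp : Function.Surjective p)
    (hs : Setoid.ker p = s) :
    diagMeasure lam s = (Measure.pi fun _ : Q => lam).map fun z c => z (p c) := by
  subst hs
  let := Fintype.ofFinite (Quotient (Setoid.ker p))
  unfold diagMeasure
  rw [← map_pi_equiv lam (Setoid.quotientKerEquivOfSurjective p hp),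
    Measure.map_map (by fun_prop) (by fun_prop)]
  rfl

/-- The point of `X^C` with prescribed coordinates in the two parts `A` and `B` of `C`. -/
def merge {X C A B : Type*} (e : C ≃ A ⊕ B) (p : (A → X) × (B → X)) : C → X :=
  fun c => Sum.elim p.1 p.2 (e c)

lemma measurable_merge {X C A B : Type*} [MeasurableSpace X] (e : C ≃ A ⊕ B) :
    Measurable (merge (X := X) e) := by
  refine measurable_pi_lambda _ fun c => ?_
  unfold merge
  rcases e c with a | b
  · exact (measurable_pi_apply a).comp measurable_fst
  · exact (measurable_pi_apply b).comp measurable_snd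

/-- The partition of `C = A ⊔ B` consisting of the blocks of a partition of `A` and the blocks of
a partition of `B`. -/
def joinSetoid {C A B : Type*} (e : C ≃ A ⊕ B) (s : Setoid A) (t : Setoid B) : Setoid C :=
  Setoid.ker fun c => Sum.map (Quotient.mk s) (Quotient.mk t) (e c)

lemma diagMeasure_bot {X C : Type*} [MeasurableSpace X] [Fintype C] (lam : Measure X)
    [SigmaFinite lam] : diagMeasure lam (⊥ : Setoid C) = Measure.pi fun _ => lam := by
  rw [diagMeasure_eq_map lam ⊥ (id : C → C) Function.surjective_id]
  · exact Measure.map_id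
  · ext; rfl

instance sFinite_diagMeasure {X C : Type*} [MeasurableSpace X] [Finite C] (lam : Measure X)
    [SigmaFinite lam] (s : Setoid C) : SFinite (diagMeasure lam s) := by
  unfold diagMeasure; infer_instance

lemma diagMeasure_join {X C A B : Type*} [MeasurableSpace X] [Finite C] [Finite A] [Finite B]
    (lam : Measure X) [SigmaFinite lam] (e : C ≃ A ⊕ B) (s : Setoid A) (t : Setoid B) :
    diagMeasure lam (joinSetoid e s t) =
      ((diagMeasure lam s).prod (diagMeasure lam t)).map (merge e) := by
  have := Fintype.ofFinite (Quotient s)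
  have := Fintype.ofFinite (Quotient t)
  rw [diagMeasure_eq_map lam (joinSetoid e s t)
    (fun c => Sum.map (Quotient.mk s) (Quotient.mk t) (e c)) (by
      intro q
      rcases q with q | q
      · obtain ⟨a, rfl⟩ := Quotient.exists_rep q
        exact ⟨e.symm (Sum.inl a), by simp⟩
      · obtain ⟨a, rfl⟩ := Quotient.exists_rep q
        exact ⟨e.symm (Sum.inr a), by simp⟩) rfl,
    diagMeasure_eq_map lam s (Quotient.mk s) Quotient.mk_surjective
      (by ext a b; exact Quotient.eq),
    diagMeasure_eq_map lam t (Quotient.mk t) Quotient.mk_surjective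
      (by ext a b; exact Quotient.eq),
    Measure.map_prod_map _ _ (by fun_prop) (by fun_prop),
    Measure.map_map (measurable_merge e) (by fun_prop),
    ← (measurePreserving_sumPiEquivProdPi_symm
      (fun _ : Quotient s ⊕ Quotient t => lam)).map_eq,
    Measure.map_map (by fun_prop) (MeasurableEquiv.measurable _)]
  congr 1
  ext z c
  simp only [Function.comp_apply, merge, Prod.map]
  rcases e c with a | b <;> rfl

lemma joinSetoid_bot {C A B : Type*} (e : C ≃ A ⊕ B) :
    joinSetoid e (⊥ : Setoid A) (⊥ : Setoid B) = ⊥ := by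
  ext c d
  constructor
  · intro h
    have h' : Sum.map (Quotient.mk (⊥ : Setoid A)) (Quotient.mk (⊥ : Setoid B)) (e c) =
      Sum.map (Quotient.mk (⊥ : Setoid A)) (Quotient.mk (⊥ : Setoid B)) (e d) := h
    have hA : Function.Injective (Quotient.mk (⊥ : Setoid A)) := fun a b hab => Quotient.exact hab
    have hB : Function.Injective (Quotient.mk (⊥ : Setoid B)) := fun a b hab => Quotient.exact hab
    exact e.injective (hA.sumMap hB h')
  · rintro rfl
    exact Setoid.refl' _ c

lemma map_merge_pi {X C A B : Type*} [MeasurableSpace X] [Fintype C] [Fintype A] [Fintype B]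
    (lam : Measure X) [SigmaFinite lam] (e : C ≃ A ⊕ B) :
    ((Measure.pi fun _ : A => lam).prod (Measure.pi fun _ : B => lam)).map (merge e) =
      Measure.pi fun _ : C => lam := by
  rw [← diagMeasure_bot, ← diagMeasure_bot, ← diagMeasure_bot, ← diagMeasure_join,
    joinSetoid_bot]

lemma diagMeasure_map {X Y C : Type*} [MeasurableSpace X] [MeasurableSpace Y] [Finite C]
    (lam : Measure X) [SigmaFinite lam] {φ : X → Y} (hφ : Measurable φ)
    [SigmaFinite (lam.map φ)] (s : Setoid C) :
    diagMeasure (lam.map φ) s = (diagMeasure lam s).map fun x c => φ (x c) := by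
  have := Fintype.ofFinite (Quotient s)
  rw [diagMeasure_eq_map (lam.map φ) s (Quotient.mk s) Quotient.mk_surjective
      (by ext a b; exact Quotient.eq),
    diagMeasure_eq_map lam s (Quotient.mk s) Quotient.mk_surjective
      (by ext a b; exact Quotient.eq), Measure.map_map (by fun_prop) (by fun_prop),
    ← Measure.pi_map_pi (f := fun _ => φ) (fun _ => hφ.aemeasurable),
    Measure.map_map (by fun_prop) (by fun_prop)]
  rfl

/-! ### Random measures with given intensity -/

/-- The random measure `ν` on `Z` has intensity measure `μ`; this includes the measurability of
the integrals of non-negative functions. -/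
def HasIntensity {Ω Z : Type*} [MeasurableSpace Ω] [MeasurableSpace Z] (P : Measure Ω)
    (ν : Ω → Measure Z) (μ : Measure Z) : Prop :=
  ∀ h : Z → ENNReal, Measurable h →
    Measurable (fun ω => ∫⁻ z, h z ∂(ν ω)) ∧ ∫⁻ ω, ∫⁻ z, h z ∂(ν ω) ∂P = ∫⁻ z, h z ∂μ

section Intensity

variable {Ω Z : Type*} [MeasurableSpace Ω] [MeasurableSpace Z] {P : Measure Ω}
    {ν : Ω → Measure Z} {μ : Measure Z}

lemma HasIntensity.ae_integrable (hν : HasIntensity P ν μ) {f : Z → ℝ} (hf : Measurable f)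
    (hint : Integrable f μ) : ∀ᵐ ω ∂P, Integrable f (ν ω) := by
  obtain ⟨h1, h2⟩ := hν (fun z => ‖f z‖ₑ) hf.enorm
  have h3 := ae_lt_top h1 (by rw [h2]; exact hint.2.ne)
  filter_upwards [h3] with ω hω
  exact ⟨hf.aestronglyMeasurable, hω⟩

/-- Campbell's formula for integrable functions. -/
lemma HasIntensity.integrable_and_integral (hν : HasIntensity P ν μ) {f : Z → ℝ}
    (hf : Measurable f) (hint : Integrable f μ) :
    Integrable (fun ω => ∫ z, f z ∂(ν ω)) P ∧ ∫ ω, ∫ z, f z ∂(ν ω) ∂P = ∫ z, f z ∂μ := by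
  have hp := hν (fun z => ENNReal.ofReal (f z)) hf.ennreal_ofReal
  have hn := hν (fun z => ENNReal.ofReal (-f z)) hf.neg.ennreal_ofReal
  have hpf : ∫⁻ ω, ∫⁻ z, ENNReal.ofReal (f z) ∂(ν ω) ∂P ≠ ⊤ := by
    rw [hp.2]; exact hint.lintegral_lt_top.ne
  have hnf : ∫⁻ ω, ∫⁻ z, ENNReal.ofReal (-f z) ∂(ν ω) ∂P ≠ ⊤ := by
    rw [hn.2]; exact hint.neg.lintegral_lt_top.ne
  have hae : (fun ω => ∫ z, f z ∂(ν ω)) =ᵐ[P] fun ω =>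
      (∫⁻ z, ENNReal.ofReal (f z) ∂(ν ω)).toReal -
        (∫⁻ z, ENNReal.ofReal (-f z) ∂(ν ω)).toReal := by
    filter_upwards [hν.ae_integrable hf hint] with ω hω
    exact integral_eq_lintegral_pos_part_sub_lintegral_neg_part hω
  have hpi := integrable_toReal_of_lintegral_ne_top hp.1.aemeasurable hpf
  have hni := integrable_toReal_of_lintegral_ne_top hn.1.aemeasurable hnf
  refine ⟨(hpi.sub hni).congr hae.symm, ?_⟩
  rw [integral_congr_ae hae, integral_sub hpi hni,
    integral_toReal hp.1.aemeasurable (ae_lt_top hp.1 hpf),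
    integral_toReal hn.1.aemeasurable (ae_lt_top hn.1 hnf), hp.2, hn.2,
    integral_eq_lintegral_pos_part_sub_lintegral_neg_part hint]

lemma HasIntensity.prod {Z' : Type*} [MeasurableSpace Z'] (hν : HasIntensity P ν μ)
    (ρ : Measure Z') [SFinite ρ] :
    HasIntensity P (fun ω => (ν ω).prod ρ) (μ.prod ρ) := by
  intro h hh
  simp_rw [lintegral_prod _ hh.aemeasurable]
  exact hν _ hh.lintegral_prod_right'

end Intensity

lemma IsPoissonProcess.hasIntensity_facMeasure {Ω Y : Type*} [MeasurableSpace Ω]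
    [MeasurableSpace Y] {P : Measure Ω} {lam : Measure Y} {η : Ω → Measure Y}
    [MeasurableSpace.CountablySeparated Y] [MeasurableSingletonClass Y] {κ : Type*} [Fintype κ]
    [SigmaFinite lam] [IsProbabilityMeasure P] (hη : IsPoissonProcess η lam P)
    (hfin : ∀ ω N, η ω (spanningSets lam N) < ⊤) :
    HasIntensity P (fun ω => facMeasure κ (η ω)) (Measure.pi fun _ => lam) := by
  intro h hh
  refine ⟨(Measure.measurable_lintegral hh).comp (hη.measurable_facMeasure hfin), ?_⟩
  rw [← hη.bind_facMeasure hfin,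
    Measure.lintegral_bind (hη.measurable_facMeasure hfin).aemeasurable hh.aemeasurable]

/-! ### Products of factorial measures -/

lemma ENNReal_prod_tsum {R : Type} [Fintype R] : ∀ {ι : R → Type*} (a : ∀ r, ι r → ENNReal),
    ∏ r, ∑' i, a r i = ∑' f : ∀ r, ι r, ∏ r, a r (f r) := by
  refine Fintype.induction_empty_option (P := fun (R : Type) [Fintype R] =>
    ∀ {ι : R → Type _} (a : ∀ r, ι r → ENNReal),
    ∏ r, ∑' i, a r i = ∑' f : ∀ r, ι r, ∏ r, a r (f r)) ?_ ?_ ?_ R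
  · intro R R' _ e h ι a
    let := Fintype.ofEquiv R' e.symm
    rw [← e.prod_comp, ← (Equiv.piCongrLeft ι e).tsum_eq]
    have := h (fun r => a (e r))
    convert this using 1
    refine tsum_congr fun f => ?_
    rw [← e.prod_comp]
    refine Finset.prod_congr (by ext; simp) fun r _ => ?_
    rw [Equiv.piCongrLeft_apply_apply]
  · intro ι a
    simp
  · intro R _ h ι a
    rw [Fintype.prod_option, h, ← (Equiv.piOptionEquivProd (β := ι)).symm.tsum_eq,
      ENNReal.tsum_prod', ← ENNReal.tsum_mul_right]
    refine tsum_congr fun i => ?_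
    rw [← ENNReal.tsum_mul_left]
    refine tsum_congr fun f => ?_
    rw [Fintype.prod_option]
    rfl

/-- A partition of a diagram is non-flat if no two entries of a row lie in the same block. -/
def NonFlat {R : Type} {A : R → Type} (s : Setoid (Σ r, A r)) : Prop :=
  ∀ r a b, s ⟨r, a⟩ ⟨r, b⟩ → a = b

/-- A family of rowwise injective labellings is the same as a non-flat partition, the partition
into the sets of equal labels, together with an injective labelling of its blocks. -/
def embeddingsEquiv {R : Type} (A : R → Type) (P : Type*) :
    (Σ s : {s : Setoid (Σ r, A r) // NonFlat s}, Quotient s.1 ↪ P) ≃ (∀ r, A r ↪ P) :=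
  Equiv.ofBijective (fun q r => ⟨fun a => q.2 (Quotient.mk q.1.1 ⟨r, a⟩), fun a b h =>
      q.1.2 r a b (Quotient.exact (q.2.injective h))⟩) (by
    constructor
    · rintro ⟨⟨s, hs⟩, j⟩ ⟨⟨s', hs'⟩, j'⟩ h
      have hval : ∀ c : Σ r, A r, j (Quotient.mk s c) = j' (Quotient.mk s' c) := fun c =>
        DFunLike.congr_fun (congrFun h c.1) c.2
      have hss : s = s' := by
        ext c d
        constructor
        · intro hcd
          refine Quotient.exact (j'.injective ?_)
          rw [← hval, ← hval, Quotient.sound (s := s) hcd]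
        · intro hcd
          refine Quotient.exact (j.injective ?_)
          rw [hval, hval, Quotient.sound (s := s') hcd]
      subst hss
      have : j = j' := by
        ext q
        obtain ⟨c, rfl⟩ := Quotient.exists_rep q
        exact hval c
      rw [this]
    · intro i
      let g : (Σ r, A r) → P := fun c => i c.1 c.2
      refine ⟨⟨⟨Setoid.ker g, fun r a b h => (i r).injective h⟩,
        ⟨Setoid.kerLift g, Setoid.kerLift_injective g⟩⟩, ?_⟩
      ext r a
      rfl)

instance finite_setoid {C : Type*} [Finite C] : Finite (Setoid C) :=
  Finite.of_injective (fun (s : Setoid C) (a b : C) => s a b) fun s t h => by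
    ext a b; exact iff_of_eq (congrFun (congrFun h a) b)

instance fintype_setoid {C : Type*} [Finite C] : Fintype (Setoid C) := Fintype.ofFinite _

section

variable {Y : Type*} [MeasurableSpace Y] {μ : Measure Y} {R : Type} [Fintype R] {A : R → Type}

lemma pi_facMeasure (hσ : ∀ r, SigmaFinite (facMeasure (A r) μ)) :
    Measure.pi (fun r => facMeasure (A r) μ) =
      Measure.sum fun i : ∀ r, A r ↪ Points μ => Measure.dirac fun r a => (i r a).1 := by
  refine Measure.pi_eq fun S hS => ?_
  rw [Measure.sum_apply _ (MeasurableSet.univ_pi hS)]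
  simp_rw [facMeasure_apply (hS _)]
  rw [ENNReal_prod_tsum]
  refine tsum_congr fun i => ?_
  rw [Measure.dirac_apply' _ (MeasurableSet.univ_pi hS)]
  by_cases h : (fun r a => (i r a).1) ∈ Set.pi Set.univ S
  · rw [Set.indicator_of_mem h]
    symm
    exact Finset.prod_eq_one fun r _ => Set.indicator_of_mem (h r trivial) _
  · rw [Set.indicator_of_notMem h]
    simp only [Set.mem_pi, Set.mem_univ, true_imp_iff, not_forall] at h
    obtain ⟨r, hr⟩ := h
    exact (Finset.prod_eq_zero (Finset.mem_univ r) (Set.indicator_of_notMem hr _)).symm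

variable [∀ r, Finite (A r)]

open scoped Classical in
/-- The product formula: a product of factorial measures is the sum over all non-flat partitions
of the factorial measure whose arguments are identified along the partition. -/
lemma lintegral_pi_facMeasure (hσ : ∀ r, SigmaFinite (facMeasure (A r) μ))
    {h : (∀ r, A r → Y) → ENNReal} (hh : Measurable h) :
    ∫⁻ x, h x ∂(Measure.pi fun r => facMeasure (A r) μ) =
      ∑ s : {s : Setoid (Σ r, A r) // NonFlat s},
        ∫⁻ z, h (fun r a => z (Quotient.mk s.1 ⟨r, a⟩)) ∂(facMeasure (Quotient s.1) μ) := by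
  rw [pi_facMeasure hσ, lintegral_sum_measure, ← (embeddingsEquiv A (Points μ)).tsum_eq,
    ENNReal.tsum_sigma', tsum_fintype]
  refine Finset.sum_congr rfl fun s _ => ?_
  have hm : Measurable fun z : Quotient s.1 → Y =>
    h (fun r a => z (Quotient.mk s.1 ⟨r, a⟩)) := hh.comp (by fun_prop)
  rw [lintegral_facMeasure hm]
  refine tsum_congr fun j => ?_
  rw [lintegral_dirac' _ hh]
  rfl

end

/-- Fubini for products of products. -/
lemma pi_prod {R : Type} [Fintype R] {α β : R → Type*} [∀ r, MeasurableSpace (α r)]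
    [∀ r, MeasurableSpace (β r)] (μ : ∀ r, Measure (α r)) (ν : ∀ r, Measure (β r))
    [∀ r, SigmaFinite (μ r)] [∀ r, SigmaFinite (ν r)] :
    Measure.pi (fun r => (μ r).prod (ν r)) =
      ((Measure.pi μ).prod (Measure.pi ν)).map fun p r => (p.1 r, p.2 r) := by
  refine Measure.pi_eq_generateFrom (μ := fun r => (μ r).prod (ν r))
    (C := fun r => Set.image2 (· ×ˢ ·) {s | MeasurableSet s} {t | MeasurableSet t})
    (fun r => generateFrom_prod) (fun r => isPiSystem_prod)
    (fun r => (μ r).toFiniteSpanningSetsIn.prod (ν r).toFiniteSpanningSetsIn) ?_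
  intro S hS
  choose s hs t ht hst using hS
  have hm : Measurable fun (p : (∀ r, α r) × (∀ r, β r)) r => (p.1 r, p.2 r) := by fun_prop
  rw [Measure.map_apply hm (MeasurableSet.univ_pi fun r => by
    rw [← hst r]; exact (hs r).prod (ht r))]
  have : (fun (p : (∀ r, α r) × (∀ r, β r)) r => (p.1 r, p.2 r)) ⁻¹' Set.pi Set.univ S =
      (Set.pi Set.univ s) ×ˢ (Set.pi Set.univ t) := by
    ext p
    simp only [← hst, Set.mem_preimage, Set.mem_pi, Set.mem_univ, true_imp_iff, Set.mem_prod]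
    exact forall_and
  rw [this, Measure.prod_prod, Measure.pi_pi, Measure.pi_pi, ← Finset.prod_mul_distrib]
  refine Finset.prod_congr rfl fun r _ => ?_
  rw [← hst r, Measure.prod_prod]

lemma pi_sigma {X R : Type*} [MeasurableSpace X] {B : R → Type*} [Fintype R] [∀ r, Fintype (B r)]
    (lam : Measure X) [SigmaFinite lam] :
    (Measure.pi fun _ : Σ r, B r => lam) =
      (Measure.pi fun r => Measure.pi fun _ : B r => lam).map fun y c => y c.1 c.2 := by
  refine Measure.pi_eq fun S hS => ?_
  rw [Measure.map_apply (by fun_prop) (MeasurableSet.univ_pi hS)]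
  have : (fun (y : ∀ r, B r → X) (c : Σ r, B r) => y c.1 c.2) ⁻¹' Set.pi Set.univ S =
      Set.pi Set.univ fun r => Set.pi Set.univ fun b => S ⟨r, b⟩ := by
    ext y
    simp only [Set.mem_preimage, Set.mem_pi, Set.mem_univ, true_imp_iff, Sigma.forall]
  rw [this, Measure.pi_pi, Fintype.prod_sigma]
  exact Finset.prod_congr rfl fun r _ => Measure.pi_pi _ _

/-- The splitting of all rows of a diagram into two parts. -/
def sigmaSplit {R : Type} {A B C : R → Type} (e : ∀ r, C r ≃ A r ⊕ B r) :
    (Σ r, C r) ≃ (Σ r, A r) ⊕ (Σ r, B r) :=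
  (Equiv.sigmaCongrRight e).trans (Equiv.sigmaSumDistrib A B)

lemma merge_sigmaSplit {R : Type} {A B C : R → Type} (e : ∀ r, C r ≃ A r ⊕ B r) {X : Type*}
    (x : (Σ r, A r) → X) (y : (Σ r, B r) → X) (c : Σ r, C r) :
    merge (sigmaSplit e) (x, y) c =
      merge (e c.1) (fun a => x ⟨c.1, a⟩, fun b => y ⟨c.1, b⟩) c.2 := by
  obtain ⟨r, c⟩ := c
  simp only [merge, sigmaSplit, Equiv.trans_apply, Equiv.sigmaCongrRight_apply]
  rcases e r c with a | b <;> rfl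

open scoped Classical in
/-- The intensity measure of a product of mixed measures, where in each row some of the variables
are integrated with respect to a factorial measure of the Poisson process and the other ones with
respect to `lam`. Only the former can be identified with each other. -/
lemma IsPoissonProcess.hasIntensity_pi {Ω Y : Type*} [MeasurableSpace Ω]
    [MeasurableSpace Y] {P : Measure Ω} {lam : Measure Y} {η : Ω → Measure Y}
    [MeasurableSpace.CountablySeparated Y] [MeasurableSingletonClass Y]
    [SigmaFinite lam] [IsProbabilityMeasure P] (hη : IsPoissonProcess η lam P)
    (hfin : ∀ ω N, η ω (spanningSets lam N) < ⊤)
    {R : Type} [Fintype R] {A B C : R → Type} [∀ r, Fintype (A r)] [∀ r, Fintype (B r)]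
    [∀ r, Fintype (C r)] (e : ∀ r, C r ≃ A r ⊕ B r) :
    HasIntensity P (fun ω => (Measure.pi fun r => (facMeasure (A r) (η ω)).prod
        (Measure.pi fun _ : B r => lam)).map fun p (c : Σ r, C r) => merge (e c.1) (p c.1) c.2)
      (∑ s : {s : Setoid (Σ r, A r) // NonFlat s},
        diagMeasure lam (joinSetoid (sigmaSplit e) s.1 ⊥)) := by
  intro h hh
  have hσ : ∀ ω r, SigmaFinite (facMeasure (A r) (η ω)) := fun ω r =>
    hη.sigmaFinite_facMeasure hfin ω
  have hmerge : Measurable fun (p : ∀ r, (A r → Y) × (B r → Y)) (c : Σ r, C r) =>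
      merge (e c.1) (p c.1) c.2 := measurable_pi_lambda _ fun c =>
    (measurable_pi_apply c.2).comp ((measurable_merge (e c.1)).comp (measurable_pi_apply c.1))
  have hmerge' : Measurable fun (p : (∀ r, A r → Y) × (∀ r, B r → Y)) (c : Σ r, C r) =>
      merge (e c.1) (p.1 c.1, p.2 c.1) c.2 :=
    hmerge.comp (f := fun (p : (∀ r, A r → Y) × (∀ r, B r → Y)) r => (p.1 r, p.2 r))
      (by fun_prop)
  let h' : (∀ r, A r → Y) → ENNReal := fun x => ∫⁻ y, h (fun c => merge (e c.1) (x c.1, y c.1) c.2)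
    ∂(Measure.pi fun r => Measure.pi fun _ : B r => lam)
  have hh' : Measurable h' := (hh.comp hmerge').lintegral_prod_right'
  have key : ∀ ω, ∫⁻ z, h z ∂((Measure.pi fun r => (facMeasure (A r) (η ω)).prod
      (Measure.pi fun _ : B r => lam)).map fun p (c : Σ r, C r) => merge (e c.1) (p c.1) c.2) =
      ∑ s : {s : Setoid (Σ r, A r) // NonFlat s},
        ∫⁻ z, h' (fun r a => z (Quotient.mk s.1 ⟨r, a⟩)) ∂(facMeasure (Quotient s.1) (η ω)) := by
    intro ω
    have := hσ ω
    rw [lintegral_map hh hmerge, pi_prod, lintegral_map (by exact hh.comp hmerge) (by fun_prop),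
      lintegral_prod _ (by exact (hh.comp hmerge').aemeasurable)]
    exact lintegral_pi_facMeasure (hσ ω) hh'
  simp_rw [key]
  let (s : {s : Setoid (Σ r, A r) // NonFlat s}) : Fintype (Quotient s.1) := Fintype.ofFinite _
  have hI := fun s : {s : Setoid (Σ r, A r) // NonFlat s} =>
    hη.hasIntensity_facMeasure hfin (κ := Quotient s.1)
      (fun z => h' (fun r a => z (Quotient.mk s.1 ⟨r, a⟩)))
      (hh'.comp (f := fun (z : Quotient s.1 → Y) r a => z (Quotient.mk s.1 ⟨r, a⟩)) (by fun_prop))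
  refine ⟨Finset.measurable_sum _ fun s _ => (hI s).1, ?_⟩
  rw [lintegral_finsetSum _ fun s _ => (hI s).1, lintegral_finsetSum_measure]
  refine Finset.sum_congr rfl fun s _ => ?_
  rw [(hI s).2, diagMeasure_join, lintegral_map hh (measurable_merge _), diagMeasure_bot,
    lintegral_prod _ (by exact (hh.comp (measurable_merge _)).aemeasurable), diagMeasure,
    lintegral_map
    (by exact (hh.comp (measurable_merge _)).lintegral_prod_right') (by fun_prop)]
  refine lintegral_congr fun z => ?_
  rw [pi_sigma, lintegral_map (by
    exact (hh.comp (measurable_merge _)).comp measurable_prodMk_left) (by fun_prop)]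
  refine lintegral_congr fun y => ?_
  congr 1
  ext c
  rw [merge_sigmaSplit]

/-! ### Partitions of a disjoint union -/

section Join

variable {C A B : Type*} (e : C ≃ A ⊕ B) (s : Setoid A) (t : Setoid B)

lemma joinSetoid_inl_inl {a a' : A} :
    joinSetoid e s t (e.symm (Sum.inl a)) (e.symm (Sum.inl a')) ↔ s a a' := by
  change Sum.map _ _ _ = Sum.map _ _ _ ↔ _
  simp [Quotient.eq]

lemma joinSetoid_inr_inr {b b' : B} :
    joinSetoid e s t (e.symm (Sum.inr b)) (e.symm (Sum.inr b')) ↔ t b b' := by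
  change Sum.map _ _ _ = Sum.map _ _ _ ↔ _
  simp [Quotient.eq]

lemma not_joinSetoid_inl_inr {a : A} {b : B} :
    ¬ joinSetoid e s t (e.symm (Sum.inl a)) (e.symm (Sum.inr b)) := by
  change ¬ Sum.map _ _ _ = Sum.map _ _ _
  simp

/-- Partitions of `A` and `B` amount to a partition of `C = A ⊔ B` without blocks meeting both
parts. -/
def joinEquiv : Setoid A × Setoid B ≃
    {σ : Setoid C // ∀ a b, ¬ σ (e.symm (Sum.inl a)) (e.symm (Sum.inr b))} where
  toFun p := ⟨joinSetoid e p.1 p.2, fun _ _ => not_joinSetoid_inl_inr e p.1 p.2⟩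
  invFun σ := (σ.1.comap fun a => e.symm (Sum.inl a), σ.1.comap fun b => e.symm (Sum.inr b))
  left_inv p := by
    ext a b
    · exact joinSetoid_inl_inl e p.1 p.2
    · exact joinSetoid_inr_inr e p.1 p.2
  right_inv σ := by
    ext c d
    obtain ⟨c, rfl⟩ := e.symm.surjective c
    obtain ⟨d, rfl⟩ := e.symm.surjective d
    rcases c with a | b <;> rcases d with a' | b'
    · exact joinSetoid_inl_inl e _ _
    · exact iff_of_false (not_joinSetoid_inl_inr e _ _) (σ.2 _ _)
    · exact iff_of_false (fun h => not_joinSetoid_inl_inr e _ _ (Setoid.symm' _ h))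
        (fun h => σ.2 _ _ (Setoid.symm' _ h))
    · exact joinSetoid_inr_inr e _ _

end Join

/-- The entry `c` forms a block of its own. -/
def IsSingletonBlock {C : Type*} (σ : Setoid C) (c : C) : Prop := ∀ d, σ c d → c = d

/-- All blocks of the partition have at least two elements. -/
def GeTwo {C : Type*} (σ : Setoid C) : Prop := ∀ c, ¬ IsSingletonBlock σ c

lemma exists_joinSetoid_bot_iff {C A B : Type*} (e : C ≃ A ⊕ B) (σ : Setoid C) :
    (∀ b, IsSingletonBlock σ (e.symm (Sum.inr b))) ↔ ∃ s, joinSetoid e s ⊥ = σ := by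
  constructor
  · intro h
    have hσ : ∀ a b, ¬ σ (e.symm (Sum.inl a)) (e.symm (Sum.inr b)) := fun a b hab => by
      have := h b _ (Setoid.symm' _ hab)
      simp at this
    refine ⟨((joinEquiv e).symm ⟨σ, hσ⟩).1, ?_⟩
    have h1 : ((joinEquiv e).symm ⟨σ, hσ⟩).2 = ⊥ := by
      ext b b'
      constructor
      · intro hb
        have := h b _ hb
        simpa using this
      · rintro rfl
        exact Setoid.refl' _ _
    have h2 := congrArg Subtype.val ((joinEquiv e).apply_symm_apply ⟨σ, hσ⟩)
    rw [← h1]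
    exact h2
  · rintro ⟨s, rfl⟩ b d hd
    obtain ⟨d, rfl⟩ := e.symm.surjective d
    rcases d with a | b'
    · exact absurd (Setoid.symm' _ hd) (not_joinSetoid_inl_inr e _ _)
    · have : b = b' := (joinSetoid_inr_inr e s ⊥).1 hd
      rw [this]

lemma nonFlat_joinSetoid_bot {R : Type} {A B C : R → Type} (e : ∀ r, C r ≃ A r ⊕ B r)
    (s : Setoid (Σ r, A r)) : NonFlat (joinSetoid (sigmaSplit e) s ⊥) ↔ NonFlat s := by
  have hA : ∀ r a, (sigmaSplit e).symm (Sum.inl ⟨r, a⟩) = ⟨r, (e r).symm (Sum.inl a)⟩ := by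
    intro r a
    rw [Equiv.symm_apply_eq]
    simp [sigmaSplit]
  have hB : ∀ r b, (sigmaSplit e).symm (Sum.inr ⟨r, b⟩) = ⟨r, (e r).symm (Sum.inr b)⟩ := by
    intro r b
    rw [Equiv.symm_apply_eq]
    simp [sigmaSplit]
  constructor
  · intro h r a a' haa
    have := h r ((e r).symm (Sum.inl a)) ((e r).symm (Sum.inl a')) (by
      rw [← hA, ← hA]; exact (joinSetoid_inl_inl _ _ _).2 haa)
    simpa using this
  · intro h r c c' hcc
    obtain ⟨c, rfl⟩ := (e r).symm.surjective c
    obtain ⟨c', rfl⟩ := (e r).symm.surjective c'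
    congr 1
    rcases c with a | b <;> rcases c' with a' | b' <;> simp only [← hA, ← hB] at hcc
    · rw [h r a a' ((joinSetoid_inl_inl _ _ _).1 hcc)]
    · exact absurd hcc (not_joinSetoid_inl_inr _ _ _)
    · exact absurd (Setoid.symm' _ hcc) (not_joinSetoid_inl_inr _ _ _)
    · have : (⟨r, b⟩ : Σ r, B r) = ⟨r, b'⟩ := (joinSetoid_inr_inr _ _ _).1 hcc
      simpa using this

open scoped Classical in
lemma sum_nonFlat_joinSetoid_bot {R : Type} [Fintype R] {A B C : R → Type} [∀ r, Finite (A r)]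
    [∀ r, Finite (C r)] (e : ∀ r, C r ≃ A r ⊕ B r) (F : Setoid (Σ r, C r) → ℝ) :
    ∑ s : {s : Setoid (Σ r, A r) // NonFlat s}, F (joinSetoid (sigmaSplit e) s.1 ⊥) =
      ∑ σ : Setoid (Σ r, C r) with NonFlat σ ∧
        ∀ r b, IsSingletonBlock σ ⟨r, (e r).symm (Sum.inr b)⟩, F σ := by
  have hB : ∀ r b, (sigmaSplit e).symm (Sum.inr ⟨r, b⟩) = ⟨r, (e r).symm (Sum.inr b)⟩ := by
    intro r b
    rw [Equiv.symm_apply_eq]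
    simp [sigmaSplit]
  refine Finset.sum_bij (fun s _ => joinSetoid (sigmaSplit e) s.1 ⊥) ?_ ?_ ?_ ?_
  · intro s _
    refine Finset.mem_filter.2 ⟨Finset.mem_univ _, (nonFlat_joinSetoid_bot e s.1).2 s.2,
      fun r b => ?_⟩
    have h := (exists_joinSetoid_bot_iff (sigmaSplit e) _).2 ⟨s.1, rfl⟩ (⟨r, b⟩ : Σ r, B r)
    rwa [hB] at h
  · intro s _ s' _ h
    have h' : joinEquiv (sigmaSplit e) (s.1, ⊥) = joinEquiv (sigmaSplit e) (s'.1, ⊥) :=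
      Subtype.ext h
    exact Subtype.ext (congrArg Prod.fst ((joinEquiv (sigmaSplit e)).injective h'))
  · intro σ hσ
    obtain ⟨-, h1, h2⟩ := Finset.mem_filter.1 hσ
    obtain ⟨s, rfl⟩ := (exists_joinSetoid_bot_iff (sigmaSplit e) σ).1
      (fun b => by rw [hB b.1 b.2]; exact h2 b.1 b.2)
    exact ⟨⟨s, (nonFlat_joinSetoid_bot e s).1 h1⟩, Finset.mem_univ _, rfl⟩
  · intro s _
    rfl

open scoped Classical in
/-- The alternating sum over all sets of indices whose complement satisfies `p` vanishes unless
`p` is never satisfied. -/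
lemma sum_neg_one_pow_compl {n : ℕ} (p : Fin n → Prop) :
    ∑ J : Finset (Fin n), (if ∀ j, j ∉ J → p j then (-1 : ℝ) ^ (n - J.card) else 0) =
      if ∀ j, ¬ p j then 1 else 0 := by
  have h1 : ∑ J : Finset (Fin n), (if ∀ j, j ∉ J → p j then (-1 : ℝ) ^ (n - J.card) else 0) =
      ∑ K : Finset (Fin n), (if K ⊆ Finset.univ.filter p then (-1 : ℝ) ^ K.card else 0) := by
    refine Fintype.sum_equiv (Equiv.mk compl compl compl_compl compl_compl) _ _ fun J => ?_
    simp only [Equiv.coe_fn_mk, Finset.card_compl, Fintype.card_fin]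
    congr 1
    simp [Finset.subset_iff]
  rw [h1, ← Finset.sum_filter]
  have h2 : Finset.univ.filter (fun K : Finset (Fin n) => K ⊆ Finset.univ.filter p) =
      (Finset.univ.filter p).powerset := by ext; simp
  rw [h2]
  have h3 := Finset.sum_powerset_neg_one_pow_card (x := Finset.univ.filter p)
  have h4 : ((∑ m ∈ (Finset.univ.filter p).powerset, (-1 : ℤ) ^ m.card : ℤ) : ℝ) =
    ((if Finset.univ.filter p = ∅ then 1 else 0 : ℤ) : ℝ) := by rw [h3]
  push_cast at h4
  rw [h4]
  simp [Finset.filter_eq_empty_iff]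

/-! ### Moments of products of multiple Wiener-Itô integrals -/

/-- The splitting of the indices into those in `J`, enumerated in increasing order, and the other
ones. -/
def splitFinset {n : ℕ} (J : Finset (Fin n)) : Fin n ≃ Fin J.card ⊕ {i : Fin n // i ∉ J} :=
  (Equiv.sumCompl (· ∈ J)).symm.trans
    (Equiv.sumCongr (J.orderIsoOfFin rfl).symm.toEquiv (Equiv.refl _))

lemma glue_eq_merge {X : Type*} {n : ℕ} (J : Finset (Fin n)) (x : Fin J.card → X)
    (y : {i : Fin n // i ∉ J} → X) : glue J x y = merge (splitFinset J) (x, y) := by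
  ext i
  by_cases h : i ∈ J
  · simp [glue, merge, splitFinset, h, Equiv.sumCompl_symm_apply_of_pos]
  · simp [glue, merge, splitFinset, h, Equiv.sumCompl_symm_apply_of_neg]

lemma splitFinset_symm_inr {n : ℕ} (J : Finset (Fin n)) (i : {i : Fin n // i ∉ J}) :
    (splitFinset J).symm (Sum.inr i) = i := by
  simp [splitFinset]

/-- The function `∏_r g_r(x_r)` of the entries of a diagram with rows indexed by `R`. -/
def rowProd {X R : Type*} [Fintype R] {A : R → Type*} (g : ∀ r, (A r → X) → ℝ) :
    ((Σ r, A r) → X) → ℝ :=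
  fun x => ∏ r, g r fun a => x ⟨r, a⟩

lemma measurable_rowProd {X R : Type*} [MeasurableSpace X] [Fintype R] {A : R → Type*}
    {g : ∀ r, (A r → X) → ℝ} (hg : ∀ r, Measurable (g r)) : Measurable (rowProd g) := by
  unfold rowProd
  exact Finset.measurable_prod _ fun r _ => (hg r).comp (by fun_prop)

section

variable {Ω Y : Type*} [MeasurableSpace Ω] [MeasurableSpace Y] {P : Measure Ω}
  {lam : Measure Y} {η : Ω → Measure Y} [MeasurableSpace.CountablySeparated Y]
  [MeasurableSingletonClass Y] [SigmaFinite lam] [IsProbabilityMeasure P]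

/-- Almost surely, the multiple integral is the alternating sum of the integrals with respect to
the products of factorial measures and powers of `lam`. -/
lemma IsPoissonProcess.wienerIto_ae_eq (hη : IsPoissonProcess η lam P)
    (hfin : ∀ ω N, η ω (spanningSets lam N) < ⊤) {n : ℕ} {f : (Fin n → Y) → ℝ}
    (hf : Measurable f) (hint : Integrable f (Measure.pi fun _ => lam)) :
    ∀ᵐ ω ∂P, wienerIto lam f (η ω) = ∑ J : Finset (Fin n), (-1 : ℝ) ^ (n - J.card) *
      ∫ p, f (merge (splitFinset J) p) ∂((facMeasure (Fin J.card) (η ω)).prod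
        (Measure.pi fun _ : {i : Fin n // i ∉ J} => lam)) := by
  have hae : ∀ J : Finset (Fin n), ∀ᵐ ω ∂P, Integrable (fun p => f (merge (splitFinset J) p))
      ((facMeasure (Fin J.card) (η ω)).prod
        (Measure.pi fun _ : {i : Fin n // i ∉ J} => lam)) := by
    intro J
    refine ((hη.hasIntensity_facMeasure hfin (κ := Fin J.card)).prod
      (Measure.pi fun _ : {i : Fin n // i ∉ J} => lam)).ae_integrable
      (hf.comp (measurable_merge _)) ?_
    rw [← map_merge_pi lam (splitFinset J)] at hint
    exact hint.comp_measurable (measurable_merge _)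
  filter_upwards [ae_all_iff.2 hae] with ω hω
  unfold wienerIto
  refine Finset.sum_congr rfl fun J _ => ?_
  congr 1
  have := hη.sigmaFinite ω
  have := hη.sigmaFinite_facMeasure hfin (κ := Fin J.card) ω
  rw [integral_prod_symm _ (hω J)]
  refine integral_congr_ae ?_
  filter_upwards [(hω J).prod_left_ae] with y hy
  simp_rw [glue_eq_merge]
  exact facIntegral_eq_integral (hη.integerValued ω) hy

open scoped Classical in
/-- Moments of products of multiple integrals are sums over non-flat partitions with blocks of
size at least two. In the sum over all choices of the variables integrated with respect to `lam`,
a partition appears once for each set of its singleton blocks, so that the partitions having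
singleton blocks cancel. -/
lemma IsPoissonProcess.integral_prod_wienerIto (hη : IsPoissonProcess η lam P)
    (hfin : ∀ ω N, η ω (spanningSets lam N) < ⊤) {R : Type} [Fintype R] {n : R → ℕ}
    {g : ∀ r, (Fin (n r) → Y) → ℝ} (hg : ∀ r, Measurable (g r))
    (hgi : ∀ r, Integrable (g r) (Measure.pi fun _ => lam))
    (hint : ∀ σ : Setoid (Σ r, Fin (n r)), NonFlat σ →
      Integrable (rowProd g) (diagMeasure lam σ)) :
    Integrable (fun ω => ∏ r, wienerIto lam (g r) (η ω)) P ∧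
    ∫ ω, ∏ r, wienerIto lam (g r) (η ω) ∂P =
      ∑ σ : Setoid (Σ r, Fin (n r)) with NonFlat σ ∧ GeTwo σ,
        ∫ x, rowProd g x ∂(diagMeasure lam σ) := by
  let ν : (∀ r, Finset (Fin (n r))) → Ω → Measure ((Σ r, Fin (n r)) → Y) := fun J ω =>
    (Measure.pi fun r => (facMeasure (Fin (J r).card) (η ω)).prod
      (Measure.pi fun _ : {i : Fin (n r) // i ∉ J r} => lam)).map
      fun p (c : Σ r, Fin (n r)) => merge (splitFinset (J c.1)) (p c.1) c.2
  let sgn : (∀ r, Finset (Fin (n r))) → ℝ := fun J => ∏ r, (-1 : ℝ) ^ (n r - (J r).card)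
  have hae : (fun ω => ∏ r, wienerIto lam (g r) (η ω)) =ᵐ[P] fun ω =>
      ∑ J : ∀ r, Finset (Fin (n r)), sgn J * ∫ x, rowProd g x ∂(ν J ω) := by
    filter_upwards [ae_all_iff.2 fun r => hη.wienerIto_ae_eq hfin (hg r) (hgi r)] with ω hω
    simp_rw [hω]
    rw [Finset.prod_univ_sum, Fintype.piFinset_univ]
    refine Finset.sum_congr rfl fun J _ => ?_
    rw [Finset.prod_mul_distrib]
    congr 1
    have hσ : ∀ r, SigmaFinite (facMeasure (Fin (J r).card) (η ω)) := fun r =>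
      hη.sigmaFinite_facMeasure hfin ω
    have hmerge : Measurable fun (p : ∀ r, (Fin (J r).card → Y) × ({i : Fin (n r) // i ∉ J r} → Y))
        (c : Σ r, Fin (n r)) => merge (splitFinset (J c.1)) (p c.1) c.2 :=
      measurable_pi_lambda _ fun c => (measurable_pi_apply c.2).comp
        ((measurable_merge (splitFinset (J c.1))).comp (measurable_pi_apply c.1))
    rw [← integral_fintype_prod_eq_prod, integral_map hmerge.aemeasurable
      (measurable_rowProd hg).aestronglyMeasurable]
    rfl
  have hI : ∀ J, HasIntensity P (ν J) _ := fun J =>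
    hη.hasIntensity_pi hfin fun r => splitFinset (J r)
  have hJint : ∀ J : ∀ r, Finset (Fin (n r)), Integrable (rowProd g)
      (∑ s : {s : Setoid (Σ r, Fin (J r).card) // NonFlat s},
        diagMeasure lam (joinSetoid (sigmaSplit fun r => splitFinset (J r)) s.1 ⊥)) := fun J =>
    integrable_finsetSum_measure.2 fun s _ => hint _ ((nonFlat_joinSetoid_bot _ s.1).2 s.2)
  have hJ := fun J => (hI J).integrable_and_integral (measurable_rowProd hg) (hJint J)
  have hJval : ∀ J : ∀ r, Finset (Fin (n r)), ∫ ω, ∫ x, rowProd g x ∂(ν J ω) ∂P =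
      ∑ σ : Setoid (Σ r, Fin (n r)) with NonFlat σ ∧ ∀ r b, b ∉ J r → IsSingletonBlock σ ⟨r, b⟩,
        ∫ x, rowProd g x ∂(diagMeasure lam σ) := by
    intro J
    rw [(hJ J).2, integral_finsetSum_measure fun s _ =>
      hint _ ((nonFlat_joinSetoid_bot _ s.1).2 s.2)]
    rw [sum_nonFlat_joinSetoid_bot (fun r => splitFinset (J r))
      fun σ => ∫ x, rowProd g x ∂(diagMeasure lam σ)]
    simp only [splitFinset_symm_inr, Subtype.forall]
  refine ⟨(integrable_finsetSum _ fun J _ => ((hJ J).1.const_mul _)).congr hae.symm, ?_⟩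
  rw [integral_congr_ae hae, integral_finsetSum _ fun J _ => ((hJ J).1.const_mul _)]
  simp_rw [integral_const_mul, hJval, Finset.mul_sum, Finset.sum_filter]
  rw [Finset.sum_comm]
  refine Finset.sum_congr rfl fun σ _ => ?_
  by_cases hσ : NonFlat σ
  · simp only [hσ, true_and]
    have h1 : ∀ J : ∀ r, Finset (Fin (n r)),
        (if ∀ r b, b ∉ J r → IsSingletonBlock σ ⟨r, b⟩ then
          sgn J * ∫ x, rowProd g x ∂(diagMeasure lam σ) else 0) =
        (∏ r, if ∀ b, b ∉ J r → IsSingletonBlock σ ⟨r, b⟩ then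
          (-1 : ℝ) ^ (n r - (J r).card) else 0) * ∫ x, rowProd g x ∂(diagMeasure lam σ) := by
      intro J
      rw [Finset.prod_ite_zero]
      simp only [Finset.mem_univ, true_imp_iff, ite_mul, zero_mul]
      rfl
    simp_rw [h1]
    rw [← Finset.sum_mul]
    have h2 := Finset.prod_univ_sum (fun r => (Finset.univ : Finset (Finset (Fin (n r)))))
      (fun r J => if ∀ b, b ∉ J → IsSingletonBlock σ ⟨r, b⟩ then
          (-1 : ℝ) ^ (n r - J.card) else 0)
    rw [Fintype.piFinset_univ] at h2
    rw [← h2]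
    simp_rw [sum_neg_one_pow_compl]
    rw [Finset.prod_ite_zero]
    simp [GeTwo, Sigma.forall]
  · simp [hσ]

end

/-! ### Reduction to a standard Borel space -/

section Measurability

lemma measurable_finCons {X : Type*} [MeasurableSpace X] {m : ℕ} :
    Measurable fun p : X × (Fin m → X) => (Fin.cons p.1 p.2 : Fin (m + 1) → X) := by
  refine measurable_pi_lambda _ fun j => ?_
  refine Fin.cases ?_ (fun j => ?_) j
  · exact measurable_fst
  · exact (measurable_pi_apply j).comp measurable_snd

universe u

/-- Iterated factorial integrals depend measurably on parameters. -/
lemma measurable_facIntegralAux {X : Type u} [MeasurableSpace X] {μ : Measure X} [SFinite μ]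
    (m : ℕ) : ∀ {α : Type u} [MeasurableSpace α] (p : List (α → X)), (∀ q ∈ p, Measurable q) →
    ∀ G : α → (Fin m → X) → ℝ, Measurable (Function.uncurry G) →
    Measurable fun a => facIntegralAux μ m (p.map fun q => q a) (G a) := by
  induction m with
  | zero =>
    intro α _ p _ G hG
    exact hG.comp (f := fun a => (a, Fin.elim0)) (by fun_prop)
  | succ m ih =>
    intro α _ p hp G hG
    have hcons : ∀ {β : Type u} [MeasurableSpace β] (u : β → α) (v : β → X), Measurable u →
        Measurable v → Measurable (Function.uncurry fun (b : β) (y : Fin m → X) =>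
          G (u b) (Fin.cons (v b) y)) := by
      intro β _ u v hu hv
      refine hG.comp ((hu.comp measurable_fst).prodMk (measurable_finCons.comp
        ((hv.comp measurable_fst).prodMk measurable_snd)))
    have h1 : Measurable fun b : α × X => facIntegralAux μ m (b.2 :: p.map fun q => q b.1)
        fun y => G b.1 (Fin.cons b.2 y) := by
      have := ih (α := α × X) (Prod.snd :: p.map fun q b => q b.1) (by
        intro q hq
        rcases List.mem_cons.1 hq with rfl | hq
        · exact measurable_snd
        · obtain ⟨q', hq', rfl⟩ := List.mem_map.1 hq
          exact (hp q' hq').comp measurable_fst) _ (hcons _ _ measurable_fst measurable_snd)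
      simpa [Function.comp_def] using this
    have h2 : ∀ q ∈ p, Measurable fun a => facIntegralAux μ m (q a :: p.map fun q => q a)
        fun y => G a (Fin.cons (q a) y) := fun q hq =>
      h1.comp (f := fun a => (a, q a)) (measurable_id.prodMk (hp q hq))
    have h3 : Measurable fun a => ((p.map fun q a => facIntegralAux μ m
        (q a :: p.map fun q => q a) fun y => G a (Fin.cons (q a) y)).map fun f => f a).sum :=
      List.measurable_fun_sum _ (by
        intro f hf
        obtain ⟨q, hq, rfl⟩ := List.mem_map.1 hf
        exact h2 q hq)
    have h4 := (h1.stronglyMeasurable.integral_prod_right' (ν := μ)).measurable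
    simp only [List.map_map, Function.comp_def] at h3
    simp only [facIntegralAux, List.map_map, Function.comp_def]
    exact h4.sub h3

/-- Iterated factorial integrals of functions factoring through `φ` are iterated factorial
integrals with respect to the image measure. -/
lemma facIntegralAux_map {X Y : Type*} [MeasurableSpace X] [MeasurableSpace Y] {μ : Measure X}
    [SFinite μ] {φ : X → Y} (hφ : Measurable φ) (m : ℕ) : ∀ (ps : List X) (g : (Fin m → Y) → ℝ),
    Measurable g → facIntegralAux μ m ps (fun x => g fun j => φ (x j)) =
      facIntegralAux (μ.map φ) m (ps.map φ) g := by
  induction m with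
  | zero =>
    intro ps g _
    simp only [facIntegralAux]
    congr 1
    ext j; exact j.elim0
  | succ m ih =>
    intro ps g hg
    have hstep : ∀ x : X, facIntegralAux μ m (x :: ps)
        (fun y => g fun j => φ ((Fin.cons x y : Fin (m + 1) → X) j)) =
        facIntegralAux (μ.map φ) m (φ x :: ps.map φ) fun y => g (Fin.cons (φ x) y) := by
      intro x
      rw [← List.map_cons, ← ih (x :: ps) (fun y => g (Fin.cons (φ x) y))
        (hg.comp (measurable_finCons.comp measurable_prodMk_left))]
      congr 1
      ext y
      congr 1
      ext j
      refine Fin.cases ?_ (fun j => ?_) j <;> rfl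
    simp only [facIntegralAux, List.map_map, Function.comp_def, hstep]
    congr 1
    refine (integral_map hφ.aemeasurable (f := fun x => facIntegralAux (μ.map φ) m
      (x :: ps.map φ) fun y => g (Fin.cons x y)) ?_).symm
    have := measurable_facIntegralAux (μ := μ.map φ) m (α := Y)
      ((fun x => x) :: (ps.map φ).map fun c _ => c) (by
        intro q hq
        rcases List.mem_cons.1 hq with rfl | hq
        · exact measurable_id
        · obtain ⟨c, _, rfl⟩ := List.mem_map.1 hq
          exact measurable_const) (fun x y => g (Fin.cons x y)) (hg.comp measurable_finCons)
    simp only [List.map_cons, List.map_map, Function.comp_def] at this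
    simpa [Function.comp_def] using this.aestronglyMeasurable

/-- Multiple Wiener-Itô integrals of functions factoring through `φ` are multiple integrals for
the image measures. -/
lemma wienerIto_map {X Y : Type*} [MeasurableSpace X] [MeasurableSpace Y] {lam μ : Measure X}
    [SFinite μ] [SigmaFinite lam] {φ : X → Y} (hφ : Measurable φ) [SigmaFinite (lam.map φ)] {n : ℕ}
    {g : (Fin n → Y) → ℝ} (hg : Measurable g) :
    wienerIto lam (fun x => g fun j => φ (x j)) μ = wienerIto (lam.map φ) g (μ.map φ) := by
  unfold wienerIto
  refine Finset.sum_congr rfl fun J _ => ?_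
  congr 1
  have hm : Measurable fun p : (Fin J.card → Y) × ({i : Fin n // i ∉ J} → Y) =>
      g (glue J p.1 p.2) := by
    simp_rw [glue_eq_merge]
    exact hg.comp (measurable_merge _)
  have h1 : ∀ y : {i : Fin n // i ∉ J} → X,
      facIntegral μ (fun x => g fun j => φ (glue J x y j)) =
        facIntegral (μ.map φ) fun x => g (glue J x fun i => φ (y i)) := by
    intro y
    have := facIntegralAux_map (μ := μ) hφ J.card []
      (fun x => g (glue J x fun i => φ (y i))) (hm.comp measurable_prodMk_right)
    rw [facIntegral, facIntegral]
    refine Eq.trans ?_ this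
    congr 1
    ext x
    congr 1
    ext j
    unfold glue
    split_ifs <;> rfl
  simp_rw [h1]
  have hφm : Measurable fun (y : {i : Fin n // i ∉ J} → X) i => φ (y i) :=
    measurable_pi_lambda _ fun i => hφ.comp (measurable_pi_apply i)
  rw [← Measure.pi_map_pi (f := fun _ => φ) (fun _ => hφ.aemeasurable),
    integral_map hφm.aemeasurable]
  have := measurable_facIntegralAux (μ := μ.map φ) J.card (α := {i : Fin n // i ∉ J} → Y)
    [] (by simp) (fun y x => g (glue J x y)) (hm.comp measurable_swap)
  exact this.aestronglyMeasurable

end Measurability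

/-- A set of tuples which is measurable for the product `σ`-field only depends on countably many
measurable sets of the factors. -/
lemma exists_measurableSet_comap {X A : Type*} [MeasurableSpace X] {S : Set (A → X)}
    (hS : MeasurableSet S) : ∃ φ : X → (ℕ → Bool), Measurable φ ∧
      MeasurableSet[MeasurableSpace.comap (fun (x : A → X) a => φ (x a)) inferInstance] S := by
  classical
  have hS' : MeasurableSet[⨆ a : A, MeasurableSpace.comap (fun x : A → X => x a) inferInstance] S :=
    hS
  rw [MeasurableSpace.measurableSet_iSup] at hS'
  clear hS
  induction hS' with
  | basic S hS =>
    obtain ⟨a, B, hB, rfl⟩ := hS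
    refine ⟨fun x _ => decide (x ∈ B), measurable_pi_lambda _ fun _ => ?_,
      {y | y a 0 = true}, ?_, ?_⟩
    · exact measurable_to_bool (by
        have : (fun x => decide (x ∈ B)) ⁻¹' {true} = B := by ext; simp
        rw [this]; exact hB)
    · have : Measurable fun y : A → ℕ → Bool => y a 0 := by fun_prop
      exact this (MeasurableSet.singleton true)
    · ext x; simp
  | empty => exact ⟨fun _ _ => true, measurable_const, @MeasurableSet.empty _ (_)⟩
  | compl S _ ih =>
    obtain ⟨φ, hφ, h⟩ := ih
    exact ⟨φ, hφ, h.compl⟩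
  | iUnion S _ ih =>
    choose φ hφ h using ih
    refine ⟨fun x m => φ (Nat.unpair m).1 x (Nat.unpair m).2, measurable_pi_lambda _ fun m =>
      (measurable_pi_apply _).comp (hφ _), ?_⟩
    refine MeasurableSet.iUnion fun n => ?_
    obtain ⟨T, hT, hTS⟩ := h n
    rw [← hTS]
    refine ⟨(fun (y : A → ℕ → Bool) a k => y a (Nat.pair n k)) ⁻¹' T,
      (by fun_prop : Measurable fun (y : A → ℕ → Bool) a k => y a (Nat.pair n k)) hT, ?_⟩
    ext x
    simp

/-- The space of binary codes through which a finite family of functions and the `σ`-finiteness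
of the intensity measure factor. -/
abbrev CodeSpace (R : Type) : Type := ((R × ℚ) ⊕ ℕ) → ℕ → Bool

/-- Finitely many measurable functions of tuples factor through a map into a standard Borel space
under which the intensity measure remains `σ`-finite. -/
lemma exists_code {X : Type*} [MeasurableSpace X] (lam : Measure X) [SigmaFinite lam] {R : Type}
    [Finite R] {n : R → ℕ} {f : ∀ r, (Fin (n r) → X) → ℝ} (hf : ∀ r, Measurable (f r)) :
    ∃ φ : X → CodeSpace R, Measurable φ ∧ SigmaFinite (lam.map φ) ∧
      ∃ g : ∀ r, (Fin (n r) → CodeSpace R) → ℝ, (∀ r, Measurable (g r)) ∧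
        ∀ r x, f r x = g r fun j => φ (x j) := by
  choose φ₁ hφ₁ h₁ using fun p : R × ℚ =>
    exists_measurableSet_comap (hf p.1 (measurableSet_Iio (a := (p.2 : ℝ))))
  choose φ₂ hφ₂ h₂ using fun N : ℕ => exists_measurableSet_comap
    ((measurable_pi_apply (0 : Fin 1)) (measurableSet_spanningSets lam N))
  let φ : X → CodeSpace R := fun x => Sum.elim (fun p => φ₁ p x) (fun N => φ₂ N x)
  have hφ : Measurable φ := by
    refine measurable_pi_lambda _ fun i => ?_
    rcases i with p | N
    · exact hφ₁ p
    · exact hφ₂ N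
  refine ⟨φ, hφ, ?_, ?_⟩
  · choose T hT hTS using h₂
    let U : ℕ → Set (CodeSpace R) := fun N => {y | (fun _ : Fin 1 => y (Sum.inr N)) ∈ T N}
    have hU : ∀ N, MeasurableSet (U N) := fun N =>
      (by fun_prop : Measurable fun (y : CodeSpace R) (_ : Fin 1) => y (Sum.inr N)) (hT N)
    have hUS : ∀ N, φ ⁻¹' U N = spanningSets lam N := by
      intro N
      ext x
      have := congrArg (fun S : Set (Fin 1 → X) => (fun _ => x) ∈ S) (hTS N)
      exact iff_of_eq this
    have hspan : (⋃ N, U N) ∪ (⋃ N, U N)ᶜ = Set.univ := Set.union_compl_self _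
    have hnull : lam.map φ (⋃ N, U N)ᶜ = 0 := by
      rw [Measure.map_apply hφ (MeasurableSet.iUnion hU).compl, Set.preimage_compl,
        Set.preimage_iUnion]
      simp_rw [hUS]
      rw [iUnion_spanningSets]
      simp
    refine ⟨⟨⟨fun N => U N ∪ (⋃ N, U N)ᶜ, fun _ => trivial, fun N => ?_, ?_⟩⟩⟩
    · refine (measure_union_le _ _).trans_lt ?_
      rw [hnull, add_zero, Measure.map_apply hφ (hU N), hUS]
      exact measure_spanningSets_lt_top lam N
    · rw [← Set.iUnion_union]
      exact hspan
  · have hm : ∀ r, Measurable[MeasurableSpace.comap (fun (x : Fin (n r) → X) j => φ (x j))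
        inferInstance] (f r) := by
      intro r
      have hb : Real.measurableSpace =
          MeasurableSpace.generateFrom (⋃ a : ℚ, {Set.Iio (a : ℝ)}) :=
        (BorelSpace.measurable_eq).trans Real.borel_eq_generateFrom_Iio_rat
      rw [hb]
      refine @measurable_generateFrom _ _ (MeasurableSpace.comap _ inferInstance) _ _ ?_
      intro s hs
      obtain ⟨q, rfl⟩ : ∃ q : ℚ, Set.Iio (q : ℝ) = s := by simpa using hs
      obtain ⟨T, hT, hTS⟩ := h₁ (r, q)
      refine ⟨(fun (y : Fin (n r) → CodeSpace R) j => y j (Sum.inl (r, q))) ⁻¹' T,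
        (by fun_prop : Measurable fun (y : Fin (n r) → CodeSpace R) j => y j (Sum.inl (r, q))) hT,
        ?_⟩
      rw [← hTS]
      rfl
    choose g hg hgf using fun r => (hm r).exists_eq_measurable_comp
    exact ⟨g, hg, fun r x => congrFun (hgf r) x⟩

/-- The image of a Poisson process, modified on a null set in order to be finite on the sets of
the exhausting sequence for all `ω`. -/
lemma IsPoissonProcess.exists_map {Ω X Y : Type*} [MeasurableSpace Ω] [MeasurableSpace X]
    [MeasurableSpace Y] {P : Measure Ω} [IsProbabilityMeasure P] {lam : Measure X}
    {η : Ω → Measure X} (hη : IsPoissonProcess η lam P) {φ : X → Y} (hφ : Measurable φ)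
    [SigmaFinite (lam.map φ)] : ∃ η' : Ω → Measure Y, IsPoissonProcess η' (lam.map φ) P ∧
      (∀ ω N, η' ω (spanningSets (lam.map φ) N) < ⊤) ∧ ∀ᵐ ω ∂P, η' ω = (η ω).map φ := by
  classical
  let E := spanningSets (lam.map φ)
  have hE : ∀ N, MeasurableSet (E N) := measurableSet_spanningSets _
  let D : Set Ω := {ω | ∀ N, η ω (φ ⁻¹' E N) < ⊤}
  have hD : MeasurableSet D := by
    have : D = ⋂ N, {ω | η ω (φ ⁻¹' E N) < ⊤} := by ext; simp [D]
    rw [this]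
    exact MeasurableSet.iInter fun N => (hη.measurable_apply (hφ (hE N))) measurableSet_Iio
  have hDae : ∀ᵐ ω ∂P, ω ∈ D := by
    refine ae_all_iff.2 fun N => hη.ae_lt_top (hφ (hE N)) ?_
    rw [← Measure.map_apply hφ (hE N)]
    exact measure_spanningSets_lt_top _ N
  let η' : Ω → Measure Y := fun ω => if ω ∈ D then (η ω).map φ else 0
  have hη' : ∀ᵐ ω ∂P, η' ω = (η ω).map φ := by
    filter_upwards [hDae] with ω hω
    simp [η', hω]
  have hval : ∀ B, MeasurableSet B → (fun ω => η ω (φ ⁻¹' B)) =ᵐ[P] fun ω => η' ω B := by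
    intro B hB
    filter_upwards [hη'] with ω hω
    rw [hω, Measure.map_apply hφ hB]
  have hfin : ∀ ω N, η' ω (E N) < ⊤ := by
    intro ω N
    by_cases hω : ω ∈ D
    · simp only [η', hω, if_true]
      rw [Measure.map_apply hφ (hE N)]
      exact hω N
    · simp [η', hω]
  refine ⟨η', ⟨?_, ?_, ?_, ?_, ?_⟩, hfin, hη'⟩
  · exact Measurable.ite hD ((Measure.measurable_map φ hφ).comp hη.measurable) measurable_const
  · intro ω B hB
    by_cases hω : ω ∈ D
    · simp only [η', hω, if_true]
      rw [Measure.map_apply hφ hB]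
      exact hη.integerValued ω _ (hφ hB)
    · exact ⟨0, by simp [η', hω]⟩
  · intro ω
    exact ⟨⟨⟨E, fun _ => trivial, hfin ω, iUnion_spanningSets _⟩⟩⟩
  · intro B hB hB' k
    rw [Measure.map_apply hφ hB] at hB' ⊢
    rw [← hη.law _ (hφ hB) hB' k]
    refine measure_congr ?_
    filter_upwards [hval B hB] with ω hω
    exact congrArg (fun t => t = (k : ENNReal)) hω.symm
  · intro k B hB hd
    exact (hη.indep k (fun i => φ ⁻¹' B i) (fun i => hφ (hB i))
      (fun i j hij => (hd hij).preimage φ)).congr fun i => hval (B i) (hB i)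

open scoped Classical in
/-- Moments of products of multiple Wiener-Itô integrals on a general measurable space. -/
theorem integral_prod_wienerIto {Ω X : Type*} [MeasurableSpace Ω] [MeasurableSpace X]
    {P : Measure Ω} [IsProbabilityMeasure P] {lam : Measure X} [SigmaFinite lam]
    {η : Ω → Measure X} (hη : IsPoissonProcess η lam P) {R : Type} [Fintype R] {n : R → ℕ}
    {f : ∀ r, (Fin (n r) → X) → ℝ} (hf : ∀ r, Measurable (f r))
    (hfi : ∀ r, Integrable (f r) (Measure.pi fun _ => lam))
    (hint : ∀ σ : Setoid (Σ r, Fin (n r)), NonFlat σ →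
      Integrable (rowProd f) (diagMeasure lam σ)) :
    Integrable (fun ω => ∏ r, wienerIto lam (f r) (η ω)) P ∧
    ∫ ω, ∏ r, wienerIto lam (f r) (η ω) ∂P =
      ∑ σ : Setoid (Σ r, Fin (n r)) with NonFlat σ ∧ GeTwo σ,
        ∫ x, rowProd f x ∂(diagMeasure lam σ) := by
  obtain ⟨φ, hφ, hσ, g, hg, hfg⟩ := exists_code lam hf
  have hfg' : ∀ r, f r = fun x => g r fun j => φ (x j) := fun r => funext (hfg r)
  obtain ⟨η', hη', hfin, hae⟩ := hη.exists_map hφ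
  have hφm : ∀ C : Type, Measurable fun (x : C → X) c => φ (x c) := fun C =>
    measurable_pi_lambda _ fun c => hφ.comp (measurable_pi_apply c)
  have hrow : rowProd f = fun x => rowProd g fun c => φ (x c) := by
    ext x
    simp only [rowProd, hfg]
  have hW : (fun ω => ∏ r, wienerIto (lam.map φ) (g r) (η' ω)) =ᵐ[P]
      fun ω => ∏ r, wienerIto lam (f r) (η ω) := by
    filter_upwards [hae] with ω hω
    have := hη.sigmaFinite ω
    refine Finset.prod_congr rfl fun r _ => ?_
    rw [hω, hfg' r, wienerIto_map hφ (hg r)]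
  have hgi : ∀ r, Integrable (g r) (Measure.pi fun _ => lam.map φ) := by
    intro r
    rw [← Measure.pi_map_pi (f := fun _ => φ) (fun _ => hφ.aemeasurable)]
    refine (integrable_map_measure (hg r).aestronglyMeasurable (hφm _).aemeasurable).2 ?_
    have := hfi r
    rwa [hfg' r] at this
  have hgint : ∀ σ : Setoid (Σ r, Fin (n r)), NonFlat σ →
      Integrable (rowProd g) (diagMeasure (lam.map φ) σ) := by
    intro σ h
    rw [diagMeasure_map lam hφ]
    refine (integrable_map_measure (measurable_rowProd hg).aestronglyMeasurable
      (hφm _).aemeasurable).2 ?_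
    have := hint σ h
    rwa [hrow] at this
  obtain ⟨h1, h2⟩ := hη'.integral_prod_wienerIto hfin hg hgi hgint
  refine ⟨h1.congr hW, ?_⟩
  rw [← integral_congr_ae hW, h2]
  refine Finset.sum_congr rfl fun σ _ => ?_
  rw [diagMeasure_map lam hφ, integral_map (hφm _).aemeasurable
    (measurable_rowProd hg).aestronglyMeasurable, hrow]

lemma bot_of_nonFlat_unit {A : Unit → Type} {σ : Setoid (Σ r, A r)} (h : NonFlat σ) : σ = ⊥ := by
  ext ⟨r, a⟩ ⟨r', b⟩
  constructor
  · intro hab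
    have : a = b := h () a b hab
    rw [this]
  · intro hab
    have : (⟨r, a⟩ : Σ r, A r) = ⟨r', b⟩ := hab
    rw [this]

lemma integrable_wienerIto {Ω X : Type*} [MeasurableSpace Ω] [MeasurableSpace X]
    {P : Measure Ω} [IsProbabilityMeasure P] {lam : Measure X} [SigmaFinite lam]
    {η : Ω → Measure X} (hη : IsPoissonProcess η lam P) {n : ℕ}
    {f : (Fin n → X) → ℝ} (hf : Measurable f)
    (hfi : Integrable f (Measure.pi fun _ => lam)) :
    Integrable (fun ω => wienerIto lam f (η ω)) P := by
  have := (integral_prod_wienerIto hη (R := Unit) (n := fun _ => n) (f := fun _ => f)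
    (fun _ => hf) (fun _ => hfi) (fun σ hσ => by
      rw [bot_of_nonFlat_unit hσ, diagMeasure_bot]
      have h1 : rowProd (fun _ : Unit => f) =
          fun x : (Σ _ : Unit, Fin n) → X => f fun j => x ⟨(), j⟩ := by
        ext x; simp [rowProd]
      rw [h1]
      have h2 := map_pi_equiv lam (Equiv.uniqueSigma fun _ : Unit => Fin n).symm
      rw [← h2] at hfi
      exact hfi.comp_measurable (by fun_prop))).1
  simpa using this

/-! ### Moments of a random series -/

lemma hasSum_prod_option {R ι : Type} [Fintype R] {a : ι → ℝ} (ha : Summable fun i => ‖a i‖) {m : ℝ}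
    (h : HasSum (fun n : R → ι => ∏ r, a (n r)) m)
    (h' : Summable fun n : R → ι => ‖∏ r, a (n r)‖) :
    HasSum (fun n : Option R → ι => ∏ r, a (n r)) ((∑' i, a i) * m) ∧
      Summable fun n : Option R → ι => ‖∏ r, a (n r)‖ := by
  let e := Equiv.piOptionEquivProd (β := fun _ : Option R => ι)
  have he : (fun n : Option R → ι => ∏ r, a (n r)) =
      (fun p : ι × (R → ι) => a p.1 * ∏ r, a (p.2 r)) ∘ e := by
    ext n
    exact Fintype.prod_option _
  have hs := summable_mul_of_summable_norm ha h'
  constructor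
  · rw [he]
    exact (Equiv.hasSum_iff e).2 (ha.of_norm.hasSum.mul h hs)
  · have he' : (fun n : Option R → ι => ‖∏ r, a (n r)‖) =
        (fun p : ι × (R → ι) => ‖a p.1 * ∏ r, a (p.2 r)‖) ∘ e := by
      ext n
      exact congrArg norm (congrFun he n)
    rw [he']
    have h3 := Summable.mul_norm (f := a) (g := fun n : R → ι => ∏ r, a (n r)) ha h'
    exact (Equiv.summable_iff e).2 h3

/-- Powers of an absolutely convergent series. -/
lemma hasSum_prod_pow {ι : Type} {a : ι → ℝ} (ha : Summable fun i => ‖a i‖) (R : Type) [Fintype R] :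
    HasSum (fun n : R → ι => ∏ r, a (n r)) ((∑' i, a i) ^ Fintype.card R) ∧
      Summable fun n : R → ι => ‖∏ r, a (n r)‖ := by
  let Q : (R : Type) → [Fintype R] → Prop := fun R _ =>
    HasSum (fun n : R → ι => ∏ r, a (n r)) ((∑' i, a i) ^ Fintype.card R) ∧
      Summable fun n : R → ι => ‖∏ r, a (n r)‖
  have hequiv : ∀ (R R' : Type) [Fintype R] [Fintype R'] (e : R ≃ R'), Q R → Q R' := by
    intro R R' _ _ e h
    have he : (fun n : R' → ι => ∏ r, a (n r)) =
        (fun n : R → ι => ∏ r, a (n r)) ∘ (e.arrowCongr (Equiv.refl ι)).symm := by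
      ext n
      exact (e.prod_comp fun r => a (n r)).symm
    have he' : (fun n : R' → ι => ‖∏ r, a (n r)‖) =
        (fun n : R → ι => ‖∏ r, a (n r)‖) ∘ (e.arrowCongr (Equiv.refl ι)).symm := by
      ext n
      exact congrArg norm (congrFun he n)
    refine ⟨?_, ?_⟩
    · rw [he, ← Fintype.card_congr e]
      exact (Equiv.hasSum_iff _).2 h.1
    · rw [he']
      exact (Equiv.summable_iff _).2 h.2
  have hfin : ∀ k : ℕ, Q (Fin k) := by
    intro k
    induction k with
    | zero =>
      have h0 : HasSum (fun n : Fin 0 → ι => ∏ r, a (n r)) 1 := by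
        simp
      exact ⟨by simp, (hasSum_fintype _).summable⟩
    | succ k ih =>
      refine hequiv (Option (Fin k)) _ (finSuccEquiv k).symm ?_
      obtain ⟨h1, h2⟩ := hasSum_prod_option ha ih.1 ih.2
      refine ⟨?_, h2⟩
      rwa [Fintype.card_option, pow_succ']
  exact hequiv _ _ (Fintype.equivFin R).symm (hfin _)

lemma summable_norm_of_tsum_enorm_ne_top {ι : Type*} {a : ι → ℝ} (h : ∑' i, ‖a i‖ₑ ≠ ⊤) :
    Summable fun i => ‖a i‖ := by
  simpa using ENNReal.summable_toReal h

lemma enorm_finset_prod {ι : Type*} (s : Finset ι) (a : ι → ℝ) :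
    ‖∏ i ∈ s, a i‖ₑ = ∏ i ∈ s, ‖a i‖ₑ := by
  simp_rw [enorm_eq_nnnorm, nnnorm_prod, ENNReal.ofNNReal_finsetProd]

section

variable {Ω : Type*} [MeasurableSpace Ω] {P : Measure Ω} {I : ℕ+ → Ω → ℝ}

lemma ae_tsum_lt_top {ℓ : ℕ} (hℓ : 1 ≤ ℓ) (hI : ∀ n, AEStronglyMeasurable (I n) P)
    (hmom : ∫⁻ ω, (∑' n, ‖I n ω‖ₑ) ^ ℓ ∂P < ⊤) : ∀ᵐ ω ∂P, ∑' n, ‖I n ω‖ₑ < ⊤ := by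
  have hm : AEMeasurable (fun ω => (∑' n, ‖I n ω‖ₑ) ^ ℓ) P :=
    (AEMeasurable.tsum fun n => (hI n).enorm).pow_const ℓ
  filter_upwards [ae_lt_top' hm hmom.ne] with ω hω
  exact (ENNReal.pow_lt_top_iff.1 hω).resolve_right (by omega)

lemma aestronglyMeasurable_tsum (hI : ∀ n, AEStronglyMeasurable (I n) P)
    (hS : ∀ᵐ ω ∂P, ∑' n, ‖I n ω‖ₑ < ⊤) : AEStronglyMeasurable (fun ω => ∑' n, I n ω) P := by
  refine aestronglyMeasurable_of_tendsto_ae (u := Filter.atTop)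
    (f := fun (s : Finset ℕ+) ω => ∑ n ∈ s, I n ω) ?_ ?_
  · intro s
    exact Finset.aestronglyMeasurable_fun_sum s fun n _ => hI n
  · filter_upwards [hS] with ω hω
    exact (summable_norm_of_tsum_enorm_ne_top hω.ne).of_norm.hasSum

lemma lintegral_pow_lt_top_of_le [IsProbabilityMeasure P] {S : Ω → ENNReal} {k ℓ : ℕ} (hk : k ≤ ℓ)
    (h : ∫⁻ ω, S ω ^ ℓ ∂P < ⊤) : ∫⁻ ω, S ω ^ k ∂P < ⊤ := by
  calc ∫⁻ ω, S ω ^ k ∂P ≤ ∫⁻ ω, (1 + S ω ^ ℓ) ∂P := by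
        refine lintegral_mono fun ω => ?_
        rcases le_total (S ω) 1 with h1 | h1
        · exact (pow_le_one₀ bot_le h1).trans le_self_add
        · exact (pow_le_pow_right₀ h1 hk).trans le_add_self
    _ = 1 + ∫⁻ ω, S ω ^ ℓ ∂P := by
        rw [lintegral_add_left measurable_const]; simp
    _ < ⊤ := by simp [h]

/-- Term by term integration of a power of an absolutely convergent random series. -/
lemma hasSum_integral_prod (hI : ∀ n, AEStronglyMeasurable (I n) P)
    (hS : ∀ᵐ ω ∂P, ∑' n, ‖I n ω‖ₑ < ⊤) {R : Type} [Fintype R]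
    (hmom : ∫⁻ ω, (∑' n, ‖I n ω‖ₑ) ^ Fintype.card R ∂P < ⊤) :
    Integrable (fun ω => (∑' n, I n ω) ^ Fintype.card R) P ∧
    HasSum (fun n : R → ℕ+ => ∫ ω, ∏ r, I (n r) ω ∂P)
      (∫ ω, (∑' n, I n ω) ^ Fintype.card R ∂P) := by
  have hsum : ∀ᵐ ω ∂P, Summable fun n => ‖I n ω‖ := by
    filter_upwards [hS] with ω hω
    exact summable_norm_of_tsum_enorm_ne_top hω.ne
  have hprod : ∀ᵐ ω ∂P, HasSum (fun n : R → ℕ+ => ∏ r, I (n r) ω)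
      ((∑' n, I n ω) ^ Fintype.card R) := by
    filter_upwards [hsum] with ω hω
    exact (hasSum_prod_pow hω R).1
  have hmeas : ∀ n : R → ℕ+, AEStronglyMeasurable (fun ω => ∏ r, I (n r) ω) P := fun n =>
    Finset.aestronglyMeasurable_fun_prod _ fun r _ => hI (n r)
  have htot : ∑' n : R → ℕ+, ∫⁻ ω, ‖∏ r, I (n r) ω‖ₑ ∂P < ⊤ := by
    rw [← lintegral_tsum fun n => (hmeas n).enorm]
    refine lt_of_eq_of_lt (lintegral_congr fun ω => ?_) hmom
    simp_rw [enorm_finset_prod]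
    rw [← ENNReal_prod_tsum (fun (_ : R) (n : ℕ+) => ‖I n ω‖ₑ)]
    simp
  have hint : ∀ n : R → ℕ+, Integrable (fun ω => ∏ r, I (n r) ω) P := fun n =>
    ⟨hmeas n, (ENNReal.le_tsum n).trans_lt htot⟩
  have hsn : Summable fun n : R → ℕ+ => ∫ ω, ‖∏ r, I (n r) ω‖ ∂P := by
    have h1 : ∀ n : R → ℕ+, ∫ ω, ‖∏ r, I (n r) ω‖ ∂P =
        (∫⁻ ω, ‖∏ r, I (n r) ω‖ₑ ∂P).toReal := fun n =>
      integral_norm_eq_lintegral_enorm (hmeas n)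
    simp_rw [h1]
    exact ENNReal.summable_toReal htot.ne
  refine ⟨⟨(aestronglyMeasurable_tsum hI hS).pow _, ?_⟩, ?_⟩
  · refine lt_of_le_of_lt (lintegral_mono_ae ?_) hmom
    filter_upwards [hS] with ω hω
    rw [enorm_pow]
    exact pow_le_pow_left₀ bot_le (enorm_tsum_le_tsum_enorm) _
  · have h2 := hasSum_integral_of_summable_integral_norm hint hsn
    rwa [integral_congr_ae (g := fun ω => (∑' n, I n ω) ^ Fintype.card R)
      (by filter_upwards [hprod] with ω hω; exact hω.tsum_eq)] at h2

end

/-! ### Cumulants -/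

/-- The characteristic function of `(F, …, F)` is a function of the sum of its arguments, so that
its mixed partial derivatives are ordinary iterated derivatives. -/
lemma foldr_partialDeriv {ℓ : ℕ} (g : ℝ → ℂ) (L : List (Fin ℓ)) :
    L.foldr partialDeriv (fun z => g (∑ i, z i)) =
      fun z => iteratedDeriv L.length g (∑ i, z i) := by
  induction L with
  | nil => simp
  | cons i L ih =>
    rw [List.foldr_cons, ih]
    ext z
    have h1 : ∀ t : ℝ, ∑ j, Function.update z i t j = t + ∑ j ∈ Finset.univ.erase i, z j := by
      intro t
      rw [← Finset.add_sum_erase _ _ (Finset.mem_univ i), Function.update_self]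
      congr 1
      refine Finset.sum_congr rfl fun j hj => ?_
      rw [Function.update_of_ne (Finset.ne_of_mem_erase hj)]
    unfold partialDeriv
    simp only [h1]
    rw [deriv_comp_add_const, Finset.add_sum_erase _ _ (Finset.mem_univ i), List.length_cons,
      iteratedDeriv_succ]

variable {Ω : Type*} [MeasurableSpace Ω] {P : Measure Ω} {F : Ω → ℝ}

lemma cumulant_eq_iteratedDeriv (hF : AEMeasurable F P) (k : ℕ) :
    cumulant P k F = (-Complex.I) ^ k *
      iteratedDeriv k (fun t => Complex.log (charFun (P.map F) t)) 0 := by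
  unfold cumulant jointCumulant mixedPartialDeriv
  congr 1
  have h1 : (fun z : Fin k → ℝ => Complex.log (∫ ω, Complex.exp (Complex.I *
      ((∑ i, z i * F ω : ℝ) : ℂ)) ∂P)) =
      fun z => (fun t => Complex.log (charFun (P.map F) t)) (∑ i, z i) := by
    ext z
    simp only [charFun_apply_real]
    rw [integral_map hF (by fun_prop)]
    congr 2
    ext ω
    congr 1
    rw [← Finset.sum_mul]
    push_cast
    ring
  rw [h1, foldr_partialDeriv (fun t => Complex.log (charFun (P.map F) t))]
  simp

lemma memLp_map {ℓ : ℕ} (hF : AEStronglyMeasurable F P) (hint : Integrable (fun ω => F ω ^ ℓ) P) :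
    MemLp id ℓ (P.map F) := by
  rw [memLp_map_measure_iff (by fun_prop) hF.aemeasurable]
  rcases Nat.eq_zero_or_pos ℓ with rfl | hℓ
  · simpa using hF
  · have h1 : (ℓ : ENNReal) ≠ 0 := by exact_mod_cast hℓ.ne'
    refine (integrable_norm_rpow_iff (by exact hF) h1 (ENNReal.natCast_ne_top ℓ)).1 ?_
    simpa using hint.norm

/-- The recursion between moments and cumulants, obtained by differentiating
`φ' = φ (log φ)'`. -/
lemma moment_succ_eq_sum [IsProbabilityMeasure P] {ℓ : ℕ} (hF : AEStronglyMeasurable F P)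
    (hint : Integrable (fun ω => F ω ^ ℓ) P) {k : ℕ} (hk : k + 1 ≤ ℓ) :
    ((∫ ω, F ω ^ (k + 1) ∂P : ℝ) : ℂ) = ∑ j ∈ Finset.range (k + 1), (k.choose j : ℂ) *
      (cumulant P (j + 1) F * ((∫ ω, F ω ^ (k - j) ∂P : ℝ) : ℂ)) := by
  have hFm := hF.aemeasurable
  have : IsProbabilityMeasure (P.map F) := Measure.isProbabilityMeasure_map hFm
  have hL := memLp_map hF hint
  set φ : ℝ → ℂ := charFun (P.map F) with hφ
  have hφc : ContDiff ℝ ℓ φ := contDiff_charFun hL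
  have hφ0 : φ 0 = 1 := by simp [hφ]
  have hslit : φ 0 ∈ Complex.slitPlane := by rw [hφ0]; exact Complex.one_mem_slitPlane
  have hlogC : ContDiffAt ℝ ℓ Complex.log (φ 0) := (Complex.contDiffAt_log hslit).restrict_scalars ℝ
  have hlog : ContDiffAt ℝ ℓ (fun t => Complex.log (φ t)) 0 :=
    ContDiffAt.comp (0 : ℝ) hlogC hφc.contDiffAt
  have hmom : ∀ j ≤ ℓ, iteratedDeriv j φ 0 = Complex.I ^ j * ((∫ ω, F ω ^ j ∂P : ℝ) : ℂ) := by
    intro j hj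
    have hLj : MemLp id j (P.map F) := hL.mono_exponent (by exact_mod_cast hj)
    rw [hφ, iteratedDeriv_charFun_zero hLj, integral_map hFm (by fun_prop)]
  have hder : deriv φ =ᶠ[nhds 0] deriv (fun t => Complex.log (φ t)) * φ := by
    have hopen : ∀ᶠ t in nhds (0 : ℝ), φ t ∈ Complex.slitPlane :=
      hφc.continuous.continuousAt.eventually_mem (Complex.isOpen_slitPlane.mem_nhds hslit)
    filter_upwards [hopen] with t ht
    have hd : HasDerivAt φ (deriv φ t) t :=
      ((hφc.differentiable (by exact_mod_cast (by omega : ℓ ≠ 0))) t).hasDerivAt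
    rw [Pi.mul_apply, (hd.clog_real ht).deriv, div_mul_cancel₀ _ (Complex.slitPlane_ne_zero ht)]
  have hkey : iteratedDeriv (k + 1) φ 0 = ∑ j ∈ Finset.range (k + 1), (k.choose j : ℂ) *
      iteratedDeriv (j + 1) (fun t => Complex.log (φ t)) 0 * iteratedDeriv (k - j) φ 0 := by
    rw [iteratedDeriv_succ', hder.iteratedDeriv_eq k, iteratedDeriv_mul]
    · simp_rw [iteratedDeriv_succ']
    · have h1 : ContDiffAt ℝ k (fderiv ℝ fun t => Complex.log (φ t)) 0 :=
        hlog.fderiv_right (by exact_mod_cast hk)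
      exact h1.clm_apply contDiffAt_const
    · exact hφc.contDiffAt.of_le (by exact_mod_cast (by omega : k ≤ ℓ))
  have hI : ∀ n : ℕ, (-Complex.I) ^ n * Complex.I ^ n = 1 := fun n => by
    rw [← mul_pow]; simp
  calc ((∫ ω, F ω ^ (k + 1) ∂P : ℝ) : ℂ)
      = (-Complex.I) ^ (k + 1) * iteratedDeriv (k + 1) φ 0 := by
        rw [hmom _ hk, ← mul_assoc, hI, one_mul]
    _ = _ := by
        rw [hkey, Finset.mul_sum]
        refine Finset.sum_congr rfl fun j hj => ?_
        have hj' : j ≤ k := Nat.lt_succ_iff.1 (Finset.mem_range.1 hj)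
        rw [hmom _ (by omega), cumulant_eq_iteratedDeriv hFm]
        have hp : (-Complex.I) ^ (k + 1) = (-Complex.I) ^ (j + 1) * (-Complex.I) ^ (k - j) := by
          rw [← pow_add]; congr 1; omega
        rw [hp]
        linear_combination (k.choose j : ℂ) * (-Complex.I) ^ (j + 1) *
          iteratedDeriv (j + 1) (fun t => Complex.log (φ t)) 0 *
          ((∫ ω, F ω ^ (k - j) ∂P : ℝ) : ℂ) * hI (k - j)

/-! ### Connected components of diagrams -/

/-- The cells of a diagram are those in the rows satisfying `p` and those in the other rows. -/
def rowSplit {R : Type} (A : R → Type) (p : R → Prop) [DecidablePred p] :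
    (Σ r, A r) ≃ (Σ r : {r // p r}, A r) ⊕ (Σ r : {r // ¬ p r}, A r) where
  toFun c := if h : p c.1 then Sum.inl ⟨⟨c.1, h⟩, c.2⟩ else Sum.inr ⟨⟨c.1, h⟩, c.2⟩
  invFun := Sum.elim (fun a => ⟨a.1.1, a.2⟩) (fun b => ⟨b.1.1, b.2⟩)
  left_inv c := by
    by_cases h : p c.1 <;> simp [h]
  right_inv c := by
    rcases c with ⟨⟨r, hr⟩, a⟩ | ⟨⟨r, hr⟩, a⟩ <;> simp [hr]

/-- The finest partition of the set of rows for which any two rows meeting a common block of `σ`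
are equivalent. -/
def rowConn {R : Type} {A : R → Type} (σ : Setoid (Σ r, A r)) : Setoid R :=
  Relation.EqvGen.setoid fun i j => ∃ a b, σ ⟨i, a⟩ ⟨j, b⟩

/-- Any two rows are linked by a chain of blocks of the partition. -/
def Connected {R : Type} {A : R → Type} (σ : Setoid (Σ r, A r)) : Prop :=
  ∀ i j, rowConn σ i j

section

variable {R : Type} {A : R → Type}

lemma rowConn_of_rel {σ : Setoid (Σ r, A r)} {i j : R} {a : A i} {b : A j}
    (h : σ ⟨i, a⟩ ⟨j, b⟩) : rowConn σ i j :=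
  Relation.EqvGen.rel _ _ ⟨a, b, h⟩

/-- `rowConn σ` is the finest partition with this property. -/
lemma rowConn_le {σ : Setoid (Σ r, A r)} {T : Setoid R}
    (h : ∀ i a j b, σ ⟨i, a⟩ ⟨j, b⟩ → T i j) : rowConn σ ≤ T := by
  intro i j hij
  induction hij with
  | rel i j hij => obtain ⟨a, b, hab⟩ := hij; exact h i a j b hab
  | refl i => exact T.refl' i
  | symm i j _ ih => exact T.symm' ih
  | trans i j k _ _ ih₁ ih₂ => exact T.trans' ih₁ ih₂

variable (p : R → Prop) [DecidablePred p] (s : Setoid (Σ r : {r // p r}, A r))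
  (t : Setoid (Σ r : {r // ¬ p r}, A r))

lemma join_rowSplit_pos {i j : R} (hi : p i) (hj : p j) {a : A i} {b : A j} :
    joinSetoid (rowSplit A p) s t ⟨i, a⟩ ⟨j, b⟩ ↔ s ⟨⟨i, hi⟩, a⟩ ⟨⟨j, hj⟩, b⟩ :=
  joinSetoid_inl_inl (rowSplit A p) s t (a := ⟨⟨i, hi⟩, a⟩) (a' := ⟨⟨j, hj⟩, b⟩)

lemma join_rowSplit_neg {i j : R} (hi : ¬ p i) (hj : ¬ p j) {a : A i} {b : A j} :
    joinSetoid (rowSplit A p) s t ⟨i, a⟩ ⟨j, b⟩ ↔ t ⟨⟨i, hi⟩, a⟩ ⟨⟨j, hj⟩, b⟩ :=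
  joinSetoid_inr_inr (rowSplit A p) s t (b := ⟨⟨i, hi⟩, a⟩) (b' := ⟨⟨j, hj⟩, b⟩)

lemma join_rowSplit_iff {i j : R} {a : A i} {b : A j}
    (h : joinSetoid (rowSplit A p) s t ⟨i, a⟩ ⟨j, b⟩) : p i ↔ p j := by
  by_contra hij
  by_cases hi : p i <;> by_cases hj : p j
  · exact hij (iff_of_true hi hj)
  · exact not_joinSetoid_inl_inr (rowSplit A p) s t (a := ⟨⟨i, hi⟩, a⟩) (b := ⟨⟨j, hj⟩, b⟩) h
  · exact not_joinSetoid_inl_inr (rowSplit A p) s t (a := ⟨⟨j, hj⟩, b⟩) (b := ⟨⟨i, hi⟩, a⟩)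
      (Setoid.symm' _ h)
  · exact hij (iff_of_false hi hj)

lemma nonFlat_join_rowSplit :
    NonFlat (joinSetoid (rowSplit A p) s t) ↔ NonFlat s ∧ NonFlat t := by
  constructor
  · exact fun h => ⟨fun r a b hab => h r a b ((join_rowSplit_pos p s t r.2 r.2).2 hab),
      fun r a b hab => h r a b ((join_rowSplit_neg p s t r.2 r.2).2 hab)⟩
  · rintro ⟨h1, h2⟩ r a b hab
    by_cases hr : p r
    · exact h1 ⟨r, hr⟩ a b ((join_rowSplit_pos p s t hr hr).1 hab)
    · exact h2 ⟨r, hr⟩ a b ((join_rowSplit_neg p s t hr hr).1 hab)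

end

lemma isSingletonBlock_join_inl {A B C : Type*} (e : C ≃ A ⊕ B) (s : Setoid A) (t : Setoid B)
    (a : A) : IsSingletonBlock (joinSetoid e s t) (e.symm (Sum.inl a)) ↔ IsSingletonBlock s a := by
  constructor
  · intro h d hd
    have := h _ ((joinSetoid_inl_inl e s t).2 hd)
    simpa using this
  · intro h d hd
    obtain ⟨d, rfl⟩ := e.symm.surjective d
    rcases d with d | d
    · rw [h d ((joinSetoid_inl_inl e s t).1 hd)]
    · exact absurd hd (not_joinSetoid_inl_inr e s t)

lemma isSingletonBlock_join_inr {A B C : Type*} (e : C ≃ A ⊕ B) (s : Setoid A) (t : Setoid B)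
    (b : B) : IsSingletonBlock (joinSetoid e s t) (e.symm (Sum.inr b)) ↔ IsSingletonBlock t b := by
  constructor
  · intro h d hd
    have := h _ ((joinSetoid_inr_inr e s t).2 hd)
    simpa using this
  · intro h d hd
    obtain ⟨d, rfl⟩ := e.symm.surjective d
    rcases d with d | d
    · exact absurd (Setoid.symm' _ hd) (not_joinSetoid_inl_inr e s t)
    · rw [h d ((joinSetoid_inr_inr e s t).1 hd)]

lemma geTwo_join {A B C : Type*} (e : C ≃ A ⊕ B) (s : Setoid A) (t : Setoid B) :
    GeTwo (joinSetoid e s t) ↔ GeTwo s ∧ GeTwo t := by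
  unfold GeTwo
  rw [e.symm.surjective.forall, Sum.forall]
  simp only [isSingletonBlock_join_inl, isSingletonBlock_join_inr]

section

variable {R : Type} {A : R → Type} (p : R → Prop) [DecidablePred p]
  (s : Setoid (Σ r : {r // p r}, A r)) (t : Setoid (Σ r : {r // ¬ p r}, A r))

/-- The rows satisfying `p` form the component of `r₀` if they are connected among themselves. -/
lemma component_join_iff {r₀ : R} (h₀ : p r₀) :
    (∀ r, rowConn (joinSetoid (rowSplit A p) s t) r₀ r ↔ p r) ↔ Connected s := by
  have hp : ∀ {i j}, rowConn (joinSetoid (rowSplit A p) s t) i j → (p i ↔ p j) := fun h =>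
    rowConn_le (T := ⟨fun i j => p i ↔ p j, fun _ => Iff.rfl, Iff.symm, Iff.trans⟩)
      (fun i a j b => join_rowSplit_iff p s t) h
  constructor
  · intro h
    -- a row is related to `r₀` only if it lies in the component of `r₀` with respect to `s`
    have hU : rowConn (joinSetoid (rowSplit A p) s t) ≤
        Setoid.ker fun i => ∃ hi : p i, rowConn s ⟨r₀, h₀⟩ ⟨i, hi⟩ := by
      refine rowConn_le fun i a j b hab => propext ?_
      have hij := join_rowSplit_iff p s t hab
      constructor
      · rintro ⟨hi, hc⟩
        exact ⟨hij.1 hi, Setoid.trans' _ hc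
          (rowConn_of_rel ((join_rowSplit_pos p s t hi (hij.1 hi)).1 hab))⟩
      · rintro ⟨hj, hc⟩
        exact ⟨hij.2 hj, Setoid.trans' _ hc
          (Setoid.symm' _ (rowConn_of_rel ((join_rowSplit_pos p s t (hij.2 hj) hj).1 hab)))⟩
    have h0 : ∀ i : {r // p r}, rowConn s ⟨r₀, h₀⟩ i := by
      intro i
      have h1 : (∃ hi : p r₀, rowConn s ⟨r₀, h₀⟩ ⟨r₀, hi⟩) =
        ∃ hi : p i.1, rowConn s ⟨r₀, h₀⟩ ⟨i.1, hi⟩ := hU ((h i.1).2 i.2)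
      have h2 : ∃ hi : p i.1, rowConn s ⟨r₀, h₀⟩ ⟨i.1, hi⟩ :=
        h1.mp ⟨h₀, Setoid.refl' _ _⟩
      exact h2.2
    exact fun i j => Setoid.trans' _ (Setoid.symm' _ (h0 i)) (h0 j)
  · intro h r
    refine ⟨fun hr => (hp hr).1 h₀, fun hr => ?_⟩
    have h1 : rowConn s ≤ (rowConn (joinSetoid (rowSplit A p) s t)).comap Subtype.val :=
      rowConn_le fun i a j b hab => rowConn_of_rel ((join_rowSplit_pos p s t i.2 j.2).2 hab)
    exact h1 (h ⟨r₀, h₀⟩ ⟨r, hr⟩)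

open scoped Classical in
/-- The partitions for which the component of `r₀` consists of the rows satisfying `p` are
composed of a connected partition of these rows and a partition of the other ones. -/
lemma sum_component [Finite R] [∀ r, Finite (A r)] {r₀ : R} (h₀ : p r₀)
    (G : Setoid (Σ r, A r) → ℝ) :
    ∑ σ : Setoid (Σ r, A r) with (NonFlat σ ∧ GeTwo σ) ∧ ∀ r, rowConn σ r₀ r ↔ p r, G σ =
      ∑ s : Setoid (Σ r : {r // p r}, A r) with NonFlat s ∧ GeTwo s ∧ Connected s,
        ∑ t : Setoid (Σ r : {r // ¬ p r}, A r) with NonFlat t ∧ GeTwo t,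
          G (joinSetoid (rowSplit A p) s t) := by
  rw [← Finset.sum_product']
  symm
  refine Finset.sum_bij (fun q _ => joinSetoid (rowSplit A p) q.1 q.2) ?_ ?_ ?_ ?_
  · rintro ⟨s, t⟩ hst
    simp only [Finset.mem_product, Finset.mem_filter, Finset.mem_univ, true_and] at hst ⊢
    rw [nonFlat_join_rowSplit, geTwo_join, component_join_iff p s t h₀]
    tauto
  · intro q _ q' _ h
    exact (joinEquiv (rowSplit A p)).injective (Subtype.ext h)
  · intro σ hσ
    simp only [Finset.mem_filter, Finset.mem_univ, true_and] at hσ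
    have hcross : ∀ a b, ¬ σ ((rowSplit A p).symm (Sum.inl a))
        ((rowSplit A p).symm (Sum.inr b)) := by
      rintro ⟨i, a⟩ ⟨j, b⟩ hab
      exact j.2 ((hσ.2 j.1).1 (Setoid.trans' _ ((hσ.2 i.1).2 i.2) (rowConn_of_rel hab)))
    obtain ⟨⟨s, t⟩, hst⟩ := (joinEquiv (rowSplit A p)).surjective ⟨σ, hcross⟩
    have hst' : joinSetoid (rowSplit A p) s t = σ := congrArg Subtype.val hst
    subst hst'
    rw [nonFlat_join_rowSplit, geTwo_join, component_join_iff p s t h₀] at hσ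
    refine ⟨(s, t), ?_, rfl⟩
    simp only [Finset.mem_product, Finset.mem_filter, Finset.mem_univ, true_and]
    tauto
  · intro q _
    rfl

end

/-! ### Diagram sums -/

lemma rowProd_merge {X : Type*} {R : Type} [Fintype R] {A : R → Type} (p : R → Prop)
    [DecidablePred p] [Fintype {r // p r}] [Fintype {r // ¬ p r}] (g : ∀ r, (A r → X) → ℝ)
    (x : ((Σ r : {r // p r}, A r) → X) × ((Σ r : {r // ¬ p r}, A r) → X)) :
    rowProd g (merge (rowSplit A p) x) =
      rowProd (fun r : {r // p r} => g r) x.1 * rowProd (fun r : {r // ¬ p r} => g r) x.2 := by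
  unfold rowProd
  rw [← Fintype.prod_subtype_mul_prod_subtype p]
  congr 1
  · refine Finset.prod_congr (by ext; simp) fun r _ => ?_
    congr 1
    ext a
    simp [merge, rowSplit, r.2]
  · refine Finset.prod_congr (by ext; simp) fun r _ => ?_
    congr 1
    ext a
    simp [merge, rowSplit, r.2]

section

variable {X : Type*} [MeasurableSpace X] {R : Type} [Fintype R] {n : R → ℕ}

lemma integral_rowProd_join (lam : Measure X) [SigmaFinite lam] (p : R → Prop)
    [DecidablePred p] [Fintype {r // p r}] [Fintype {r // ¬ p r}]
    {g : ∀ r, (Fin (n r) → X) → ℝ} (hg : ∀ r, Measurable (g r))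
    (s : Setoid (Σ r : {r // p r}, Fin (n r))) (t : Setoid (Σ r : {r // ¬ p r}, Fin (n r))) :
    ∫ x, rowProd g x ∂(diagMeasure lam (joinSetoid (rowSplit (fun r => Fin (n r)) p) s t)) =
      (∫ x, rowProd (fun r : {r // p r} => g r) x ∂(diagMeasure lam s)) *
        ∫ x, rowProd (fun r : {r // ¬ p r} => g r) x ∂(diagMeasure lam t) := by
  rw [diagMeasure_join, integral_map (measurable_merge _).aemeasurable
    (measurable_rowProd hg).aestronglyMeasurable]
  simp_rw [rowProd_merge]
  exact integral_prod_mul (fun x => rowProd (fun r : {r // p r} => g r) x)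
    (fun x => rowProd (fun r : {r // ¬ p r} => g r) x)

lemma lintegral_rowProd_join (lam : Measure X) [SigmaFinite lam] (p : R → Prop)
    [DecidablePred p] [Fintype {r // p r}] [Fintype {r // ¬ p r}]
    {g : ∀ r, (Fin (n r) → X) → ℝ} (hg : ∀ r, Measurable (g r))
    (s : Setoid (Σ r : {r // p r}, Fin (n r))) (t : Setoid (Σ r : {r // ¬ p r}, Fin (n r))) :
    ∫⁻ x, ‖rowProd g x‖ₑ ∂(diagMeasure lam
      (joinSetoid (rowSplit (fun r => Fin (n r)) p) s t)) =
      (∫⁻ x, ‖rowProd (fun r : {r // p r} => g r) x‖ₑ ∂(diagMeasure lam s)) *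
        ∫⁻ x, ‖rowProd (fun r : {r // ¬ p r} => g r) x‖ₑ ∂(diagMeasure lam t) := by
  rw [diagMeasure_join, lintegral_map (measurable_rowProd hg).enorm (measurable_merge _)]
  simp_rw [rowProd_merge, enorm_mul]
  exact lintegral_prod_mul (measurable_rowProd fun r => hg r.1).enorm.aemeasurable
    (measurable_rowProd fun r => hg r.1).enorm.aemeasurable

open scoped Classical in
/-- The sum of the integrals of `⊗ g_r` over all non-flat partitions with blocks of size at
least two. -/
def diagramSum (lam : Measure X) (g : ∀ r, (Fin (n r) → X) → ℝ) : ℝ :=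
  ∑ σ : Setoid (Σ r, Fin (n r)) with NonFlat σ ∧ GeTwo σ, ∫ x, rowProd g x ∂(diagMeasure lam σ)

open scoped Classical in
/-- The sum of the integrals of `⊗ g_r` over all connected non-flat partitions with blocks of size
at least two. -/
def connectedSum (lam : Measure X) (g : ∀ r, (Fin (n r) → X) → ℝ) : ℝ :=
  ∑ σ : Setoid (Σ r, Fin (n r)) with NonFlat σ ∧ GeTwo σ ∧ Connected σ,
    ∫ x, rowProd g x ∂(diagMeasure lam σ)

open scoped Classical in
/-- Decomposition of the diagram sum according to the component of the row `r₀`. -/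
lemma diagramSum_eq_sum_component (lam : Measure X) [SigmaFinite lam]
    {g : ∀ r, (Fin (n r) → X) → ℝ} (hg : ∀ r, Measurable (g r)) (r₀ : R) :
    diagramSum lam g = connectedSum lam g + ∑ S : Finset R with r₀ ∈ S ∧ S ≠ Finset.univ,
      connectedSum lam (fun r : {r // r ∈ S} => g r) *
        diagramSum lam (fun r : {r // r ∉ S} => g r) := by
  have hsplit : ∀ S : Finset R, r₀ ∈ S →
      ∑ σ : Setoid (Σ r, Fin (n r)) with (NonFlat σ ∧ GeTwo σ) ∧ ∀ r, rowConn σ r₀ r ↔ r ∈ S,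
        ∫ x, rowProd g x ∂(diagMeasure lam σ) =
      connectedSum lam (fun r : {r // r ∈ S} => g r) *
        diagramSum lam (fun r : {r // r ∉ S} => g r) := by
    intro S hS
    refine (Finset.sum_congr (by ext; simp only [Finset.mem_filter]) fun _ _ => rfl).trans
      ((sum_component (fun r => r ∈ S) hS fun σ => ∫ x, rowProd g x ∂(diagMeasure lam σ)).trans ?_)
    unfold connectedSum diagramSum
    rw [Finset.sum_mul_sum]
    exact Finset.sum_congr rfl fun s _ => Finset.sum_congr rfl fun t _ =>
      integral_rowProd_join lam (fun r => r ∈ S) hg s t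
  have hcomp : ∀ (σ : Setoid (Σ r, Fin (n r))) (S : Finset R),
      (Finset.univ.filter fun r => rowConn σ r₀ r) = S ↔ ∀ r, rowConn σ r₀ r ↔ r ∈ S := by
    intro σ S
    simp [Finset.ext_iff]
  have hconn : ∀ σ : Setoid (Σ r, Fin (n r)),
      (∀ r, rowConn σ r₀ r ↔ r ∈ Finset.univ) ↔ Connected σ := fun σ =>
    ⟨fun h i j => Setoid.trans' _ (Setoid.symm' _ ((h i).2 (Finset.mem_univ _)))
      ((h j).2 (Finset.mem_univ _)), fun h r => iff_of_true (h _ _) (Finset.mem_univ _)⟩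
  have hfib : diagramSum lam g = ∑ S : Finset R with r₀ ∈ S,
      ∑ σ : Setoid (Σ r, Fin (n r)) with (NonFlat σ ∧ GeTwo σ) ∧ ∀ r, rowConn σ r₀ r ↔ r ∈ S,
        ∫ x, rowProd g x ∂(diagMeasure lam σ) := by
    unfold diagramSum
    rw [← Finset.sum_fiberwise_of_maps_to
      (g := fun σ : Setoid (Σ r, Fin (n r)) => Finset.univ.filter fun r => rowConn σ r₀ r)
      (t := Finset.univ.filter fun S : Finset R => r₀ ∈ S)]
    · refine Finset.sum_congr rfl fun S _ => ?_
      rw [Finset.filter_filter]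
      simp_rw [hcomp]
    · intro σ _
      simp
  rw [hfib, ← Finset.sum_filter_add_sum_filter_not _ (fun S => S = Finset.univ)]
  congr 1
  · have h1 : ((Finset.univ.filter fun S : Finset R => r₀ ∈ S).filter
        fun S => S = Finset.univ) = {Finset.univ} := by
      ext S
      simp only [Finset.mem_filter, Finset.mem_univ, true_and, Finset.mem_singleton]
      exact ⟨fun h => h.2, fun h => ⟨h ▸ Finset.mem_univ _, h⟩⟩
    rw [h1, Finset.sum_singleton]
    simp_rw [hconn]
    unfold connectedSum
    simp_rw [and_assoc]
  · rw [Finset.filter_filter]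
    exact Finset.sum_congr rfl fun S hS => hsplit S (Finset.mem_filter.1 hS).2.1

end

lemma nonFlat_bot {R : Type} {A : R → Type} : NonFlat (⊥ : Setoid (Σ r, A r)) :=
  fun _ _ _ h => eq_of_heq (Sigma.mk.inj h).2

/-! ### Integrability for a part of the rows -/

/-- All integrals of `⊗ f_{n_r}` over non-flat partitions of a diagram with rows `R` exist. -/
def DiagramIntegrable {X : Type*} [MeasurableSpace X] (lam : Measure X)
    (f : (n : ℕ+) → (Fin (n : ℕ) → X) → ℝ) (R : Type) [Fintype R] : Prop :=
  ∀ (n : R → ℕ+) (σ : Setoid (Σ r, Fin (n r : ℕ))), NonFlat σ →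
    Integrable (rowProd fun r => f (n r)) (diagMeasure lam σ)

/-- The image of a product measure under the projection to some of the coordinates is absolutely
continuous, although not necessarily `σ`-finite. -/
lemma map_comp_injective_absolutelyContinuous {X ι Q : Type*} [MeasurableSpace X] [Fintype ι]
    [Fintype Q] (lam : Measure X) [SigmaFinite lam] {p : ι → Q} (hp : Function.Injective p) :
    ((Measure.pi fun _ : Q => lam).map fun z i => z (p i)) ≪ Measure.pi fun _ : ι => lam := by
  classical
  let e : Q ≃ ι ⊕ ↥(Set.range p)ᶜ :=
    ((Equiv.sumCongr (Equiv.ofInjective p hp) (Equiv.refl _)).trans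
      (Equiv.Set.sumCompl (Set.range p))).symm
  have he : ∀ i, e (p i) = Sum.inl i := by
    intro i
    rw [Equiv.symm_apply_eq]
    simp
  have : Fintype ↥(Set.range p)ᶜ := Fintype.ofFinite _
  rw [← map_merge_pi lam e, Measure.map_map (by fun_prop) (measurable_merge e)]
  have hfst : ((fun (z : Q → X) i => z (p i)) ∘ merge e) = Prod.fst := by
    ext x i
    simp [merge, he]
  rw [hfst]
  exact Measure.quasiMeasurePreserving_fst.absolutelyContinuous

lemma rowProd_ae_eq_zero {X : Type*} [MeasurableSpace X] {R : Type} [Fintype R] {n : R → ℕ}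
    (lam : Measure X) [SigmaFinite lam] {g : ∀ r, (Fin (n r) → X) → ℝ}
    {σ : Setoid (Σ r, Fin (n r))} (hσ : NonFlat σ) (r : R)
    (hr : g r =ᵐ[Measure.pi fun _ => lam] 0) : rowProd g =ᵐ[diagMeasure lam σ] 0 := by
  let := Fintype.ofFinite (Quotient σ)
  have hinj : Function.Injective fun a : Fin (n r) => Quotient.mk σ ⟨r, a⟩ := fun a b hab =>
    hσ r a b (Quotient.exact hab)
  have h1 := (map_comp_injective_absolutelyContinuous lam hinj).ae_eq hr
  have h2 : (diagMeasure lam σ).map (fun x (a : Fin (n r)) => x ⟨r, a⟩) =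
      (Measure.pi fun _ : Quotient σ => lam).map
        fun z (a : Fin (n r)) => z (Quotient.mk σ ⟨r, a⟩) := by
    unfold diagMeasure
    rw [Measure.map_map (by fun_prop) (by fun_prop)]
    rfl
  rw [← h2] at h1
  filter_upwards [ae_of_ae_map
    (measurable_pi_lambda _ fun a => measurable_pi_apply _).aemeasurable h1] with x hx
  exact Finset.prod_eq_zero (Finset.mem_univ r) hx

section

variable {X : Type*} [MeasurableSpace X] {lam : Measure X} [SigmaFinite lam]

lemma lintegral_rowProd_bot_ne_zero {R : Type} [Fintype R] {n : R → ℕ}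
    {g : ∀ r, (Fin (n r) → X) → ℝ} (hg : ∀ r, Measurable (g r))
    (hgi : ∀ r, Integrable (g r) (Measure.pi fun _ => lam))
    (h0 : ∀ r, ¬ g r =ᵐ[Measure.pi fun _ => lam] 0) :
    ∫⁻ x, ‖rowProd g x‖ₑ ∂(diagMeasure lam (⊥ : Setoid (Σ r, Fin (n r)))) ≠ 0 := by
  rw [diagMeasure_bot, pi_sigma, lintegral_map (measurable_rowProd hg).enorm (by fun_prop)]
  intro h
  have h1 := (lintegral_eq_zero_iff ((measurable_rowProd hg).enorm.comp (by fun_prop))).1 h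
  have h2 : ∫ y : ∀ r, Fin (n r) → X, ∏ r, ‖g r (y r)‖
      ∂(Measure.pi fun r => Measure.pi fun _ : Fin (n r) => lam) = 0 := by
    refine integral_eq_zero_of_ae ?_
    filter_upwards [h1] with y hy
    rw [← norm_prod]
    exact norm_eq_zero.2 (enorm_eq_zero.1 hy)
  rw [integral_fintype_prod_eq_prod (fun r (y : Fin (n r) → X) => ‖g r y‖)] at h2
  obtain ⟨r, -, hr⟩ := Finset.prod_eq_zero_iff.1 h2
  rw [integral_eq_zero_iff_of_nonneg (fun _ => norm_nonneg _) (hgi r).norm] at hr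
  refine h0 r ?_
  filter_upwards [hr] with y hy
  simpa using hy

/-- The integrability assumption passes to a part of the rows. If some `f_m` does not vanish almost
everywhere, then it may be placed in the other rows; otherwise all integrands vanish almost
everywhere. -/
lemma DiagramIntegrable.subtype {f : (n : ℕ+) → (Fin (n : ℕ) → X) → ℝ}
    (hf : ∀ n, Measurable (f n)) (hfi : ∀ n, Integrable (f n) (Measure.pi fun _ => lam))
    {R : Type} [Fintype R] (h : DiagramIntegrable lam f R) (p : R → Prop)
    [Fintype {r // p r}] : DiagramIntegrable lam f {r // p r} := by
  classical
  intro n σ hσ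
  by_cases hm : ∃ m, ¬ f m =ᵐ[Measure.pi fun _ => lam] 0
  · -- the remaining rows are filled with a function that does not vanish
    obtain ⟨m, hm⟩ := hm
    obtain ⟨N, hN⟩ := (Equiv.piEquivPiSubtypeProd p fun _ : R => ℕ+).surjective (n, fun _ => m)
    have hn : (fun r : {r // p r} => N r) = n := congrArg Prod.fst hN
    have hNm : ∀ r : {r // ¬ p r}, N r = m := congrFun (congrArg Prod.snd hN)
    subst hn
    have h1 := (h N (joinSetoid (rowSplit (fun r => Fin (N r : ℕ)) p) σ ⊥)
      ((nonFlat_join_rowSplit (A := fun r => Fin (N r : ℕ)) p σ ⊥).2 ⟨hσ, nonFlat_bot⟩)).2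
    unfold HasFiniteIntegral at h1
    rw [lintegral_rowProd_join lam p (fun r => hf (N r))] at h1
    refine ⟨(measurable_rowProd fun r => hf _).aestronglyMeasurable, ?_⟩
    refine ENNReal.lt_top_of_mul_ne_top_left h1.ne ?_
    refine lintegral_rowProd_bot_ne_zero (fun r => hf _) (fun r => hfi _) fun r => ?_
    rw [hNm r]
    exact hm
  · push Not at hm
    rcases isEmpty_or_nonempty {r // p r} with hE | ⟨⟨r⟩⟩
    · have : IsEmpty (Quotient σ) := ⟨fun q => by
        obtain ⟨c, -⟩ := Quotient.exists_rep q
        exact hE.elim c.1⟩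
      have : IsFiniteMeasure (diagMeasure lam σ) := by
        let := Fintype.ofFinite (Quotient σ)
        unfold diagMeasure
        rw [Measure.pi_of_empty]
        infer_instance
      have h1 : (rowProd fun r : {r // p r} => f (n r)) = fun _ => 1 := by
        ext x
        simp [rowProd]
      rw [h1]
      exact integrable_const _
    · exact (integrable_zero _ _ _).congr (rowProd_ae_eq_zero lam hσ r (hm _)).symm

end

/-! ### Cumulants as connected diagram sums -/

lemma sum_mem_apply_card {R : Type*} [Fintype R] [DecidableEq R] (r₀ : R) (G : ℕ → ℂ) {k : ℕ}
    (hk : Fintype.card R = k + 1) :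
    ∑ S : Finset R with r₀ ∈ S, G S.card =
      ∑ j ∈ Finset.range (k + 1), (k.choose j : ℂ) * G (j + 1) := by
  have hcard : (Finset.univ.erase r₀).card = k := by
    rw [Finset.card_erase_of_mem (Finset.mem_univ _), Finset.card_univ, hk]
    rfl
  have h1 : ∑ S : Finset R with r₀ ∈ S, G S.card =
      ∑ T ∈ (Finset.univ.erase r₀).powerset, G (T.card + 1) := by
    symm
    refine Finset.sum_bij' (fun T _ => insert r₀ T) (fun S _ => S.erase r₀) ?_ ?_ ?_ ?_ ?_
    · intro T _
      simp
    · intro S _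
      exact Finset.mem_powerset.2 (Finset.erase_subset_erase _ (Finset.subset_univ _))
    · intro T hT
      refine Finset.erase_insert fun h => ?_
      exact Finset.notMem_erase r₀ _ (Finset.mem_powerset.1 hT h)
    · intro S hS
      exact Finset.insert_erase (Finset.mem_filter.1 hS).2
    · intro T hT
      rw [Finset.card_insert_of_notMem fun h =>
        Finset.notMem_erase r₀ _ (Finset.mem_powerset.1 hT h)]
  rw [h1, Finset.sum_powerset_apply_card (fun j => G (j + 1)), hcard]
  simp [nsmul_eq_mul]

lemma hasSum_mul_subtype {R : Type} (p : R → Prop) [DecidablePred p]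
    {a : ({r // p r} → ℕ+) → ℂ} {b : ({r // ¬ p r} → ℕ+) → ℂ} {x y : ℂ} (ha : HasSum a x)
    (hb : HasSum b y) :
    HasSum (fun n : R → ℕ+ => a (fun r => n r) * b fun r => n r) (x * y) :=
  (Equiv.hasSum_iff (Equiv.piEquivPiSubtypeProd p fun _ : R => ℕ+)).2
    (ha.mul hb (summable_mul_of_summable_norm ha.summable.norm hb.summable.norm))

/-- If the moments up to order `ℓ` are sums of diagram sums, then the cumulants are the sums
over the connected diagrams. Both satisfy the same recursion: splitting off the component of a
row in a diagram corresponds to the recursion between moments and cumulants. -/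
lemma hasSum_connectedSum {Ω X : Type*} [MeasurableSpace Ω] [MeasurableSpace X] {P : Measure Ω}
    [IsProbabilityMeasure P] {F : Ω → ℝ} {lam : Measure X} [SigmaFinite lam]
    {f : (n : ℕ+) → (Fin (n : ℕ) → X) → ℝ} (hf : ∀ n, Measurable (f n))
    (hfi : ∀ n, Integrable (f n) (Measure.pi fun _ => lam)) {ℓ : ℕ}
    (hF : AEStronglyMeasurable F P) (hint : Integrable (fun ω => F ω ^ ℓ) P)
    (hmom : ∀ (R : Type) [Fintype R], Fintype.card R ≤ ℓ → DiagramIntegrable lam f R →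
      HasSum (fun n : R → ℕ+ => diagramSum lam fun r => f (n r))
        (∫ ω, F ω ^ Fintype.card R ∂P)) (k : ℕ) :
    ∀ (R : Type) [Fintype R], Fintype.card R = k + 1 → k + 1 ≤ ℓ → DiagramIntegrable lam f R →
      HasSum (fun n : R → ℕ+ => ((connectedSum lam fun r => f (n r) : ℝ) : ℂ))
        (cumulant P (k + 1) F) := by
  classical
  induction k using Nat.strong_induction_on with
  | _ k ih =>
    intro R _ hR hk hI
    obtain ⟨r₀⟩ : Nonempty R := Fintype.card_pos_iff.1 (by omega)
    let G : ℕ → ℂ := fun j => cumulant P j F * ((∫ ω, F ω ^ (k + 1 - j) ∂P : ℝ) : ℂ)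
    have hpart : ∀ S : Finset R, r₀ ∈ S ∧ S ≠ Finset.univ →
        HasSum (fun n : R → ℕ+ =>
          ((connectedSum lam (fun r : {r // r ∈ S} => f (n r)) : ℝ) : ℂ) *
            ((diagramSum lam (fun r : {r // r ∉ S} => f (n r)) : ℝ) : ℂ)) (G S.card) := by
      rintro S ⟨hr₀, hS⟩
      have hpos : 0 < S.card := Finset.card_pos.2 ⟨r₀, hr₀⟩
      have hlt : S.card < k + 1 := by
        rw [← hR]
        exact Finset.card_lt_univ_of_notMem (x := (not_forall.1 fun h =>
          hS (Finset.eq_univ_iff_forall.2 h)).choose)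
          (not_forall.1 fun h => hS (Finset.eq_univ_iff_forall.2 h)).choose_spec
      have h1 := ih (S.card - 1) (by omega) {r // r ∈ S} (by rw [Fintype.card_coe]; omega)
        (by omega) (hI.subtype hf hfi _)
      have hc : Fintype.card {r // r ∉ S} = k + 1 - S.card := by
        rw [Fintype.card_subtype_compl, Fintype.card_coe, hR]
      have h2 := hmom {r // r ∉ S} (by omega) (hI.subtype hf hfi _)
      rw [hc] at h2
      rw [Nat.sub_add_cancel hpos] at h1
      have h3 : HasSum (fun n : {r // r ∉ S} → ℕ+ =>
          ((diagramSum lam (fun r => f (n r)) : ℝ) : ℂ))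
          ((∫ ω, F ω ^ (k + 1 - S.card) ∂P : ℝ) : ℂ) := Complex.hasSum_ofReal.2 h2
      exact hasSum_mul_subtype (fun r => r ∈ S)
        (a := fun n => ((connectedSum lam (fun r : {r // r ∈ S} => f (n r)) : ℝ) : ℂ))
        (b := fun n => ((diagramSum lam (fun r : {r // r ∉ S} => f (n r)) : ℝ) : ℂ)) h1 h3
    have hall : HasSum (fun n : R → ℕ+ => ((diagramSum lam (fun r => f (n r)) : ℝ) : ℂ))
        ((∫ ω, F ω ^ Fintype.card R ∂P : ℝ) : ℂ) :=
      Complex.hasSum_ofReal.2 (hmom R (by omega) hI)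
    have htot := hall.sub
      (hasSum_sum (s := Finset.univ.filter fun S : Finset R => r₀ ∈ S ∧ S ≠ Finset.univ)
        fun S hS => hpart S (Finset.mem_filter.1 hS).2)
    -- the term `S = univ` of the recursion is the cumulant itself
    have hval : ((∫ ω, F ω ^ Fintype.card R ∂P : ℝ) : ℂ) -
        ∑ S : Finset R with r₀ ∈ S ∧ S ≠ Finset.univ, G S.card = cumulant P (k + 1) F := by
      have h1 : ∑ S : Finset R with r₀ ∈ S, G S.card = ((∫ ω, F ω ^ (k + 1) ∂P : ℝ) : ℂ) := by
        rw [sum_mem_apply_card r₀ G hR, moment_succ_eq_sum hF hint hk]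
        simp only [G, Nat.add_sub_add_right]
      have h2 : ∑ S : Finset R with r₀ ∈ S, G S.card = G (k + 1) +
          ∑ S : Finset R with r₀ ∈ S ∧ S ≠ Finset.univ, G S.card := by
        rw [← Finset.add_sum_erase _ _ (a := Finset.univ) (by simp), Finset.card_univ, hR]
        congr 1
        refine Finset.sum_congr ?_ fun _ _ => rfl
        ext S
        simp [and_comm]
      rw [hR, ← h1, h2]
      simp [G]
    rw [hval] at htot
    refine (congrArg (HasSum · _) (funext fun n => ?_)).mp htot
    rw [diagramSum_eq_sum_component lam (fun r => hf (n r)) r₀, Complex.ofReal_add,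
      Complex.ofReal_sum]
    simp only [Complex.ofReal_mul]
    exact add_sub_cancel_right _ _

/-! ### Partitions into blocks and equivalence relations -/

section

variable {ℓ : ℕ} {n : Fin ℓ → ℕ+}

/-- The equivalence relation whose classes are the blocks of a partition. -/
def blockSetoid (σ : Partn n) : Setoid (Cell n) := Setoid.ker (blockOf σ)

lemma blockSetoid_iff {σ : Partn n} {a b : Cell n} : blockSetoid σ a b ↔ b ∈ σ.part a := by
  change blockOf σ a = blockOf σ b ↔ _
  rw [blockOf, blockOf, Subtype.mk.injEq, eq_comm,
    σ.mem_part_iff_part_eq_part (Finset.mem_univ b) (Finset.mem_univ a)]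

lemma mem_of_blockSetoid {σ : Partn n} {a b : Cell n} {B : Finset (Cell n)} (hB : B ∈ σ.parts)
    (ha : a ∈ B) : blockSetoid σ a b ↔ b ∈ B := by
  rw [blockSetoid_iff, σ.part_eq_of_mem hB ha]

lemma blockOf_surjective (σ : Partn n) : Function.Surjective (blockOf σ) := by
  rintro ⟨B, hB⟩
  obtain ⟨a, ha⟩ := σ.nonempty_of_mem_parts hB
  exact ⟨a, Subtype.ext (σ.part_eq_of_mem hB ha)⟩

lemma blockSetoid_bijective : Function.Bijective (blockSetoid (n := n)) := by
  classical
  constructor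
  · intro σ τ h
    have hpart : ∀ a, σ.part a = τ.part a := by
      intro a
      ext b
      rw [← blockSetoid_iff, ← blockSetoid_iff, h]
    have hsub : ∀ {σ τ : Partn n}, (∀ a, σ.part a = τ.part a) → σ.parts ⊆ τ.parts := by
      intro σ τ h B hB
      obtain ⟨a, ha⟩ := σ.nonempty_of_mem_parts hB
      rw [← σ.part_eq_of_mem hB ha, h]
      exact τ.part_mem.2 (Finset.mem_univ a)
    exact Finpartition.ext (Finset.Subset.antisymm (hsub hpart) (hsub fun a => (hpart a).symm))
  · intro s
    refine ⟨Finpartition.ofSetoid s, ?_⟩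
    ext a b
    rw [blockSetoid_iff, Finpartition.mem_part_ofSetoid_iff_rel]

lemma nonFlat_blockSetoid (σ : Partn n) : NonFlat (blockSetoid σ) ↔ σ ∈ nonFlat n := by
  constructor
  · intro h B hB i
    rw [Finset.card_le_one]
    rintro ⟨i', a⟩ ha ⟨j', b⟩ hb
    obtain ⟨haB, rfl⟩ := Finset.mem_filter.1 ha
    obtain ⟨hbB, hij⟩ := Finset.mem_filter.1 hb
    dsimp only at hij
    subst hij
    rw [h _ a b ((mem_of_blockSetoid hB haB).2 hbB)]
  · intro h i a b hab
    have ha : (⟨i, a⟩ : Cell n) ∈ σ.part ⟨i, a⟩ := σ.mem_part (Finset.mem_univ _)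
    have h1 := Finset.card_le_one.1 (h (σ.part ⟨i, a⟩) (σ.part_mem.2 (Finset.mem_univ _)) i)
      ⟨i, a⟩ (Finset.mem_filter.2 ⟨ha, rfl⟩) ⟨i, b⟩
      (Finset.mem_filter.2 ⟨blockSetoid_iff.1 hab, rfl⟩)
    exact eq_of_heq (Sigma.mk.inj h1).2

lemma nonFlat_and_geTwo_blockSetoid (σ : Partn n) :
    NonFlat (blockSetoid σ) ∧ GeTwo (blockSetoid σ) ↔ σ ∈ nonFlatGeTwo n := by
  refine and_congr (nonFlat_blockSetoid σ) ⟨fun h B hB => ?_, fun h c hc => ?_⟩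
  · obtain ⟨a, ha⟩ := σ.nonempty_of_mem_parts hB
    have h1 := h a
    unfold IsSingletonBlock at h1
    push Not at h1
    obtain ⟨d, hd, hne⟩ := h1
    exact Finset.one_lt_card.2 ⟨a, ha, d, (mem_of_blockSetoid hB ha).1 hd, hne⟩
  · have hB : σ.part c ∈ σ.parts := σ.part_mem.2 (Finset.mem_univ c)
    obtain ⟨a, ha, b, hb, hne⟩ := Finset.one_lt_card.1 (h _ hB)
    exact hne ((hc a (blockSetoid_iff.2 ha)).symm.trans (hc b (blockSetoid_iff.2 hb)))

lemma rowPartition_eq_rowConn (σ : Partn n) : rowPartition σ = rowConn (blockSetoid σ) := by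
  unfold rowPartition rowConn
  congr 1
  ext i j
  constructor
  · rintro ⟨B, hB, ⟨⟨i, a⟩, ha, rfl⟩, ⟨j, b⟩, hb, rfl⟩
    exact ⟨a, b, (mem_of_blockSetoid hB ha).2 hb⟩
  · rintro ⟨a, b, hab⟩
    exact ⟨σ.part ⟨i, a⟩, σ.part_mem.2 (Finset.mem_univ _),
      ⟨_, σ.mem_part (Finset.mem_univ _), rfl⟩, ⟨_, blockSetoid_iff.1 hab, rfl⟩⟩

lemma connected_blockSetoid (hℓ : 1 ≤ ℓ) (σ : Partn n) :
    NonFlat (blockSetoid σ) ∧ GeTwo (blockSetoid σ) ∧ Connected (blockSetoid σ) ↔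
      σ ∈ connectedGeTwo n := by
  rw [← and_assoc, nonFlat_and_geTwo_blockSetoid]
  refine and_congr Iff.rfl ?_
  rw [rowPartition_eq_rowConn, Nat.card_eq_one_iff_unique]
  constructor
  · intro h
    refine ⟨⟨fun x y => ?_⟩, ⟨Quotient.mk _ ⟨0, hℓ⟩⟩⟩
    obtain ⟨i, rfl⟩ := Quotient.exists_rep x
    obtain ⟨j, rfl⟩ := Quotient.exists_rep y
    exact Quotient.sound (h i j)
  · rintro ⟨h, -⟩ i j
    exact Quotient.exact (h.elim _ _)

variable {X : Type*} [MeasurableSpace X] (lam : Measure X) [SigmaFinite lam]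
  {g : (i : Fin ℓ) → (Fin (n i : ℕ) → X) → ℝ}

lemma diagMeasure_blockSetoid (σ : Partn n) : diagMeasure lam (blockSetoid σ) =
    (Measure.pi fun _ : {B // B ∈ σ.parts} => lam).map fun z a => z (blockOf σ a) :=
  diagMeasure_eq_map lam _ (blockOf σ) (blockOf_surjective σ) rfl

lemma partitionIntegral_eq (hg : ∀ i, Measurable (g i)) (σ : Partn n) :
    partitionIntegral lam g σ = ∫ x, rowProd g x ∂(diagMeasure lam (blockSetoid σ)) := by
  rw [diagMeasure_blockSetoid, integral_map
    (measurable_pi_lambda _ fun a => measurable_pi_apply _).aemeasurable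
    (measurable_rowProd hg).aestronglyMeasurable]
  rfl

lemma integrable_rowProd_of_identify (hg : ∀ i, Measurable (g i)) (σ : Partn n)
    (h : Integrable (identify σ (tensor fun i x => |g i x|)) (Measure.pi fun _ => lam)) :
    Integrable (rowProd g) (diagMeasure lam (blockSetoid σ)) := by
  rw [diagMeasure_blockSetoid, integrable_map_measure
    (measurable_rowProd hg).aestronglyMeasurable
    (measurable_pi_lambda _ fun a => measurable_pi_apply _).aemeasurable]
  refine h.mono ((measurable_rowProd hg).comp
    (measurable_pi_lambda _ fun a => measurable_pi_apply _)).aestronglyMeasurable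
    (Filter.Eventually.of_forall fun z => ?_)
  simp [identify, tensor, rowProd]

open scoped Classical in
lemma sum_nonFlatGeTwo_eq (hg : ∀ i, Measurable (g i)) :
    ∑ σ : Partn n with σ ∈ nonFlatGeTwo n, partitionIntegral lam g σ = diagramSum lam g := by
  unfold diagramSum
  refine Finset.sum_bijective blockSetoid blockSetoid_bijective (fun σ => ?_)
    fun σ _ => partitionIntegral_eq lam hg σ
  simp only [Finset.mem_filter, Finset.mem_univ, true_and, nonFlat_and_geTwo_blockSetoid]

open scoped Classical in
lemma sum_connectedGeTwo_eq (hℓ : 1 ≤ ℓ) (hg : ∀ i, Measurable (g i)) :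
    ∑ σ : Partn n with σ ∈ connectedGeTwo n, partitionIntegral lam g σ = connectedSum lam g := by
  unfold connectedSum
  refine Finset.sum_bijective blockSetoid blockSetoid_bijective (fun σ => ?_)
    fun σ _ => partitionIntegral_eq lam hg σ
  simp only [Finset.mem_filter, Finset.mem_univ, true_and, connected_blockSetoid hℓ]

end

/-! ### Moments and cumulants of the chaos series -/

/-- The moments of order at most `ℓ` of the chaos series are sums of diagram sums. -/
lemma hasSum_diagramSum {Ω X : Type*} [MeasurableSpace Ω] [MeasurableSpace X]
    {P : Measure Ω} [IsProbabilityMeasure P] {lam : Measure X} [SigmaFinite lam]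
    {η : Ω → Measure X} (hη : IsPoissonProcess η lam P)
    {f : (n : ℕ+) → (Fin (n : ℕ) → X) → ℝ} (hf : ∀ n, IsL1Symm lam (f n)) {ℓ : ℕ} (hℓ : 1 ≤ ℓ)
    (hmom : ∫⁻ ω, (∑' n : ℕ+, ‖wienerIto lam (f n) (η ω)‖ₑ) ^ ℓ ∂P < ⊤) {R : Type} [Fintype R]
    (hR : Fintype.card R ≤ ℓ) (hI : DiagramIntegrable lam f R) :
    Integrable (fun ω => chaosSum η lam f ω ^ Fintype.card R) P ∧
    HasSum (fun n : R → ℕ+ => diagramSum lam fun r => f (n r))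
      (∫ ω, chaosSum η lam f ω ^ Fintype.card R ∂P) := by
  have hW : ∀ n, AEStronglyMeasurable (fun ω => wienerIto lam (f n) (η ω)) P := fun n =>
    (integrable_wienerIto hη (hf n).measurable (hf n).integrable).aestronglyMeasurable
  obtain ⟨h1, h2⟩ := hasSum_integral_prod hW (ae_tsum_lt_top hℓ hW hmom) (R := R)
    (lintegral_pow_lt_top_of_le hR hmom)
  refine ⟨h1, (congrArg (HasSum · _) (funext fun n => ?_)).mp h2⟩
  exact (integral_prod_wienerIto hη (fun r => (hf (n r)).measurable)
    (fun r => (hf (n r)).integrable) (hI n)).2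

end PoissonChaos

end
open PoissonChaos in
open scoped Classical in
theorem corollaryc2 {Ω X : Type*} [MeasurableSpace Ω] [MeasurableSpace X]
    (P : Measure Ω) [IsProbabilityMeasure P] (lam : Measure X) [SigmaFinite lam]
    (η : Ω → Measure X) (hη : IsPoissonProcess η lam P)
    (f : (n : ℕ+) → (Fin (n : ℕ) → X) → ℝ) (hf : ∀ n, IsL1Symm lam (f n))
    (ℓ : ℕ) (hℓ : 1 ≤ ℓ)
    (hint : ∀ n : Fin ℓ → ℕ+, ∀ σ ∈ nonFlat n,
      Integrable (identify σ (tensor fun i x => |f (n i) x|)) (Measure.pi fun _ => lam))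
    (hmom : ∫⁻ ω, (∑' n : ℕ+, ‖wienerIto lam (f n) (η ω)‖ₑ) ^ ℓ ∂P < ⊤) :
    Integrable (fun ω => chaosSum η lam f ω ^ ℓ) P ∧
    HasSum
      (fun n : Fin ℓ → ℕ+ => ∑ σ : Partn n with σ ∈ nonFlatGeTwo n,
        partitionIntegral lam (fun i => f (n i)) σ)
      (∫ ω, chaosSum η lam f ω ^ ℓ ∂P) ∧
    HasSum
      (fun n : Fin ℓ → ℕ+ => ((∑ σ : Partn n with σ ∈ connectedGeTwo n,
        partitionIntegral lam (fun i => f (n i)) σ : ℝ) : ℂ))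
      (cumulant P ℓ (chaosSum η lam f)) := by
  have hfm : ∀ n, Measurable (f n) := fun n => (hf n).measurable
  have hI : DiagramIntegrable lam f (Fin ℓ) := by
    intro n s hs
    obtain ⟨σ, rfl⟩ := blockSetoid_bijective.surjective s
    exact integrable_rowProd_of_identify lam (fun i => hfm (n i)) σ
      (hint n σ ((nonFlat_blockSetoid σ).1 hs))
  have hW : ∀ n, AEStronglyMeasurable (fun ω => wienerIto lam (f n) (η ω)) P := fun n =>
    (integrable_wienerIto hη (hfm n) (hf n).integrable).aestronglyMeasurable
  have hF : AEStronglyMeasurable (chaosSum η lam f) P :=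
    aestronglyMeasurable_tsum hW (ae_tsum_lt_top hℓ hW hmom)
  obtain ⟨h1, h2⟩ := hasSum_diagramSum hη hf hℓ hmom (R := Fin ℓ) (by simp) hI
  rw [Fintype.card_fin] at h1 h2
  have hn2 : ∀ n : Fin ℓ → ℕ+, ∑ σ : Partn n with σ ∈ nonFlatGeTwo n,
      partitionIntegral lam (fun i => f (n i)) σ = diagramSum lam fun i => f (n i) := fun n =>
    sum_nonFlatGeTwo_eq lam fun i => hfm (n i)
  have hn3 : ∀ n : Fin ℓ → ℕ+, ∑ σ : Partn n with σ ∈ connectedGeTwo n,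
      partitionIntegral lam (fun i => f (n i)) σ = connectedSum lam fun i => f (n i) := fun n =>
    sum_connectedGeTwo_eq lam hℓ fun i => hfm (n i)
  simp_rw [hn2, hn3]
  refine ⟨h1, h2, ?_⟩
  have h3 := hasSum_connectedSum hfm (fun n => (hf n).integrable) hF h1
    (fun R _ hR hIR => (hasSum_diagramSum hη hf hℓ hmom hR hIR).2) (ℓ - 1) (Fin ℓ)
    (by rw [Fintype.card_fin]; omega) (by omega) hI
  rwa [Nat.sub_add_cancel hℓ] at h3
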